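/- **Setting.** A function $p:\{-1,1\}^n\to\mathbb R$ is identified with its multilinear expansion $p(x)=\sum_{S\subseteq[n]}\widehat p(S)\prod_{j\in S}x_j$; put $\|p\|_1=\sum_S|\widehat p(S)|$ and $\|p\|_\infty=\max_S|\widehat p(S)|$. A Hamiltonian $\psi$ defines a $(k,d,\lambda)$-Markov random field $\mu_\psi(x)\propto e^{\psi(x)}$ if $\deg\psi\le k$ and, for every $i$, the neighborhood $\mathcal N(i)$ (the set of variables occurring in $\partial_i\psi$) has at most $d$ elements and $\|\partial_i\psi\|_1\le\lambda$. The discrete-time Glauber dynamics $(X^t)_{t\ge0}$ starts at an arbitrary (possibly random) configuration; at each time $t\ge1$ a uniformly random site $i_t$ is chosen and $X^t$ is obtained from $X^{t-1}$ by resampling this coordinate, which becomes $+1$ with probability $\sigma(2\,\partial_{i_t}\psi(X^{t-1}))$, where $\sigma(z)=1/(1+e^{-z})$. For a node $i$ let $\tau_0=0$ and $\tau_{m+1}=\inf\{t\ge\tau_m+4\log(d)\,n:\ i_t=i\}$. The $T$ samples for node $i$ are $X^{\tau_1},\dots,X^{\tau_T}$. Let $P_i$ be the set of polynomials in the variables $\mathcal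 N(i)$ of degree at most $k$ with $\|p\|_1\le\lambda$. Logistic regression for node $i$ outputs a minimizer $\widehat p_i$ over $p\in P_i$ of the empirical loss $$L_i(p)=\frac1T\sum_{m=1}^T\log\bigl(1+\exp(-2X_i^{\tau_m}\,p(X^{\tau_m}))\bigr).$$ **Theorem.** For every $\lambda_0>0$ there is a constant $C>0$, depending only on $\lambda_0$, such that the following holds for all $n\ge1$, $d\ge3$, $k\ge1$, $\lambda\ge\lambda_0$, $\varepsilon>0$, $\delta\in(0,1)$ and every $(k,d,\lambda)$-Markov random field on $\{-1,1\}^n$ with Hamiltonian $\psi$. Put $$A(\delta)=\frac{\lambda^2\,k\,\log(d/\delta)\,d^{C\lambda k^2}}{\varepsilon^4},\qquad T_0(\delta)=C\,A(\delta)\,\bigl(\log(3+A(\delta))\bigr)^C .$$ 1. If $T\ge T_0(\delta)$, then for each node $i$, with probability at least $1-\delta$, minimizers $\widehat p_i$ exist and every one of them satisfies $\|\widehat p_i-\partial_i\psi\|_\infty\le\varepsilon$. 2. If $T\ge T_0(\delta/n)$, then with probability at least $1-\delta$ minimizers exist for all nodes, and whatever minimizers $\widehat p_1,\dots,\widehat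 p_n$ are chosen, the polynomial $\widehat\psi$ with coefficients $\widehat\psi(\emptyset)=0$ and $\widehat\psi(S)=\widehat p_{\min S}(S\setminus\{\min S\})$ for $S\ne\emptyset$ satisfies $\|\widehat\psi-(\psi-c)\|_\infty\le\varepsilon$, where $c$ is the constant coefficient of $\psi$ (which does not affect $\mu_\psi$). 3. (Efficiency.) Let $T\ge T_0(\delta/n)$, and let the neighborhoods be known: sets $N_1,\dots,N_n\subseteq[n]$ with $|N_i|\le d$ are given. Then there are maps sending every possible array of $T$ configurations for node $i$ to a polynomial $q_i$ in the variables $N_i$, of degree at most $k$, with $\|q_i\|_1\le\lambda$, whose empirical loss for node $i$ is within $\varepsilon$ of the minimum over such polynomials; all coefficients of the polynomial $\tilde\psi$ assembled from $q_1,\dots,q_n$ as in part 2 are computed, from the spins of $i$ and of $N_i$ in the samples of each node $i$, by one straight-line program over $\mathbb R$ with instructions constant, $+,-,\times,/,\exp$ and with at most $$n\cdot C\,d^{C\lambda k^2}\bigl(T(1+1/\varepsilon)\bigr)^C$$ instructions; and for every $(k,d,\lambda)$-Markov random field with neighborhoods $\mathcal N(i)=N_i$, with probability at least $1-\delta$,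 $\|\tilde\psi-(\psi-c)\|_\infty\le\varepsilon$. -/

import Mathlib

namespace GlauberMRF

noncomputable section

/-! ### Multilinear polynomials on the hypercube -/

/-- A configuration in `{-1,1}^n`. -/
abbrev Config (n : ℕ) : Type := Fin n → ℤˣ

/-- The value `x_j ∈ {-1,1}` as a real number. -/
def spin {n : ℕ} (x : Config n) (j : Fin n) : ℝ := ((x j : ℤ) : ℝ)

/-- A multilinear polynomial in `x_1, …, x_n`, represented by its coefficients: `p S` is the
coefficient of the monomial `∏ j ∈ S, x_j`. Every function `{-1,1}^n → ℝ` has exactly one such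
representation. -/
abbrev MPoly (n : ℕ) : Type := Finset (Fin n) → ℝ

/-- The value of a multilinear polynomial at a configuration. -/
def MPoly.eval {n : ℕ} (p : MPoly n) (x : Config n) : ℝ :=
  ∑ S : Finset (Fin n), p S * ∏ j ∈ S, spin x j

/-- `p` has degree at most `k`. -/
def MPoly.DegreeLE {n : ℕ} (p : MPoly n) (k : ℕ) : Prop :=
  ∀ S, p S ≠ 0 → S.card ≤ k

/-- The partial derivative `∂_i p`. -/
def MPoly.pderiv {n : ℕ} (i : Fin n) (p : MPoly n) : MPoly n :=
  fun S => if i ∈ S then 0 else p (insert i S)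

/-- The Fourier `1`-norm: the sum of the absolute values of the coefficients. -/
def MPoly.l1Norm {n : ℕ} (p : MPoly n) : ℝ := ∑ S : Finset (Fin n), |p S|

/-- The Fourier `∞`-norm: the maximum of the absolute values of the coefficients. -/
def MPoly.supNorm {n : ℕ} (p : MPoly n) : ℝ :=
  Finset.univ.sup' Finset.univ_nonempty (fun S : Finset (Fin n) => |p S|)

/-- The polynomial with its constant coefficient removed. -/
def MPoly.dropConst {n : ℕ} (p : MPoly n) : MPoly n := Function.update p ∅ 0

open Classical in
/-- The neighborhood `N(i)`: the variables that occur in `∂_i ψ`. -/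
def neighbors {n : ℕ} (ψ : MPoly n) (i : Fin n) : Finset (Fin n) :=
  Finset.univ.filter fun j => ∃ S, j ∈ S ∧ ψ.pderiv i S ≠ 0

/-- `ψ` is the Hamiltonian of a `(k,d,lam)`-Markov random field `μ(x) ∝ exp (ψ x)`: order at most
`k`, at most `d` neighbors of every site, and width at most `lam`. -/
structure IsMRF {n : ℕ} (k d : ℕ) (lam : ℝ) (ψ : MPoly n) : Prop where
  degree : ψ.DegreeLE k
  card_neighbors : ∀ i, (neighbors ψ i).card ≤ d
  width : ∀ i, (ψ.pderiv i).l1Norm ≤ lam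

/-! ### Discrete-time Glauber dynamics -/

/-- The sigmoid function. -/
def sigm (z : ℝ) : ℝ := 1 / (1 + Real.exp (-z))

/-- The probability that site `i`, when it is updated in the configuration `x`, receives the
spin `e`. It does not depend on `x i`. -/
def updateProb {n : ℕ} (ψ : MPoly n) (x : Config n) (i : Fin n) (e : ℤˣ) : ℝ :=
  if e = 1 then sigm (2 * (ψ.pderiv i).eval x) else 1 - sigm (2 * (ψ.pderiv i).eval x)

open Classical in
/-- The one-step transition probability from the configuration `x`: choose the site `i` uniformly
at random, resample its spin, and arrive at the configuration `y`. -/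
def stepProb {n : ℕ} (ψ : MPoly n) (x : Config n) (i : Fin n) (y : Config n) : ℝ :=
  if ∀ j, j ≠ i → y j = x j then (1 / (n : ℝ)) * updateProb ψ x i (y i) else 0

/-- The event that up to time `t` the configurations are `x 0, …, x t` and the updated sites are
`u 1, …, u t`. -/
def history {Ω : Type*} {n : ℕ} (X : ℕ → Ω → Config n) (U : ℕ → Ω → Fin n) (t : ℕ)
    (x : ℕ → Config n) (u : ℕ → Fin n) : Set Ω :=
  {ω | (∀ s, s ≤ t → X s ω = x s) ∧ ∀ s, 1 ≤ s → s ≤ t → U s ω = u s}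

/-- `X 0, X 1, …` with updated sites `U 1, U 2, …` is a trajectory of the discrete-time Glauber
dynamics for `ψ`, with an arbitrary (possibly random) initial configuration: given any history up to
time `t`, the next site and the next configuration have the law `stepProb ψ (X t)`.
The variable `U 0` plays no role. -/
structure IsGlauber {Ω : Type*} [MeasurableSpace Ω] {n : ℕ} (ψ : MPoly n)
    (P : MeasureTheory.Measure Ω) (X : ℕ → Ω → Config n) (U : ℕ → Ω → Fin n) : Prop where
  measurable_config : ∀ t x, MeasurableSet {ω | X t ω = x}
  measurable_site : ∀ t i, MeasurableSet {ω | U t ω = i}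
  step : ∀ (t : ℕ) (x : ℕ → Config n) (u : ℕ → Fin n),
    P (history X U (t + 1) x u) =
      P (history X U t x u) * ENNReal.ofReal (stepProb ψ (x t) (u (t + 1)) (x (t + 1)))

/-- For a sequence `u` of updated sites: `τ_0 = 0`, and `τ_{m+1}` is the first time
`t ≥ τ_m + 4 log(d) n` at which site `i` is updated (`0` if there is none, which has
probability zero). -/
def tau {n : ℕ} (d : ℕ) (i : Fin n) (u : ℕ → Fin n) : ℕ → ℕ
  | 0 => 0
  | m + 1 => sInf {t : ℕ | (tau d i u m : ℝ) + 4 * Real.log d * n ≤ t ∧ u t = i}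

/-- The `T` generated samples for node `i`: the configurations at the times `τ_1, …, τ_T`. -/
def samples {Ω : Type*} {n : ℕ} (d : ℕ) (X : ℕ → Ω → Config n) (U : ℕ → Ω → Fin n)
    (i : Fin n) (T : ℕ) (ω : Ω) : Fin T → Config n :=
  fun m => X (tau d i (fun t => U t ω) (m + 1)) ω

/-! ### Node-wise logistic regression -/

/-- The logistic loss. -/
def logisticLoss (z : ℝ) : ℝ := Real.log (1 + Real.exp (-z))

/-- The polynomials of degree at most `k` in the variables `N` with `1`-norm at most `lam`. -/
def feasible {n : ℕ} (N : Finset (Fin n)) (k : ℕ) (lam : ℝ) : Set (MPoly n) :=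
  {p | (∀ S, p S ≠ 0 → S ⊆ N) ∧ p.DegreeLE k ∧ p.l1Norm ≤ lam}

/-- The empirical logistic loss of `p` for node `i` on the samples `Z`. -/
def empLoss {n T : ℕ} (i : Fin n) (Z : Fin T → Config n) (p : MPoly n) : ℝ :=
  (1 / (T : ℝ)) * ∑ m : Fin T, logisticLoss (2 * spin (Z m) i * p.eval (Z m))

/-- `p` is an output of logistic regression for node `i` with neighborhood `N`. -/
def IsLogReg {n T : ℕ} (i : Fin n) (N : Finset (Fin n)) (k : ℕ) (lam : ℝ)
    (Z : Fin T → Config n) (p : MPoly n) : Prop :=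
  p ∈ feasible N k lam ∧ ∀ q ∈ feasible N k lam, empLoss i Z p ≤ empLoss i Z q

/-- The polynomial on `{-1,1}^n` put together from node-wise polynomials `p i` (estimates of
`∂_i ψ`): the coefficient of a nonempty `S` is read off from the node `min S`. -/
def assemble {n : ℕ} (p : Fin n → MPoly n) : MPoly n :=
  fun S => if h : S.Nonempty then p (S.min' h) (S.erase (S.min' h)) else 0

/-! ### Rates and operation counts -/

/-- The quantity `A = lam² k log(d/δ) d^(C lam k²) / ε⁴`. -/
def rate (C : ℝ) (k d : ℕ) (lam ε δ : ℝ) : ℝ :=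
  lam ^ 2 * k * Real.log (d / δ) * (d : ℝ) ^ (C * lam * (k : ℝ) ^ 2) / ε ^ 4

/-- The sample size `C A log(3 + A)^C`, that is, `A` up to a factor polylogarithmic in `A`. -/
def sampleBound (C : ℝ) (k d : ℕ) (lam ε δ : ℝ) : ℝ :=
  C * rate C k d lam ε δ * (Real.log (3 + rate C k d lam ε δ)) ^ C

/-- Straight-line programs over the reals: `Computes inputs m R` says that some program with `m`
instructions, started with the functions `inputs` of the data in its registers, ends with the
functions `R` of the data in its registers. An instruction writes a constant, or the result of one
operation `+`, `-`, `*`, `/`, `exp` on registers, into a new register. -/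
inductive Computes {D : Type*} (inputs : Set (D → ℝ)) : ℕ → Set (D → ℝ) → Prop
  | start : Computes inputs 0 inputs
  | const {m : ℕ} {R : Set (D → ℝ)} (c : ℝ) (h : Computes inputs m R) :
      Computes inputs (m + 1) (insert (fun _ => c) R)
  | add {m : ℕ} {R : Set (D → ℝ)} {f g : D → ℝ} (h : Computes inputs m R) (hf : f ∈ R)
      (hg : g ∈ R) : Computes inputs (m + 1) (insert (fun z => f z + g z) R)
  | sub {m : ℕ} {R : Set (D → ℝ)} {f g : D → ℝ} (h : Computes inputs m R) (hf : f ∈ R)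
      (hg : g ∈ R) : Computes inputs (m + 1) (insert (fun z => f z - g z) R)
  | mul {m : ℕ} {R : Set (D → ℝ)} {f g : D → ℝ} (h : Computes inputs m R) (hf : f ∈ R)
      (hg : g ∈ R) : Computes inputs (m + 1) (insert (fun z => f z * g z) R)
  | div {m : ℕ} {R : Set (D → ℝ)} {f g : D → ℝ} (h : Computes inputs m R) (hf : f ∈ R)
      (hg : g ∈ R) : Computes inputs (m + 1) (insert (fun z => f z / g z) R)
  | exp {m : ℕ} {R : Set (D → ℝ)} {f : D → ℝ} (h : Computes inputs m R) (hf : f ∈ R) :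
      Computes inputs (m + 1) (insert (fun z => Real.exp (f z)) R)

/-- The data read by the node-wise regressions: for every node `i`, the spins of `i` and of its
neighbors in the `T` samples for node `i`. -/
def dataInputs {n : ℕ} (T : ℕ) (N : Fin n → Finset (Fin n)) :
    Set ((Fin n → Fin T → Config n) → ℝ) :=
  {f | ∃ (i : Fin n) (m : Fin T) (j : Fin n), j ∈ insert i (N i) ∧ f = fun z => spin (z i m) j}

end

end GlauberMRF

open GlauberMRF

/-!
Between two consecutive samples for node `i` there are at least `n` unrestricted steps. Given a set
`S` of at most `k` neighbours, with probability at least of order `d ^ (-(k + 1))` the last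
`|S| * (n / |N(i)|)` of them update each site of `S` exactly once and no other neighbour, and no
neighbour is updated while waiting for `i`. An update of `j` with both outcomes of probability at
least `e ^ (-2λ) / 2` turns the mean of `r ^ 2` into at least `e ^ (-2λ) (∂_j r) ^ 2`, so
conditionally on the previous sample the second moment of a polynomial `r` of degree `k` on the
neighbourhood is at least of order `(e ^ (-2λ) / d) ^ k / d * (∂_S r) ^ 2`. As `∂_S r` is the
coefficient of `S` plus contributions of strictly larger sets, downward induction on `S` bounds all
coefficients by the second moment.

Since site `i` has just been resampled, the conditional mean of the gradient of the logistic loss at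
`∂_i ψ` vanishes. The loss is strongly convex on the range allowed by the `ℓ¹` constraint, and only
about `d ^ (2 * k)` monomials have to concentrate, which Chernoff bounds along the chain of samples
provide; so a small excess loss forces a small coefficient error. Exponentiated gradient descent
over the `ℓ¹` ball reaches a small excess loss after polynomially many rounds of arithmetic and
exponentials.
-/

namespace GlauberMRF

noncomputable section

open Matrix MeasureTheory Finset

variable {n : ℕ}

/-! ### Multilinear polynomials -/

theorem spin_eq_one_or_neg_one (x : Config n) (j : Fin n) : spin x j = 1 ∨ spin x j = -1 := by
  rcases Int.units_eq_one_or (x j) with h | h <;> simp [spin, h]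

theorem abs_spin (x : Config n) (j : Fin n) : |spin x j| = 1 := by
  rcases spin_eq_one_or_neg_one x j with h | h <;> simp [h]

/-- The monomial `∏ j ∈ S, x_j`. -/
def chi (S : Finset (Fin n)) (x : Config n) : ℝ := ∏ j ∈ S, spin x j

theorem abs_chi (S : Finset (Fin n)) (x : Config n) : |chi S x| = 1 := by
  rw [chi, abs_prod]
  exact prod_eq_one fun j _ => abs_spin x j

theorem chi_congr {S : Finset (Fin n)} {x y : Config n} (h : ∀ j ∈ S, x j = y j) :
    chi S x = chi S y :=
  prod_congr rfl fun j hj => by rw [spin, spin, h j hj]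

theorem chi_update_of_notMem {S : Finset (Fin n)} {j : Fin n} (hj : j ∉ S) (x : Config n)
    (e : ℤˣ) : chi S (Function.update x j e) = chi S x :=
  chi_congr fun _ hl => Function.update_of_ne (ne_of_mem_of_not_mem hl hj) e x

theorem chi_insert_update {S : Finset (Fin n)} {j : Fin n} (hj : j ∉ S) (x : Config n) (e : ℤˣ) :
    chi (insert j S) (Function.update x j e) = ((e : ℤ) : ℝ) * chi S x := by
  rw [chi, prod_insert hj, ← chi, chi_update_of_notMem hj, spin, Function.update_self]

theorem sum_eq_sum_powerset_erase {α β : Type*} [Fintype α] [DecidableEq α] [AddCommMonoid β]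
    (j : α) (f : Finset α → β) :
    ∑ S, f S = ∑ S ∈ (univ.erase j).powerset, (f S + f (insert j S)) := by
  rw [sum_add_distrib, ← sum_powerset_insert (notMem_erase j _), insert_erase (mem_univ j),
    powerset_univ]

namespace MPoly

theorem eval_eq_sum_chi (p : MPoly n) (x : Config n) : p.eval x = ∑ S, p S * chi S x := rfl

theorem eval_sub (p q : MPoly n) (x : Config n) : (p - q).eval x = p.eval x - q.eval x := by
  simp [eval_eq_sum_chi, sub_mul]

theorem abs_eval_le (p : MPoly n) (x : Config n) : |p.eval x| ≤ p.l1Norm := by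
  refine (abs_sum_le_sum_abs _ _).trans_eq (sum_congr rfl fun S _ => ?_)
  rw [← chi, abs_mul, abs_chi, mul_one]

theorem l1Norm_nonneg (p : MPoly n) : 0 ≤ p.l1Norm := sum_nonneg fun _ _ => abs_nonneg _

theorem l1Norm_sub_le (p q : MPoly n) : (p - q).l1Norm ≤ p.l1Norm + q.l1Norm := by
  simp only [l1Norm, ← sum_add_distrib]
  exact sum_le_sum fun S _ => abs_sub (p S) (q S)

theorem supNorm_le_iff {p : MPoly n} {b : ℝ} : p.supNorm ≤ b ↔ ∀ S, |p S| ≤ b := by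
  simp [supNorm]

theorem abs_le_supNorm (p : MPoly n) (S : Finset (Fin n)) : |p S| ≤ p.supNorm :=
  supNorm_le_iff.1 le_rfl S

theorem supNorm_nonneg (p : MPoly n) : 0 ≤ p.supNorm :=
  (abs_nonneg _).trans (p.abs_le_supNorm ∅)

theorem pderiv_of_notMem (p : MPoly n) {j : Fin n} {S : Finset (Fin n)} (hj : j ∉ S) :
    p.pderiv j S = p (insert j S) := if_neg hj

theorem eval_update_sub (p : MPoly n) (j : Fin n) (x : Config n) :
    p.eval (Function.update x j 1) - p.eval (Function.update x j (-1))
      = 2 * (p.pderiv j).eval x := by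
  simp only [eval_eq_sum_chi, sum_eq_sum_powerset_erase j, ← sum_sub_distrib, mul_sum]
  refine sum_congr rfl fun S hS => ?_
  have hj : j ∉ S := fun h => notMem_erase j _ (mem_powerset.1 hS h)
  have hins : p.pderiv j (insert j S) = 0 := if_pos (mem_insert_self j S)
  simp only [chi_update_of_notMem hj, chi_insert_update hj, p.pderiv_of_notMem hj, hins,
    Units.val_one, Units.val_neg, Int.cast_neg, Int.cast_one]
  ring

/-- Only the variables in `N` occur in `p`. -/
def VarsIn (p : MPoly n) (N : Finset (Fin n)) : Prop := ∀ S, p S ≠ 0 → S ⊆ N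

theorem insert_coeff_ne_zero {p : MPoly n} {j : Fin n} {S : Finset (Fin n)}
    (h : p.pderiv j S ≠ 0) : p (insert j S) ≠ 0 := fun h0 => h (by simp [pderiv, h0])

variable {p : MPoly n} {N : Finset (Fin n)}

theorem VarsIn.eval_congr (hp : p.VarsIn N) {x y : Config n} (h : ∀ j ∈ N, x j = y j) :
    p.eval x = p.eval y := by
  refine sum_congr rfl fun S _ => ?_
  by_cases hS : p S = 0
  · rw [hS, zero_mul, zero_mul]
  · exact congrArg (p S * ·) (chi_congr fun j hj => h j (hp S hS hj))

theorem VarsIn.eval_update (hp : p.VarsIn N) {j : Fin n} (hj : j ∉ N) (x : Config n) (e : ℤˣ) :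
    p.eval (Function.update x j e) = p.eval x :=
  hp.eval_congr fun _ hl => Function.update_of_ne (ne_of_mem_of_not_mem hl hj) _ _

theorem VarsIn.sub {q : MPoly n} (hp : p.VarsIn N) (hq : q.VarsIn N) : (p - q).VarsIn N := by
  intro S hS
  by_contra hN
  exact hS (by simp [not_imp_comm.1 (hp S) hN, not_imp_comm.1 (hq S) hN])

theorem DegreeLE.sub {q : MPoly n} {k : ℕ} (hp : p.DegreeLE k) (hq : q.DegreeLE k) :
    (p - q).DegreeLE k := by
  intro S hS
  by_contra hk
  exact hS (by simp [not_imp_comm.1 (hp S) hk, not_imp_comm.1 (hq S) hk])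

theorem VarsIn.pderiv (hp : p.VarsIn N) (j : Fin n) : (p.pderiv j).VarsIn N := fun S hS =>
  (subset_insert j S).trans (hp _ (insert_coeff_ne_zero hS))

theorem DegreeLE.pderiv {k : ℕ} (hp : p.DegreeLE k) (j : Fin n) : (p.pderiv j).DegreeLE k :=
  fun S hS => (card_le_card (subset_insert j S)).trans (hp _ (insert_coeff_ne_zero hS))

/-- The iterated partial derivative `∂_S p`. -/
def iterDeriv (S : Finset (Fin n)) (p : MPoly n) : MPoly n :=
  fun T => if Disjoint S T then p (S ∪ T) else 0

theorem iterDeriv_empty (p : MPoly n) : p.iterDeriv ∅ = p := by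
  funext T
  simp [iterDeriv]

theorem iterDeriv_pderiv (p : MPoly n) {j : Fin n} {S : Finset (Fin n)} (hj : j ∉ S) :
    (p.pderiv j).iterDeriv S = p.iterDeriv (insert j S) := by
  funext T
  by_cases hT : j ∈ T <;> simp [iterDeriv, MPoly.pderiv, disjoint_insert_left, hj, hT]

theorem eval_iterDeriv (S : Finset (Fin n)) (p : MPoly n) (x : Config n) :
    (p.iterDeriv S).eval x = ∑ T with S ⊆ T, p T * chi (T \ S) x := by
  simp only [eval_eq_sum_chi, iterDeriv, ite_mul, zero_mul, ← sum_filter]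
  refine sum_nbij' (S ∪ ·) (· \ S) ?_ ?_ ?_ ?_ ?_ <;> intro T hT <;>
    simp only [mem_filter_univ] at hT ⊢
  · exact subset_union_left
  · exact disjoint_sdiff
  · rw [union_sdiff_cancel_left hT]
  · exact union_sdiff_of_subset hT
  · rw [union_sdiff_cancel_left hT]

theorem abs_coeff_le (S : Finset (Fin n)) (p : MPoly n) (x : Config n) :
    |p S| ≤ |(p.iterDeriv S).eval x| + ∑ T with S ⊂ T, |p T| := by
  have heval : (p.iterDeriv S).eval x = p S + ∑ T with S ⊂ T, p T * chi (T \ S) x := by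
    have hfilter : univ.filter (S ⊆ ·) = insert S (univ.filter (S ⊂ ·)) := by
      ext T
      simp [subset_iff_ssubset_or_eq, or_comm, eq_comm]
    rw [eval_iterDeriv, hfilter, sum_insert (by simp), sdiff_self]
    simp [chi]
  calc |p S| = |(p.iterDeriv S).eval x - ∑ T with S ⊂ T, p T * chi (T \ S) x| := by simp [heval]
    _ ≤ |(p.iterDeriv S).eval x| + |∑ T with S ⊂ T, p T * chi (T \ S) x| := abs_sub _ _
    _ ≤ |(p.iterDeriv S).eval x| + ∑ T with S ⊂ T, |p T| := by
      gcongr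
      refine (abs_sum_le_sum_abs _ _).trans_eq (sum_congr rfl fun T _ => ?_)
      rw [abs_mul, abs_chi, mul_one]

end MPoly

/-! ### The logistic loss -/

theorem exp_le_add_exp_sq (z : ℝ) : Real.exp z ≤ z + Real.exp (z ^ 2) := by
  have hsq := Real.add_one_le_exp (z ^ 2)
  rcases le_or_gt |z| 1 with hz | hz
  · linarith [(abs_le.1 (Real.abs_exp_sub_one_sub_id_le hz)).2]
  rcases lt_abs.1 hz with hz | hz
  · have : Real.exp z ≤ Real.exp (z ^ 2) := Real.exp_le_exp.2 (by nlinarith)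
    linarith
  · have : Real.exp z ≤ 1 := Real.exp_le_one_iff.2 (by linarith)
    nlinarith

theorem sigm_eq_sigmoid : sigm = Real.sigmoid := by
  funext z
  rw [sigm, Real.sigmoid_def, one_div]

theorem sigm_pos (z : ℝ) : 0 < sigm z := sigm_eq_sigmoid ▸ Real.sigmoid_pos z

theorem sigm_lt_one (z : ℝ) : sigm z < 1 := sigm_eq_sigmoid ▸ Real.sigmoid_lt_one z

theorem sigm_neg (z : ℝ) : sigm (-z) = 1 - sigm z := by rw [sigm_eq_sigmoid, Real.sigmoid_neg]

theorem exp_neg_le_sigm_mul_sigm_neg {z a : ℝ} (hz : |z| ≤ a) :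
    Real.exp (-a) / 4 ≤ sigm z * sigm (-z) := by
  have hza : Real.exp z ≤ Real.exp a := Real.exp_le_exp.2 (abs_le.1 hz).2
  have hza' : Real.exp (-z) ≤ Real.exp a := Real.exp_le_exp.2 (by linarith [(abs_le.1 hz).1])
  have ha : 1 ≤ Real.exp a := Real.one_le_exp ((abs_nonneg z).trans hz)
  have hprod : sigm z * sigm (-z) = 1 / (2 + Real.exp z + Real.exp (-z)) := by
    have hinv : Real.exp z * Real.exp (-z) = 1 := by
      rw [← Real.exp_add, add_neg_cancel, Real.exp_zero]
    rw [sigm, sigm, neg_neg, one_div_mul_one_div]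
    congr 1
    linear_combination hinv
  rw [hprod, Real.exp_neg, ← one_div, div_div]
  exact one_div_le_one_div_of_le (by positivity) (by linarith)

theorem hasDerivAt_logisticLoss (z : ℝ) : HasDerivAt logisticLoss (-sigm (-z)) z := by
  have hinner : HasDerivAt (fun z => 1 + Real.exp (-z)) (-Real.exp (-z)) z := by
    simpa using ((hasDerivAt_neg z).exp).const_add 1
  refine (hinner.log (by positivity)).congr_deriv ?_
  rw [sigm_neg, sigm]
  field

theorem hasDerivAt_neg_sigm_neg (z : ℝ) :
    HasDerivAt (fun z => -sigm (-z)) (sigm z * sigm (-z)) z := by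
  simp only [sigm_neg, neg_sub]
  rw [sigm_eq_sigmoid]
  exact (Real.hasDerivAt_sigmoid z).sub_const 1

theorem tangent_add_sq_le_of_strongConvexOn {s : Set ℝ} {f : ℝ → ℝ} {m a b f' : ℝ}
    (hf : StrongConvexOn s m f) (ha : a ∈ s) (hb : b ∈ s) (hd : HasDerivAt f f' a) :
    f a + f' * (b - a) + m / 2 * (b - a) ^ 2 ≤ f b := by
  have hconv : ConvexOn ℝ s fun x => f x - m / 2 * x ^ 2 := by
    simpa only [Real.norm_eq_abs, sq_abs] using strongConvexOn_iff_convex.1 hf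
  have hd' : HasDerivAt (fun x => f x - m / 2 * x ^ 2) (f' - m / 2 * (2 * a)) a :=
    hd.sub (by simpa using (hasDerivAt_pow 2 a).const_mul (m / 2))
  have htangent : (f' - m / 2 * (2 * a)) * (b - a) ≤
      (f b - m / 2 * b ^ 2) - (f a - m / 2 * a ^ 2) := by
    rcases lt_trichotomy a b with hab | rfl | hab
    · have := hconv.le_slope_of_hasDerivAt ha hb hab hd'
      rwa [slope_def_field, le_div_iff₀ (by linarith)] at this
    · simp
    · have := hconv.slope_le_of_hasDerivAt hb ha hab hd'
      rw [slope_def_field, div_le_iff₀ (by linarith)] at this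
      linarith
  linarith

theorem strongConvexOn_logisticLoss (r : ℝ) :
    StrongConvexOn (Set.Icc (-r) r) (Real.exp (-r) / 4) logisticLoss := by
  set m := Real.exp (-r) / 4
  have hd (z : ℝ) : HasDerivAt (fun z => logisticLoss z - m / 2 * z ^ 2) (-sigm (-z) - m * z) z :=
    ((hasDerivAt_logisticLoss z).sub ((hasDerivAt_pow 2 z).const_mul (m / 2))).congr_deriv
      (by push_cast; ring)
  have hd2 (z : ℝ) : HasDerivAt (fun z => -sigm (-z) - m * z) (sigm z * sigm (-z) - m) z :=
    (hasDerivAt_neg_sigm_neg z).sub (hasDerivAt_const_mul m)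
  simp only [strongConvexOn_iff_convex, Real.norm_eq_abs, sq_abs]
  refine convexOn_of_hasDerivWithinAt2_nonneg (convex_Icc _ _)
    (fun z _ => (hd z).continuousAt.continuousWithinAt) (fun z _ => (hd z).hasDerivWithinAt)
    (fun z _ => (hd2 z).hasDerivWithinAt) fun z hz => ?_
  rw [interior_Icc] at hz
  exact sub_nonneg.2 (exp_neg_le_sigm_mul_sigm_neg (abs_le.2 ⟨hz.1.le, hz.2.le⟩))

/-! ### Transition matrices of the Glauber dynamics -/

/-- A matrix with nonnegative entries. -/
def EntryNonneg {α : Type*} (M : Matrix α α ℝ) : Prop := ∀ x y, 0 ≤ M x y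

namespace EntryNonneg

variable {α : Type*} [Fintype α] {M M' : Matrix α α ℝ}

theorem mul (h : EntryNonneg M) (h' : EntryNonneg M') : EntryNonneg (M * M') := fun x y =>
  sum_nonneg fun z _ => mul_nonneg (h x z) (h' z y)

theorem pow [DecidableEq α] (h : EntryNonneg M) (s : ℕ) : EntryNonneg (M ^ s) := by
  induction s with
  | zero => exact fun x y => by rw [pow_zero, one_apply]; split_ifs <;> norm_num
  | succ s ih => exact pow_succ M s ▸ ih.mul h

theorem mulVec_mono (h : EntryNonneg M) {f g : α → ℝ} (hfg : f ≤ g) : M *ᵥ f ≤ M *ᵥ g :=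
  fun x => sum_le_sum fun y _ => mul_le_mul_of_nonneg_left (hfg y) (h x y)

theorem apply_le_mulVec_one (h : EntryNonneg M) (x y : α) : M x y ≤ (M *ᵥ 1) x := by
  simp only [mulVec, dotProduct, Pi.one_apply, mul_one]
  exact single_le_sum (fun z _ => h x z) (mem_univ y)

end EntryNonneg

section Transition

variable (ψ : MPoly n)

theorem updateProb_nonneg (x : Config n) (j : Fin n) (e : ℤˣ) : 0 ≤ updateProb ψ x j e := by
  unfold updateProb
  split_ifs
  · exact (sigm_pos _).le
  · exact sub_nonneg.2 (sigm_lt_one _).le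

theorem stepProb_nonneg (x : Config n) (i : Fin n) (y : Config n) : 0 ≤ stepProb ψ x i y := by
  have := updateProb_nonneg ψ x i (y i)
  unfold stepProb
  split_ifs <;> positivity

/-- The mean of `f` after the spin at site `j` has been resampled. -/
def updOp (j : Fin n) (f : Config n → ℝ) (x : Config n) : ℝ :=
  ∑ e, updateProb ψ x j e * f (Function.update x j e)

theorem updOp_eq (j : Fin n) (f : Config n → ℝ) (x : Config n) :
    updOp ψ j f x = sigm (2 * (ψ.pderiv j).eval x) * f (Function.update x j 1)
      + (1 - sigm (2 * (ψ.pderiv j).eval x)) * f (Function.update x j (-1)) := by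
  rw [updOp, UnitsInt.univ, sum_pair (by decide)]
  simp [updateProb]

theorem updOp_of_update_eq {j : Fin n} {f : Config n → ℝ}
    (hf : ∀ x e, f (Function.update x j e) = f x) : updOp ψ j f = f := by
  funext x
  rw [updOp_eq, hf, hf]
  ring

theorem sum_stepProb_mul (j : Fin n) (f : Config n → ℝ) (x : Config n) :
    ∑ y, stepProb ψ x j y * f y = 1 / (n : ℝ) * updOp ψ j f x := by
  rw [updOp, mul_sum]
  refine (Fintype.sum_of_injective (Function.update x j) (Function.update_injective x j) _ _
    (fun y hy => ?_) fun e => ?_).symm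
  · rw [stepProb, if_neg, zero_mul]
    exact fun h => hy ⟨y j, (Function.eq_update_iff.2 ⟨rfl, h⟩).symm⟩
  · rw [stepProb, if_pos fun l hl => Function.update_of_ne hl _ _, Function.update_self, mul_assoc]

/-- The transition matrix of the dynamics restricted to updates of the sites in `J`. -/
def stepMat (J : Finset (Fin n)) : Matrix (Config n) (Config n) ℝ :=
  fun x y => ∑ j ∈ J, stepProb ψ x j y

theorem entryNonneg_stepMat (J : Finset (Fin n)) : EntryNonneg (stepMat ψ J) := fun _ _ =>
  sum_nonneg fun _ _ => stepProb_nonneg _ _ _ _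

theorem stepMat_mulVec (J : Finset (Fin n)) (f : Config n → ℝ) (x : Config n) :
    (stepMat ψ J *ᵥ f) x = 1 / (n : ℝ) * ∑ j ∈ J, updOp ψ j f x := by
  simp only [mulVec, dotProduct, stepMat, sum_mul, mul_sum, ← sum_stepProb_mul]
  exact sum_comm

theorem stepMat_mulVec_one (J : Finset (Fin n)) : stepMat ψ J *ᵥ 1 = (#J / n : ℝ) • 1 := by
  funext x
  have hone (j : Fin n) : updOp ψ j 1 = 1 := updOp_of_update_eq ψ fun _ _ => rfl
  simp only [stepMat_mulVec, hone, Pi.one_apply, sum_const, nsmul_eq_mul, Pi.smul_apply,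
    smul_eq_mul]
  ring

theorem stepMat_pow_mulVec_one (J : Finset (Fin n)) (s : ℕ) :
    stepMat ψ J ^ s *ᵥ 1 = (#J / n : ℝ) ^ s • 1 := by
  induction s with
  | zero => simp
  | succ s ih => rw [pow_succ, ← mulVec_mulVec, stepMat_mulVec_one, mulVec_smul, ih, smul_smul,
      pow_succ']

theorem stepMat_univ_mem_rowStochastic (hn : n ≠ 0) :
    stepMat ψ univ ∈ rowStochastic ℝ (Config n) := by
  have hn' : (n : ℝ) ≠ 0 := Nat.cast_ne_zero.2 hn
  exact ⟨fun _ _ => entryNonneg_stepMat ψ univ _ _, by simp [stepMat_mulVec_one, hn']⟩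

/-! ### The law of the next sample -/

/-- The probability to move from `x` to `y` in `w` unrestricted steps, then `s` steps without an
update of `i`, then an update of `i`. -/
def sampleMat (i : Fin n) (w s : ℕ) : Matrix (Config n) (Config n) ℝ :=
  stepMat ψ univ ^ w * stepMat ψ {i}ᶜ ^ s * stepMat ψ {i}

/-- The transition matrix between consecutive samples: `w` unrestricted steps followed by the
first subsequent update of `i`. -/
def sampleKernel (i : Fin n) (w : ℕ) : Matrix (Config n) (Config n) ℝ :=
  fun x y => ∑' s, sampleMat ψ i w s x y

variable (i : Fin n) (w : ℕ)

theorem entryNonneg_sampleMat (s : ℕ) : EntryNonneg (sampleMat ψ i w s) :=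
  (((entryNonneg_stepMat ψ _).pow w).mul ((entryNonneg_stepMat ψ _).pow s)).mul
    (entryNonneg_stepMat ψ _)

theorem sampleMat_mulVec (s : ℕ) (f : Config n → ℝ) :
    sampleMat ψ i w s *ᵥ f = stepMat ψ univ ^ w *ᵥ stepMat ψ {i}ᶜ ^ s *ᵥ stepMat ψ {i} *ᵥ f := by
  simp only [sampleMat, mulVec_mulVec, Matrix.mul_assoc]

theorem card_compl_singleton_div : (#{i}ᶜ : ℝ) / n = 1 - 1 / n := by
  have hn : (n : ℝ) ≠ 0 := Nat.cast_ne_zero.2 i.pos.ne'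
  rw [card_compl, card_singleton, Fintype.card_fin, Nat.cast_sub i.pos, Nat.cast_one, sub_div,
    div_self hn]

theorem sampleMat_mulVec_one (s : ℕ) :
    sampleMat ψ i w s *ᵥ 1 = ((1 - 1 / n : ℝ) ^ s * (1 / n)) • 1 := by
  have hone := one_vecMul_of_mem_rowStochastic
    (Submonoid.pow_mem _ (stepMat_univ_mem_rowStochastic ψ i.pos.ne') w)
  rw [sampleMat_mulVec, stepMat_mulVec_one, card_singleton, Nat.cast_one, mulVec_smul,
    stepMat_pow_mulVec_one, card_compl_singleton_div, mulVec_smul, mulVec_smul, hone, smul_smul,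
    mul_comm]

theorem hasSum_one_sub_pow_mul {q : ℝ} (hq0 : 0 < q) (hq1 : q ≤ 1) :
    HasSum (fun s : ℕ => (1 - q) ^ s * q) 1 := by
  have h := (hasSum_geometric_of_lt_one (sub_nonneg.2 hq1) (sub_lt_self 1 hq0)).mul_right q
  rwa [sub_sub_cancel, inv_mul_cancel₀ hq0.ne'] at h

theorem hasSum_sampleMat_mulVec_one (x : Config n) :
    HasSum (fun s => (sampleMat ψ i w s *ᵥ 1) x) 1 := by
  have hn : (1 : ℝ) ≤ n := Nat.one_le_cast.2 i.pos
  simpa [sampleMat_mulVec_one] using hasSum_one_sub_pow_mul (q := 1 / (n : ℝ)) (by positivity)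
    ((div_le_one (by positivity)).2 hn)

theorem summable_sampleMat (x y : Config n) : Summable fun s => sampleMat ψ i w s x y := by
  refine Summable.of_nonneg_of_le (fun s => entryNonneg_sampleMat ψ i w s x y) (fun s => ?_)
    (hasSum_sampleMat_mulVec_one ψ i w x).summable
  exact (entryNonneg_sampleMat ψ i w s).apply_le_mulVec_one x y

theorem hasSum_sampleMat_mulVec (f : Config n → ℝ) (x : Config n) :
    HasSum (fun s => (sampleMat ψ i w s *ᵥ f) x) ((sampleKernel ψ i w *ᵥ f) x) :=
  hasSum_sum fun y _ => (summable_sampleMat ψ i w x y).hasSum.mul_right (f y)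

theorem sampleKernel_mem_rowStochastic : sampleKernel ψ i w ∈ rowStochastic ℝ (Config n) := by
  refine ⟨fun x y => tsum_nonneg fun s => entryNonneg_sampleMat ψ i w s x y, funext fun x => ?_⟩
  exact (hasSum_sampleMat_mulVec ψ i w 1 x).unique (hasSum_sampleMat_mulVec_one ψ i w x)

variable {ψ} in
theorem sampleKernel_mulVec_eq_zero {f : Config n → ℝ} (hf : updOp ψ i f = 0) :
    sampleKernel ψ i w *ᵥ f = 0 := by
  funext x
  have hstep : stepMat ψ {i} *ᵥ f = 0 := by
    funext z
    simp [stepMat_mulVec, hf]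
  have hsum := hasSum_sampleMat_mulVec ψ i w f x
  simp only [sampleMat_mulVec, hstep, mulVec_zero, Pi.zero_apply] at hsum
  exact hsum.unique hasSum_zero

end Transition

/-! ### Anticoncentration of polynomials at the next sample -/

section Stochastic

variable {α : Type*} [Fintype α] [DecidableEq α] {M : Matrix α α ℝ}

theorem EntryNonneg.pow_smul_le_pow_mulVec (hM : EntryNonneg M) {c : ℝ} (hc : 0 ≤ c) {f : α → ℝ}
    (h : c • f ≤ M *ᵥ f) (s : ℕ) : c ^ s • f ≤ M ^ s *ᵥ f := by
  induction s with
  | zero => simp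
  | succ s ih => calc
      c ^ (s + 1) • f = c ^ s • c • f := by rw [pow_succ, mul_smul]
      _ ≤ c ^ s • M *ᵥ f := smul_le_smul_of_nonneg_left h (pow_nonneg hc s)
      _ = M *ᵥ c ^ s • f := (mulVec_smul ..).symm
      _ ≤ M *ᵥ M ^ s *ᵥ f := hM.mulVec_mono ih
      _ = M ^ (s + 1) *ᵥ f := by rw [mulVec_mulVec, pow_succ']

theorem exists_le_mulVec_of_mem_rowStochastic (hM : M ∈ rowStochastic ℝ α) (f : α → ℝ) (x : α) :
    ∃ y, f y ≤ (M *ᵥ f) x := by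
  by_contra! h
  have hlt : ∑ y, M x y * (M *ᵥ f) x < ∑ y, M x y * f y := by
    obtain ⟨y, -, hy⟩ : ∃ y ∈ univ, 0 < M x y := by
      refine exists_lt_of_sum_lt ?_
      simp [sum_row_of_mem_rowStochastic hM]
    exact sum_lt_sum (fun z _ => mul_le_mul_of_nonneg_left (h z).le
      (nonneg_of_mem_rowStochastic hM)) ⟨y, mem_univ y, mul_lt_mul_of_pos_left (h y) hy⟩
  rw [← sum_mul, sum_row_of_mem_rowStochastic hM, one_mul] at hlt
  exact hlt.false

end Stochastic

section Monomials

/-- The monomials of degree at most `k` in the variables `N`, as sets of variables. -/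
def monos {α : Type*} (N : Finset α) (k : ℕ) : Finset (Finset α) := {S ∈ N.powerset | #S ≤ k}

theorem mem_monos {α : Type*} {N S : Finset α} {k : ℕ} : S ∈ monos N k ↔ S ⊆ N ∧ #S ≤ k := by
  simp [monos]

theorem card_monos_le {α : Type*} {N : Finset α} {d : ℕ} (hd : #N ≤ d) (k : ℕ) :
    #(monos N k) ≤ (d + 1) ^ k := by
  classical
  induction k with
  | zero =>
    have hempty : monos N 0 ⊆ {∅} := fun S hS => by simpa using (mem_monos.1 hS).2
    simpa using card_le_card hempty
  | succ k ih =>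
    have hsplit : monos N (k + 1) ⊆ monos N k ∪ N.powersetCard (k + 1) := fun S hS => by
      rw [mem_monos] at hS
      rw [mem_union, mem_monos, mem_powersetCard]
      grind
    calc #(monos N (k + 1)) ≤ #(monos N k) + (#N).choose (k + 1) :=
          (card_le_card hsplit).trans ((card_union_le _ _).trans_eq (by rw [card_powersetCard]))
      _ ≤ (d + 1) ^ k + d ^ (k + 1) := by
          gcongr
          exact (Nat.choose_le_pow _ _).trans (Nat.pow_le_pow_left hd _)
      _ ≤ (d + 1) ^ k + d * (d + 1) ^ k := by
          rw [pow_succ' d]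
          gcongr
          exact d.le_succ
      _ = (d + 1) ^ (k + 1) := by ring

theorem le_mul_pow_of_le_add_sum_ssuperset {α : Type*} [DecidableEq α] {F : Finset (Finset α)}
    {a : Finset α → ℝ} {k : ℕ} {M : ℝ} (hM : 0 ≤ M) (hk : ∀ S ∈ F, #S ≤ k)
    (ha : ∀ S ∈ F, a S ≤ M + ∑ T ∈ F with S ⊂ T, a T) {S : Finset α} (hS : S ∈ F) :
    a S ≤ M * (1 + #F) ^ k := by
  suffices H : ∀ m, ∀ S ∈ F, k ≤ #S + m → a S ≤ M * (1 + #F) ^ m from H k S hS (by omega)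
  intro m
  induction m with
  | zero =>
    intro S hS hkS
    have hmax : F.filter (S ⊂ ·) = ∅ := filter_eq_empty_iff.2 fun T hT hST => by
      have := card_lt_card hST
      have := hk T hT
      omega
    simpa [hmax] using ha S hS
  | succ m ih =>
    intro S hS hkS
    have hsum : ∑ T ∈ F with S ⊂ T, a T ≤ #F * (M * (1 + #F) ^ m) := calc
      ∑ T ∈ F with S ⊂ T, a T ≤ #(F.filter (S ⊂ ·)) • (M * (1 + #F : ℝ) ^ m) :=
        sum_le_card_nsmul _ _ _ fun T hT => by
          obtain ⟨hTF, hST⟩ := mem_filter.1 hT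
          have := card_lt_card hST
          exact ih T hTF (by omega)
      _ ≤ _ := by rw [nsmul_eq_mul]; gcongr; exact filter_subset _ _
    have hMle : M ≤ M * (1 + #F : ℝ) ^ m :=
      le_mul_of_one_le_right hM (one_le_pow₀ (le_add_of_nonneg_right (Nat.cast_nonneg _)))
    calc a S ≤ M + ∑ T ∈ F with S ⊂ T, a T := ha S hS
      _ ≤ M * (1 + #F) ^ m + #F * (M * (1 + #F) ^ m) := add_le_add hMle hsum
      _ = M * (1 + #F) ^ (m + 1) := by ring

end Monomials

section SecondMoment

variable {ψ : MPoly n} {N S : Finset (Fin n)} {lam : ℝ} {p : MPoly n} {i : Fin n}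

theorem exp_mul_sq_le_updOp_sq {j : Fin n} (hψ : (ψ.pderiv j).l1Norm ≤ lam) (p : MPoly n)
    (x : Config n) :
    Real.exp (-(2 * lam)) * (p.pderiv j).eval x ^ 2 ≤ updOp ψ j (p.eval ^ 2) x := by
  have hdrift : |2 * (ψ.pderiv j).eval x| ≤ 2 * lam := by
    rw [abs_mul, abs_two]
    linarith [(ψ.pderiv j).abs_eval_le x]
  have hvar := exp_neg_le_sigm_mul_sigm_neg hdrift
  have hdiff := p.eval_update_sub j x
  rw [updOp_eq, Pi.pow_apply, Pi.pow_apply]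
  rw [sigm_neg] at hvar
  set q := sigm (2 * (ψ.pderiv j).eval x)
  set u := p.eval (Function.update x j 1)
  set v := p.eval (Function.update x j (-1))
  calc Real.exp (-(2 * lam)) * (p.pderiv j).eval x ^ 2
      = Real.exp (-(2 * lam)) / 4 * (u - v) ^ 2 := by rw [hdiff]; ring
    _ ≤ q * (1 - q) * (u - v) ^ 2 := mul_le_mul_of_nonneg_right hvar (sq_nonneg _)
    _ ≤ q * (1 - q) * (u - v) ^ 2 + (q * u + (1 - q) * v) ^ 2 := by
      linarith [sq_nonneg (q * u + (1 - q) * v)]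
    _ = q * u ^ 2 + (1 - q) * v ^ 2 := by ring

theorem le_stepMat_mulVec_sq (hp : p.VarsIn N) (hψ : ∀ j ∈ N, (ψ.pderiv j).l1Norm ≤ lam)
    (J : Finset (Fin n)) (x : Config n) :
    (#(J \ N) / n : ℝ) * p.eval x ^ 2
        + Real.exp (-(2 * lam)) / n * ∑ j ∈ J ∩ N, (p.pderiv j).eval x ^ 2
      ≤ (stepMat ψ J *ᵥ p.eval ^ 2) x := by
  have hout : ∑ j ∈ J \ N, updOp ψ j (p.eval ^ 2) x = #(J \ N) * p.eval x ^ 2 := by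
    rw [← nsmul_eq_mul, ← sum_const]
    refine sum_congr rfl fun j hj => congrFun (updOp_of_update_eq ψ fun x e => ?_) x
    rw [Pi.pow_apply, Pi.pow_apply, hp.eval_update (mem_sdiff.1 hj).2]
  have hin : Real.exp (-(2 * lam)) * ∑ j ∈ J ∩ N, (p.pderiv j).eval x ^ 2
      ≤ ∑ j ∈ J ∩ N, updOp ψ j (p.eval ^ 2) x := by
    rw [mul_sum]
    exact sum_le_sum fun j hj => exp_mul_sq_le_updOp_sq (hψ j (mem_inter.1 hj).2) p x
  rw [stepMat_mulVec, ← sum_inter_add_sum_sdiff J N, hout]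
  calc _ = 1 / (n : ℝ) * (Real.exp (-(2 * lam)) * ∑ j ∈ J ∩ N, (p.pderiv j).eval x ^ 2
        + #(J \ N) * p.eval x ^ 2) := by ring
    _ ≤ _ := by gcongr

theorem card_sdiff_div (N : Finset (Fin n)) (hn : n ≠ 0) :
    (#(univ \ N) / n : ℝ) = 1 - #N / n := by
  rw [card_univ_sdiff, Fintype.card_fin, Nat.cast_sub (card_le_univ N |>.trans_eq (by simp)),
    sub_div, div_self (Nat.cast_ne_zero.2 hn)]

theorem choose_mul_pow_sub {R : Type*} [CommSemiring R] (a : R) (L s : ℕ) :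
    L.choose (s + 1) * a ^ (L - s) = L.choose (s + 1) * a ^ (L - (s + 1)) * a := by
  rcases lt_or_ge L (s + 1) with h | h
  · simp [Nat.choose_eq_zero_of_lt h]
  · rw [mul_assoc, ← pow_succ, ← Nat.sub_add_comm h, Nat.add_sub_add_right]

theorem le_stepMat_pow_succ_mulVec_sq (hn : n ≠ 0) (hψ : ∀ j ∈ N, (ψ.pderiv j).l1Norm ≤ lam)
    (hp : p.VarsIn N) (L : ℕ) (x : Config n) :
    (1 - #N / n : ℝ) * (stepMat ψ univ ^ L *ᵥ p.eval ^ 2) x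
        + Real.exp (-(2 * lam)) / n * ∑ j ∈ N, (stepMat ψ univ ^ L *ᵥ (p.pderiv j).eval ^ 2) x
      ≤ (stepMat ψ univ ^ (L + 1) *ᵥ p.eval ^ 2) x := by
  have hstep : (1 - #N / n : ℝ) • p.eval ^ 2
      + (Real.exp (-(2 * lam)) / n) • ∑ j ∈ N, (p.pderiv j).eval ^ 2
      ≤ stepMat ψ univ *ᵥ p.eval ^ 2 := fun y => by
    simpa [card_sdiff_div N hn] using le_stepMat_mulVec_sq hp hψ univ y
  have h := ((entryNonneg_stepMat ψ univ).pow L).mulVec_mono hstep x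
  rw [mulVec_mulVec, ← pow_succ, mulVec_add, mulVec_smul, mulVec_smul, mulVec_sum] at h
  simpa using h

/-- Pascal's rule: the last of the `L` updates misses `N` or hits one chosen site of `S`. -/
theorem choose_mul_le_stepMat_pow_mulVec_sq (hn : n ≠ 0)
    (hψ : ∀ j ∈ N, (ψ.pderiv j).l1Norm ≤ lam) (hp : p.VarsIn N) (hS : S ⊆ N) (L : ℕ)
    (x : Config n) :
    L.choose #S * (1 - #N / n : ℝ) ^ (L - #S) * (Real.exp (-(2 * lam)) / n) ^ #S
        * (p.iterDeriv S).eval x ^ 2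
      ≤ (stepMat ψ univ ^ L *ᵥ p.eval ^ 2) x := by
  set a : ℝ := 1 - #N / n with ha
  set b : ℝ := Real.exp (-(2 * lam)) / n with hb
  have ha0 : 0 ≤ a := by rw [ha, ← card_sdiff_div N hn]; positivity
  have hb0 : 0 ≤ b := by positivity
  induction L generalizing p S x with
  | zero =>
    rcases S.eq_empty_or_nonempty with rfl | hne
    · simp [MPoly.iterDeriv_empty]
    · simpa [Nat.choose_eq_zero_of_lt hne.card_pos] using sq_nonneg (p.eval x)
  | succ L ih =>
    refine le_trans ?_ (le_stepMat_pow_succ_mulVec_sq hn hψ hp L x)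
    have hnonneg : ∀ j ∈ N, 0 ≤ (stepMat ψ univ ^ L *ᵥ (p.pderiv j).eval ^ 2) x := fun j _ =>
      sum_nonneg fun y _ => mul_nonneg ((entryNonneg_stepMat ψ univ).pow L x y) (sq_nonneg _)
    rw [← ha, ← hb]
    rcases S.eq_empty_or_nonempty with rfl | ⟨j, hj⟩
    · calc _ = a * (L.choose #(∅ : Finset (Fin n)) * a ^ (L - #(∅ : Finset (Fin n)))
            * b ^ #(∅ : Finset (Fin n)) * (p.iterDeriv ∅).eval x ^ 2) := by simp; ring
        _ ≤ a * (stepMat ψ univ ^ L *ᵥ p.eval ^ 2) x := by gcongr; exact ih hp hS x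
        _ ≤ _ := le_add_of_nonneg_right (mul_nonneg hb0 (sum_nonneg hnonneg))
    · have hkeep := ih hp hS x
      have hdiff := ih (hp.pderiv j) ((erase_subset j S).trans hS) x
      rw [p.iterDeriv_pderiv (notMem_erase j S), insert_erase hj] at hdiff
      have hcard : #S = #(S.erase j) + 1 := (card_erase_add_one hj).symm
      rw [hcard] at hkeep ⊢
      calc _ = a * (L.choose (#(S.erase j) + 1) * a ^ (L - (#(S.erase j) + 1))
              * b ^ (#(S.erase j) + 1) * (p.iterDeriv S).eval x ^ 2)
            + b * (L.choose #(S.erase j) * a ^ (L - #(S.erase j)) * b ^ #(S.erase j)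
              * (p.iterDeriv S).eval x ^ 2) := by
            rw [Nat.choose_succ_succ', Nat.add_sub_add_right, Nat.cast_add]
            linear_combination b ^ (#(S.erase j) + 1) * (p.iterDeriv S).eval x ^ 2
              * choose_mul_pow_sub a L #(S.erase j)
        _ ≤ _ := by
          gcongr
          exact hdiff.trans (single_le_sum hnonneg (hS hj))

theorem exp_neg_one_le_one_sub_pow {x : ℝ} (hx1 : x < 1) {m : ℕ}
    (hm : (m + 1) * x ≤ 1) : Real.exp (-1) ≤ (1 - x) ^ m := by
  have h1x : 0 < 1 - x := sub_pos.2 hx1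
  rw [← Real.exp_log h1x, ← Real.exp_nat_mul]
  refine Real.exp_le_exp.2 ?_
  calc -1 ≤ m * (1 - (1 - x)⁻¹) := by
        have : m * x / (1 - x) ≤ 1 := (div_le_one h1x).2 (by linarith)
        have : m * (1 - (1 - x)⁻¹) = -(m * x / (1 - x)) := by field
        linarith
    _ ≤ m * Real.log (1 - x) := by gcongr; exact Real.one_sub_inv_le_log_of_pos h1x

theorem pow_le_choose_mul {m : ℕ} (hm : 1 ≤ m) (s : ℕ) : m ^ s ≤ (m * s).choose s := by
  induction s with
  | zero => simp
  | succ s ih =>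
    have hsucc : (m * (s + 1)).choose (s + 1) = m * (m * (s + 1) - 1).choose s := by
      refine Nat.eq_of_mul_eq_mul_right s.succ_pos ?_
      have := Nat.add_one_mul_choose_eq (m * (s + 1) - 1) s
      rw [Nat.sub_add_cancel (Nat.mul_pos hm s.succ_pos)] at this
      linarith
    rw [hsucc, pow_succ']
    exact Nat.mul_le_mul_left m (ih.trans (Nat.choose_le_choose s (by rw [mul_add_one]; omega)))

theorem le_div_mul_one_sub_pow {D : ℕ} (hD : 0 < D) (hDn : D < n) {c : ℝ} (hc : 0 ≤ c) :
    c / (6 * D) ≤ (n / D : ℕ) * (1 - D / n : ℝ) ^ (n / D - 1) * (c / n) := by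
  have : (0 : ℝ) < D := Nat.cast_pos.2 hD
  have hn : (0 : ℝ) < n := Nat.cast_pos.2 (hD.trans hDn)
  obtain ⟨m, hm⟩ := Nat.exists_eq_add_of_le' ((Nat.one_le_div_iff hD).2 hDn.le)
  have hmle : ((m : ℝ) + 1) * D ≤ n := by exact_mod_cast hm ▸ Nat.div_mul_le_self n D
  have hlem : (n : ℝ) ≤ 2 * D * (m + 1) := by
    have : n < D * (m + 1 + 1) := hm ▸ Nat.lt_mul_div_succ n hD
    exact_mod_cast (by nlinarith : n ≤ 2 * D * (m + 1))
  have hpow : 1 / 3 ≤ (1 - D / n : ℝ) ^ m := by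
    refine (by norm_num : (1 / 3 : ℝ) ≤ 0.36787944116).trans (Real.exp_neg_one_gt_d9.le.trans
      (exp_neg_one_le_one_sub_pow ?_ ?_))
    · exact (div_lt_one hn).2 (Nat.cast_lt.2 hDn)
    · rwa [mul_div_assoc', div_le_one hn]
  rw [hm, Nat.add_sub_cancel]
  push_cast
  calc c / (6 * D) = 1 / (2 * D) * (1 / 3) * c := by field
    _ ≤ (m + 1) / n * (1 - D / n : ℝ) ^ m * c := by
      gcongr ?_ * ?_ * c
      rw [div_le_div_iff₀ (by positivity) hn]
      linarith
    _ = _ := by ring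

theorem pow_mul_le_stepMat_pow_mulVec_sq (hN : #N < n)
    (hψ : ∀ j ∈ N, (ψ.pderiv j).l1Norm ≤ lam) (hp : p.VarsIn N) (hS : S ⊆ N) (x : Config n) :
    (Real.exp (-(2 * lam)) / (6 * #N)) ^ #S * (p.iterDeriv S).eval x ^ 2
      ≤ (stepMat ψ univ ^ (n / #N * #S) *ᵥ p.eval ^ 2) x := by
  refine le_trans ?_ (choose_mul_le_stepMat_pow_mulVec_sq (by omega) hψ hp hS _ x)
  rcases S.eq_empty_or_nonempty with rfl | hne
  · simp
  have hNpos : 0 < #N := (hne.mono hS).card_pos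
  have hm : 1 ≤ n / #N := (Nat.one_le_div_iff hNpos).2 hN.le
  have ha : 0 ≤ 1 - #N / (n : ℝ) := by
    rw [← card_sdiff_div N (by omega)]; positivity
  gcongr ?_ * _
  calc _ ≤ ((n / #N : ℕ) * (1 - #N / n : ℝ) ^ (n / #N - 1)
        * (Real.exp (-(2 * lam)) / n)) ^ #S := by
        gcongr
        exact le_div_mul_one_sub_pow hNpos hN (Real.exp_pos _).le
    _ = ((n / #N) ^ #S : ℕ) * (1 - #N / n : ℝ) ^ (n / #N * #S - #S)
        * (Real.exp (-(2 * lam)) / n) ^ #S := by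
        rw [mul_pow, mul_pow, ← pow_mul, Nat.sub_mul, one_mul, Nat.cast_pow]
    _ ≤ _ := by gcongr; exact pow_le_choose_mul hm _

theorem mul_pow_smul_le_sampleMat_mulVec_sq (hi : i ∉ N)
    (hψ : ∀ j ∈ N, (ψ.pderiv j).l1Norm ≤ lam) (hp : p.VarsIn N) (w s : ℕ) :
    (1 / n * (1 - (1 + #N) / n) ^ s : ℝ) • stepMat ψ univ ^ w *ᵥ p.eval ^ 2
      ≤ sampleMat ψ i w s *ᵥ p.eval ^ 2 := by
  have hstep (J : Finset (Fin n)) : (#(J \ N) / n : ℝ) • p.eval ^ 2 ≤ stepMat ψ J *ᵥ p.eval ^ 2 :=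
    fun y => (le_add_of_nonneg_right (by positivity)).trans (le_stepMat_mulVec_sq hp hψ J y)
  have hwait : (#({i}ᶜ \ N) / n : ℝ) = 1 - (1 + #N) / n := by
    have hset : {i}ᶜ \ N = univ \ insert i N := by ext; simp
    rw [hset, card_sdiff_div _ i.pos.ne', card_insert_of_notMem hi]
    push_cast
    ring
  have hhit : #({i} \ N) = 1 := by rw [sdiff_eq_self_of_disjoint (by simpa), card_singleton]
  have hQ := (entryNonneg_stepMat ψ univ).pow w
  have hQi := (entryNonneg_stepMat ψ {i}ᶜ).pow s
  rw [sampleMat_mulVec, ← mulVec_smul, mul_smul, ← hwait]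
  refine hQ.mulVec_mono ((smul_le_smul_of_nonneg_left ((entryNonneg_stepMat ψ _)
    |>.pow_smul_le_pow_mulVec (by positivity) (hstep _) s) (by positivity)).trans ?_)
  rw [← mulVec_smul]
  exact hQi.mulVec_mono (by simpa only [hhit, Nat.cast_one] using hstep {i})

theorem smul_le_sampleKernel_mulVec_sq (hi : i ∉ N)
    (hψ : ∀ j ∈ N, (ψ.pderiv j).l1Norm ≤ lam) (hp : p.VarsIn N) (w : ℕ) :
    (1 / (1 + #N) : ℝ) • stepMat ψ univ ^ w *ᵥ p.eval ^ 2 ≤ sampleKernel ψ i w *ᵥ p.eval ^ 2 := by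
  intro x
  have hn : (0 : ℝ) < n := Nat.cast_pos.2 i.pos
  have hcard : #N + 1 ≤ n := by
    simpa [card_insert_of_notMem hi] using card_le_univ (insert i N)
  have hq : (1 + #N : ℝ) / n ≤ 1 := (div_le_one hn).2 (by rw [add_comm]; exact_mod_cast hcard)
  have hgeom := (hasSum_one_sub_pow_mul (q := (1 + #N : ℝ) / n) (by positivity) hq).mul_left
    (1 / (1 + #N) * (stepMat ψ univ ^ w *ᵥ p.eval ^ 2) x)
  rw [mul_one] at hgeom
  refine hasSum_le (fun s => ?_) hgeom (hasSum_sampleMat_mulVec ψ i w _ x)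
  refine Eq.trans_le ?_ (mul_pow_smul_le_sampleMat_mulVec_sq hi hψ hp w s x)
  rw [Pi.smul_apply, smul_eq_mul]
  field

theorem exists_mul_sq_le_sampleKernel_mulVec_sq {d k : ℕ} (hd : 1 ≤ d) (hlam : 0 ≤ lam)
    (hi : i ∉ N) (hN : #N ≤ d) (hψ : ∀ j ∈ N, (ψ.pderiv j).l1Norm ≤ lam) (hp : p.VarsIn N)
    (hS : S ⊆ N) (hSk : #S ≤ k) {w : ℕ} (hw : n ≤ w) (x : Config n) :
    ∃ z, 1 / (1 + d) * (Real.exp (-(2 * lam)) / (6 * d)) ^ k * (p.iterDeriv S).eval z ^ 2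
      ≤ (sampleKernel ψ i w *ᵥ p.eval ^ 2) x := by
  have hNn : #N < n := by
    simpa [card_insert_of_notMem hi] using card_le_univ (insert i N)
  have hd' : (1 : ℝ) ≤ d := Nat.one_le_cast.2 hd
  have hblocks : n / #N * #S ≤ w :=
    (Nat.mul_le_mul_left _ (card_le_card hS)).trans ((Nat.div_mul_le_self _ _).trans hw)
  obtain ⟨z, hz⟩ := exists_le_mulVec_of_mem_rowStochastic (Submonoid.pow_mem _
    (stepMat_univ_mem_rowStochastic ψ i.pos.ne') (w - n / #N * #S))
    (stepMat ψ univ ^ (n / #N * #S) *ᵥ p.eval ^ 2) x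
  rw [mulVec_mulVec, ← pow_add, Nat.sub_add_cancel hblocks] at hz
  refine ⟨z, le_trans ?_ (smul_le_sampleKernel_mulVec_sq hi hψ hp w x)⟩
  have hexp : Real.exp (-(2 * lam)) ≤ 1 := Real.exp_le_one_iff.2 (by linarith)
  have hone : Real.exp (-(2 * lam)) / (6 * d) ≤ 1 := (div_le_one (by positivity)).2 (by linarith)
  have hconst : (Real.exp (-(2 * lam)) / (6 * d)) ^ k
      ≤ (Real.exp (-(2 * lam)) / (6 * #N)) ^ #S := by
    refine (pow_le_pow_of_le_one (by positivity) hone hSk).trans ?_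
    rcases S.eq_empty_or_nonempty with rfl | hne
    · simp
    · have : (0 : ℝ) < #N := Nat.cast_pos.2 (hne.mono hS).card_pos
      gcongr
  rw [Pi.smul_apply, smul_eq_mul, mul_assoc]
  gcongr
  exact le_trans (by gcongr) ((pow_mul_le_stepMat_pow_mulVec_sq hNn hψ hp hS z).trans hz)

/-- The constant in the lower bound for the second moment of a polynomial at the next sample. -/
def spread (d k : ℕ) (lam : ℝ) : ℝ :=
  1 / (1 + d) * (Real.exp (-(2 * lam)) / (6 * d)) ^ k / (1 + (d + 1) ^ k) ^ (2 * k)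

theorem spread_mul_supNorm_sq_le {d k : ℕ} (hd : 1 ≤ d) (hlam : 0 ≤ lam) (hi : i ∉ N)
    (hN : #N ≤ d) (hψ : ∀ j ∈ N, (ψ.pderiv j).l1Norm ≤ lam) (hp : p.VarsIn N)
    (hk : p.DegreeLE k) {w : ℕ} (hw : n ≤ w) (x : Config n) :
    spread d k lam * p.supNorm ^ 2 ≤ (sampleKernel ψ i w *ᵥ p.eval ^ 2) x := by
  set g := 1 / (1 + d : ℝ) * (Real.exp (-(2 * lam)) / (6 * d)) ^ k with hg
  set V := (sampleKernel ψ i w *ᵥ p.eval ^ 2) x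
  have hg0 : 0 < g := by positivity
  have hV0 : 0 ≤ V := sum_nonneg fun y _ =>
    mul_nonneg (nonneg_of_mem_rowStochastic (sampleKernel_mem_rowStochastic ψ i w)) (sq_nonneg _)
  have hmonos (T : Finset (Fin n)) (hT : p T ≠ 0) : T ∈ monos N k := mem_monos.2 ⟨hp T hT, hk T hT⟩
  have hcoeff : ∀ S ∈ monos N k, |p S| ≤ √(V / g) + ∑ T ∈ monos N k with S ⊂ T, |p T| := by
    intro S hS
    obtain ⟨hSN, hSk⟩ := mem_monos.1 hS
    obtain ⟨z, hz⟩ :=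
      exists_mul_sq_le_sampleKernel_mulVec_sq hd hlam hi hN hψ hp hSN hSk hw x
    have hderiv : |(p.iterDeriv S).eval z| ≤ √(V / g) :=
      Real.abs_le_sqrt ((le_div_iff₀' hg0).2 hz)
    refine (p.abs_coeff_le S z).trans (add_le_add hderiv (sum_subset ?_ ?_).ge)
    · exact filter_subset_filter _ (subset_univ _)
    · intro T hT hT'
      rw [mem_filter] at hT hT'
      exact abs_eq_zero.2 (of_not_not fun hpT => hT' ⟨hmonos T hpT, hT.2⟩)
  have hsup : p.supNorm ≤ √(V / g) * (1 + (d + 1) ^ k) ^ k := by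
    refine MPoly.supNorm_le_iff.2 fun S => ?_
    by_cases hS : p S = 0
    · rw [hS, abs_zero]; positivity
    refine (le_mul_pow_of_le_add_sum_ssuperset (Real.sqrt_nonneg _)
      (fun S hS => (mem_monos.1 hS).2) hcoeff (hmonos S hS)).trans ?_
    gcongr
    exact_mod_cast card_monos_le hN k
  have hsq := pow_le_pow_left₀ p.supNorm_nonneg hsup 2
  rw [mul_pow, Real.sq_sqrt (by positivity), ← pow_mul, mul_comm k 2] at hsq
  calc spread d k lam * p.supNorm ^ 2
      = g / (1 + (d + 1) ^ k) ^ (2 * k) * p.supNorm ^ 2 := by rw [spread, hg]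
    _ ≤ g / (1 + (d + 1) ^ k) ^ (2 * k) * (V / g * (1 + (d + 1) ^ k) ^ (2 * k)) := by gcongr
    _ = V := by field

end SecondMoment

/-! ### The Markov property -/

theorem sum_measureReal_preimage_inter {Ω β : Type*} [MeasurableSpace Ω] [Fintype β]
    {P : Measure Ω} [IsFiniteMeasure P] {f : Ω → β} (hf : ∀ b, MeasurableSet (f ⁻¹' {b}))
    (A : Set Ω) : ∑ b, P.real (f ⁻¹' {b} ∩ A) = P.real A := by
  have h := sum_measureReal_preimage_singleton (μ := P.restrict A) univ fun b _ => hf b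
  simpa [measureReal_restrict_apply, hf] using h

section Adapted

variable {Ω : Type*} (X : ℕ → Ω → Config n) (U : ℕ → Ω → Fin n)

/-- The event `A` depends only on the history up to time `t`: with each of its outcomes, it
contains all outcomes that have the same history. -/
def Adapted (t : ℕ) (A : Set Ω) : Prop :=
  ∀ ω₀ ∈ A, history X U t (fun s => X s ω₀) (fun s => U s ω₀) ⊆ A

/-- The history up to time `t`, as an element of a finite type. -/
def historyCode (t : ℕ) (ω : Ω) : (Fin (t + 1) → Config n) × (Fin t → Fin n) :=
  (fun s => X s ω, fun s => U (s + 1) ω)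

theorem historyCode_preimage (t : ℕ) (ω₀ : Ω) :
    historyCode X U t ⁻¹' {historyCode X U t ω₀}
      = history X U t (fun s => X s ω₀) (fun s => U s ω₀) := by
  ext ω
  simp only [historyCode, history, Set.mem_preimage, Set.mem_singleton_iff, Prod.ext_iff,
    funext_iff, Set.mem_ofPred_eq]
  refine and_congr ⟨fun h s hs => h ⟨s, by omega⟩, fun h s => h s (by omega)⟩
    ⟨fun h s hs hst => ?_, fun h s => h _ (by omega) (by omega)⟩
  simpa [Nat.sub_add_cancel hs] using h ⟨s - 1, by omega⟩

variable {X U} {t : ℕ} {A B : Set Ω}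

theorem history_congr {x x' : ℕ → Config n} {u u' : ℕ → Fin n} (hx : ∀ s ≤ t, x s = x' s)
    (hu : ∀ s, 1 ≤ s → s ≤ t → u s = u' s) : history X U t x u = history X U t x' u' := by
  ext ω
  exact and_congr (forall₂_congr fun s hs => by rw [hx s hs])
    (forall₃_congr fun s h1 hs => by rw [hu s h1 hs])

theorem history_succ (x : ℕ → Config n) (u : ℕ → Fin n) : history X U (t + 1) x u =
    history X U t x u ∩ {ω | U (t + 1) ω = u (t + 1) ∧ X (t + 1) ω = x (t + 1)} := by
  ext ω
  simp only [history, Set.mem_inter_iff, Set.mem_ofPred_eq, Nat.le_succ_iff]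
  grind

theorem Adapted.mono {s : ℕ} (hst : s ≤ t) (hA : Adapted X U s A) : Adapted X U t A :=
  fun ω₀ hω₀ _ hω => hA ω₀ hω₀
    ⟨fun r hr => hω.1 r (hr.trans hst), fun r h1 hr => hω.2 r h1 (hr.trans hst)⟩

theorem Adapted.inter (hA : Adapted X U t A) (hB : Adapted X U t B) : Adapted X U t (A ∩ B) :=
  fun ω₀ hω₀ => Set.subset_inter (hA ω₀ hω₀.1) (hB ω₀ hω₀.2)

theorem adapted_config {s : ℕ} (hst : s ≤ t) (x : Config n) : Adapted X U t {ω | X s ω = x} :=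
  fun _ hω₀ _ hω => (hω.1 s hst).trans hω₀

theorem adapted_site {s : ℕ} (hs : 1 ≤ s) (hst : s ≤ t) (J : Finset (Fin n)) :
    Adapted X U t {ω | U s ω ∈ J} :=
  fun _ hω₀ _ hω => by simpa only [Set.mem_ofPred_eq, hω.2 s hs hst] using hω₀

theorem adapted_sites {s : ℕ} (hst : t + s ≤ t') (J : Finset (Fin n)) :
    Adapted X U t' {ω | ∀ r < s, U (t + r + 1) ω ∈ J} :=
  fun ω₀ hω₀ _ hω r hr => adapted_site (by omega) (by omega) J ω₀ (hω₀ r hr) hω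

end Adapted

section Markov

variable {Ω : Type*} [MeasurableSpace Ω] {ψ : MPoly n} {P : Measure Ω}
  {X : ℕ → Ω → Config n} {U : ℕ → Ω → Fin n} {t : ℕ} {A : Set Ω}

theorem IsGlauber.measurableSet_historyCode_preimage (hG : IsGlauber ψ P X U) (t : ℕ)
    (c : (Fin (t + 1) → Config n) × (Fin t → Fin n)) :
    MeasurableSet (historyCode X U t ⁻¹' {c}) := by
  have hfibre : historyCode X U t ⁻¹' {c}
      = (⋂ s : Fin (t + 1), {ω | X s ω = c.1 s}) ∩ ⋂ s : Fin t, {ω | U (s + 1) ω = c.2 s} := by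
    ext ω
    simp only [historyCode, Set.mem_preimage, Set.mem_singleton_iff, Prod.ext_iff,
      Set.mem_inter_iff, Set.mem_iInter, Set.mem_ofPred_eq]
    exact and_congr funext_iff funext_iff
  rw [hfibre]
  exact (MeasurableSet.iInter fun _ => hG.measurable_config _ _).inter
    (MeasurableSet.iInter fun _ => hG.measurable_site _ _)

theorem IsGlauber.measureReal_history_inter (hG : IsGlauber ψ P X U) (x : ℕ → Config n)
    (u : ℕ → Fin n) (j : Fin n) (y : Config n) :
    P.real (history X U t x u ∩ {ω | U (t + 1) ω = j ∧ X (t + 1) ω = y})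
      = P.real (history X U t x u) * stepProb ψ (x t) j y := by
  have h := hG.step t (Function.update x (t + 1) y) (Function.update u (t + 1) j)
  have hcongr : history X U t (Function.update x (t + 1) y) (Function.update u (t + 1) j)
      = history X U t x u := by
    refine history_congr ?_ ?_ <;> intros <;> rw [Function.update_of_ne (by omega)]
  rw [history_succ, hcongr] at h
  simp only [Function.update_self, Function.update_of_ne t.lt_succ_self.ne] at h
  rw [measureReal_def, h, ENNReal.toReal_mul, ENNReal.toReal_ofReal (stepProb_nonneg _ _ _ _),
    measureReal_def]

variable (P X) in
/-- The distribution of the configuration at time `t` restricted to the event `A`. -/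
def stateMass (t : ℕ) (A : Set Ω) : Config n → ℝ := fun x => P.real (A ∩ {ω | X t ω = x})

theorem stateMass_eq_single {x : Config n} (hx : ∀ ω ∈ A, X t ω = x) :
    stateMass P X t A = Pi.single x (P.real A) := by
  funext y
  rcases eq_or_ne y x with rfl | hxy
  · rw [Pi.single_eq_same]
    exact congrArg P.real (Set.inter_eq_self_of_subset_left hx)
  · have hempty : A ∩ {ω | X t ω = y} = ∅ :=
      Set.eq_empty_of_forall_notMem fun ω hω => hxy (hω.2.symm.trans (hx ω hω.1))
    rw [Pi.single_eq_of_ne hxy, stateMass, hempty, measureReal_empty]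

variable [IsFiniteMeasure P]

theorem IsGlauber.measureReal_step (hG : IsGlauber ψ P X U) (hA : Adapted X U t A)
    {x : Config n} (hx : ∀ ω ∈ A, X t ω = x) (j : Fin n) (y : Config n) :
    P.real (A ∩ {ω | U (t + 1) ω = j ∧ X (t + 1) ω = y}) = P.real A * stepProb ψ x j y := by
  have hpart := hG.measurableSet_historyCode_preimage t
  rw [← sum_measureReal_preimage_inter hpart A, ← sum_measureReal_preimage_inter hpart (A ∩ _),
    sum_mul]
  refine sum_congr rfl fun c _ => ?_
  rw [← Set.inter_assoc]
  rcases (historyCode X U t ⁻¹' {c} ∩ A).eq_empty_or_nonempty with hc | ⟨ω₀, rfl, hω₀⟩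
  · simp [hc]
  · rw [historyCode_preimage, Set.inter_eq_self_of_subset_left (hA ω₀ hω₀),
      hG.measureReal_history_inter, hx ω₀ hω₀]

theorem IsGlauber.stateMass_dotProduct_one (hG : IsGlauber ψ P X U) (t : ℕ) (A : Set Ω) :
    stateMass P X t A ⬝ᵥ 1 = P.real A := by
  rw [← sum_measureReal_preimage_inter (f := X t) (fun x => hG.measurable_config t x) A]
  simp only [dotProduct, stateMass, Pi.one_apply, mul_one, Set.inter_comm A]
  rfl

theorem IsGlauber.stateMass_succ (hG : IsGlauber ψ P X U) (hA : Adapted X U t A)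
    (J : Finset (Fin n)) : stateMass P X (t + 1) (A ∩ {ω | U (t + 1) ω ∈ J})
      = stateMass P X t A ᵥ* stepMat ψ J := by
  funext y
  rw [stateMass, ← sum_measureReal_preimage_inter (f := X t) (fun x => hG.measurable_config t x)]
  refine sum_congr rfl fun x _ => ?_
  change _ = stateMass P X t A x * ∑ j ∈ J, stepProb ψ x j y
  rw [← sum_measureReal_preimage_inter (f := U (t + 1)) (fun j => hG.measurable_site (t + 1) j),
    mul_sum, ← sum_subset (subset_univ J)]
  · refine sum_congr rfl fun j hj => ?_
    rw [stateMass, ← hG.measureReal_step (hA.inter (adapted_config le_rfl x)) (fun ω hω => hω.2)]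
    congr 1
    ext ω
    simp only [Set.mem_inter_iff, Set.mem_preimage, Set.mem_singleton_iff, Set.mem_ofPred_eq]
    grind
  · intro j _ hj
    rw [← measureReal_empty (μ := P)]
    congr 1
    ext ω
    simp only [Set.mem_inter_iff, Set.mem_preimage, Set.mem_singleton_iff, Set.mem_ofPred_eq,
      Set.mem_empty_iff_false]
    grind

theorem IsGlauber.stateMass_add (hG : IsGlauber ψ P X U) (hA : Adapted X U t A)
    (J : Finset (Fin n)) (s : ℕ) :
    stateMass P X (t + s) (A ∩ {ω | ∀ r < s, U (t + r + 1) ω ∈ J})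
      = stateMass P X t A ᵥ* stepMat ψ J ^ s := by
  induction s with
  | zero => simp
  | succ s ih =>
    have hsplit : A ∩ {ω | ∀ r < s + 1, U (t + r + 1) ω ∈ J}
        = A ∩ {ω | ∀ r < s, U (t + r + 1) ω ∈ J} ∩ {ω | U (t + s + 1) ω ∈ J} := by
      ext ω
      simp only [Set.mem_inter_iff, Set.mem_ofPred_eq, Nat.forall_lt_succ_right, and_assoc]
    have hadapted := (hA.mono (Nat.le_add_right t s)).inter (adapted_sites le_rfl J)
    rw [hsplit, ← add_assoc, hG.stateMass_succ hadapted, ih, vecMul_vecMul, pow_succ]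

theorem IsGlauber.stateMass_nextSample (hG : IsGlauber ψ P X U) (hA : Adapted X U t A)
    (i : Fin n) (w s : ℕ) :
    stateMass P X (t + w + s + 1) (A ∩ {ω | ∀ r < s, U (t + w + r + 1) ω ∈ ({i}ᶜ : Finset (Fin n))}
        ∩ {ω | U (t + w + s + 1) ω ∈ ({i} : Finset (Fin n))})
      = stateMass P X t A ᵥ* sampleMat ψ i w s := by
  have hfree : stateMass P X (t + w) A = stateMass P X t A ᵥ* stepMat ψ univ ^ w := by
    simpa using hG.stateMass_add hA univ w
  have hAw := hA.mono (Nat.le_add_right t w)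
  rw [hG.stateMass_succ ((hAw.mono (by omega)).inter (adapted_sites le_rfl _)),
    hG.stateMass_add hAw, hfree, vecMul_vecMul, vecMul_vecMul, sampleMat, Matrix.mul_assoc]

theorem IsGlauber.measureReal_forall_mem (hG : IsGlauber ψ P X U) (t s : ℕ)
    (J : Finset (Fin n)) :
    P.real {ω | ∀ r < s, U (t + r + 1) ω ∈ J} = (#J / n) ^ s * P.real Set.univ := by
  have huniv : Adapted X U t Set.univ := fun _ _ => Set.subset_univ _
  have h := congrArg (· ⬝ᵥ 1) (hG.stateMass_add huniv J s)
  simpa only [Set.univ_inter, hG.stateMass_dotProduct_one, ← dotProduct_mulVec,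
    stepMat_pow_mulVec_one, dotProduct_smul, smul_eq_mul] using h

theorem IsGlauber.ae_frequently_site_eq (hG : IsGlauber ψ P X U) (i : Fin n) :
    ∀ᵐ ω ∂P, ∃ᶠ t in Filter.atTop, U t ω = i := by
  simp only [Filter.frequently_atTop, ae_all_iff]
  intro t
  have hn : (1 : ℝ) ≤ n := Nat.one_le_cast.2 i.pos
  have hbound (s : ℕ) : P.real {ω | ¬ ∃ b ≥ t, U b ω = i} ≤ (1 - 1 / n) ^ s * P.real Set.univ := by
    rw [← card_compl_singleton_div i, ← hG.measureReal_forall_mem t]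
    refine measureReal_mono fun ω hω r _ => ?_
    simpa using fun h => hω ⟨t + r + 1, by omega, h⟩
  have hle : (0 : ℝ) ≤ 1 - 1 / n := sub_nonneg.2 ((div_le_one (by positivity)).2 hn)
  have hlt : (1 : ℝ) - 1 / n < 1 := sub_lt_self 1 (by positivity)
  have hlim := (tendsto_pow_atTop_nhds_zero_of_lt_one hle hlt).mul_const (P.real Set.univ)
  rw [zero_mul] at hlim
  exact (measureReal_eq_zero_iff).1 (le_antisymm (ge_of_tendsto' hlim hbound) measureReal_nonneg)

end Markov

/-! ### The chain of samples -/

section Samples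

variable {Ω : Type*} (X : ℕ → Ω → Config n) (U : ℕ → Ω → Fin n) (i : Fin n) (w : ℕ)
  (y : ℕ → Config n)

/-- The event that the `m`-th sample time is `t` and that the first `m` samples, preceded by the
initial configuration, are `y 0, …, y m`. A sample time follows the previous one after `w` free
steps and the waiting time `s` for an update of `i`. -/
def sampleEvent : ℕ → ℕ → Set Ω
  | 0, t => {ω | t = 0 ∧ X 0 ω = y 0}
  | m + 1, t' => ⋃ p ∈ {p : ℕ × ℕ | p.1 + w + p.2 + 1 = t'}, sampleEvent m p.1
      ∩ {ω | ∀ r < p.2, U (p.1 + w + r + 1) ω ∈ ({i}ᶜ : Finset (Fin n))}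
      ∩ {ω | U (p.1 + w + p.2 + 1) ω ∈ ({i} : Finset (Fin n))}
      ∩ {ω | X (p.1 + w + p.2 + 1) ω = y (m + 1)}

variable {X U i w y}

theorem config_of_mem_sampleEvent {m t : ℕ} {ω : Ω} (h : ω ∈ sampleEvent X U i w y m t) :
    X t ω = y m := by
  cases m with
  | zero => obtain ⟨rfl, h⟩ := h; exact h
  | succ m => obtain ⟨p, rfl, -, h⟩ := Set.mem_iUnion₂.1 h; exact h

theorem adapted_sampleEvent (m t : ℕ) : Adapted X U t (sampleEvent X U i w y m t) := by
  induction m generalizing t with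
  | zero => exact fun ω₀ hω₀ ω hω => ⟨hω₀.1, (hω.1 0 t.zero_le).trans hω₀.2⟩
  | succ m ih =>
    intro ω₀ hω₀
    obtain ⟨p, rfl, hp⟩ := Set.mem_iUnion₂.1 hω₀
    refine Set.subset_iUnion₂_of_subset p rfl ((?_ : Adapted X U _ _) ω₀ hp)
    exact ((((ih p.1).mono (by omega)).inter (adapted_sites (by omega) _)).inter
      (adapted_site (by omega) le_rfl _)).inter (adapted_config le_rfl _)

/-- The number of free steps after each sample time. -/
def freeSteps (d n : ℕ) : ℕ := ⌈4 * Real.log d * n⌉₊ - 1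

theorem one_le_log_natCast {d : ℕ} (hd : 3 ≤ d) : 1 ≤ Real.log d := by
  have hd' : (3 : ℝ) ≤ d := Nat.ofNat_le_cast.2 hd
  rw [Real.le_log_iff_exp_le (by positivity)]
  linarith [Real.exp_one_lt_d9]

theorem succ_le_ceil_four_mul_log_mul {d : ℕ} (hd : 3 ≤ d) (hn : 0 < n) :
    n + 1 ≤ ⌈4 * Real.log d * n⌉₊ := by
  have hlog := one_le_log_natCast hd
  have hn' : (1 : ℝ) ≤ n := Nat.one_le_cast.2 hn
  have hle : ((n + 1 : ℕ) : ℝ) ≤ 4 * Real.log d * n := by push_cast; nlinarith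
  exact Nat.cast_le.1 (hle.trans (Nat.le_ceil _))

theorem le_freeSteps {d : ℕ} (hd : 3 ≤ d) (hn : 0 < n) : n ≤ freeSteps d n :=
  Nat.le_sub_of_add_le (succ_le_ceil_four_mul_log_mul hd hn)

theorem tau_succ {d : ℕ} (hd : 3 ≤ d) (i : Fin n) (u : ℕ → Fin n) (m : ℕ) :
    tau d i u (m + 1) = sInf {t | tau d i u m + freeSteps d n + 1 ≤ t ∧ u t = i} := by
  have hceil : freeSteps d n + 1 = ⌈4 * Real.log d * n⌉₊ := by
    have := succ_le_ceil_four_mul_log_mul hd i.pos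
    unfold freeSteps
    omega
  have hlog : 0 ≤ 4 * Real.log d * n := by
    have := Real.log_natCast_nonneg d
    positivity
  have hle (t : ℕ) : (tau d i u m : ℝ) + 4 * Real.log d * n ≤ t
      ↔ tau d i u m + freeSteps d n + 1 ≤ t := by
    rw [add_assoc, hceil, ← Nat.ceil_le, add_comm, Nat.ceil_add_natCast hlog, add_comm]
  simp only [tau, hle]

theorem exists_tau_succ_eq {d : ℕ} (hd : 3 ≤ d) {u : ℕ → Fin n}
    (hu : ∃ᶠ t in Filter.atTop, u t = i) (m : ℕ) :
    ∃ s, tau d i u m + freeSteps d n + s + 1 = tau d i u (m + 1) ∧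
      (∀ r < s, u (tau d i u m + freeSteps d n + r + 1) ≠ i) ∧ u (tau d i u (m + 1)) = i := by
  obtain ⟨hle, hsite⟩ := Nat.sInf_mem
    (s := {t | tau d i u m + freeSteps d n + 1 ≤ t ∧ u t = i}) (Filter.frequently_atTop.1 hu _)
  rw [← tau_succ hd] at hle hsite
  refine ⟨tau d i u (m + 1) - (tau d i u m + freeSteps d n + 1), by omega, fun r hr h => ?_, hsite⟩
  have hmin := Nat.sInf_le (s := {t | tau d i u m + freeSteps d n + 1 ≤ t ∧ u t = i})
    (m := tau d i u m + freeSteps d n + r + 1) ⟨by omega, h⟩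
  rw [← tau_succ hd] at hmin
  omega

theorem mem_sampleEvent_tau {d : ℕ} (hd : 3 ≤ d) {ω : Ω}
    (hω : ∃ᶠ t in Filter.atTop, U t ω = i) (m : ℕ)
    (hy : ∀ j ≤ m, X (tau d i (fun t => U t ω) j) ω = y j) :
    ω ∈ sampleEvent X U i (freeSteps d n) y m (tau d i (fun t => U t ω) m) := by
  induction m with
  | zero => exact ⟨rfl, hy 0 le_rfl⟩
  | succ m ih =>
    obtain ⟨s, hs, hwait, hsite⟩ := exists_tau_succ_eq hd hω m
    refine Set.mem_biUnion (x := (tau d i (fun t => U t ω) m, s)) hs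
      ⟨⟨⟨ih fun j hj => hy j (by omega), fun r hr => by simpa using hwait r hr⟩, ?_⟩, ?_⟩
    · simpa [hs] using hsite
    · simpa only [Set.mem_ofPred_eq, hs] using hy (m + 1) le_rfl

variable [MeasurableSpace Ω] {ψ : MPoly n} {P : Measure Ω} [IsFiniteMeasure P]

theorem IsGlauber.measure_nextSample (hG : IsGlauber ψ P X U) (m t s : ℕ) :
    P (sampleEvent X U i w y m t
        ∩ {ω | ∀ r < s, U (t + w + r + 1) ω ∈ ({i}ᶜ : Finset (Fin n))}
        ∩ {ω | U (t + w + s + 1) ω ∈ ({i} : Finset (Fin n))}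
        ∩ {ω | X (t + w + s + 1) ω = y (m + 1)})
      = P (sampleEvent X U i w y m t)
        * ENNReal.ofReal (sampleMat ψ i w s (y m) (y (m + 1))) := by
  have hadapted : Adapted X U t (sampleEvent X U i w y m t) := adapted_sampleEvent m t
  have h := congrFun (hG.stateMass_nextSample hadapted i w s) (y (m + 1))
  rw [stateMass_eq_single fun ω => config_of_mem_sampleEvent, single_vecMul] at h
  rw [← ofReal_measureReal, ← ofReal_measureReal, ← ENNReal.ofReal_mul measureReal_nonneg]
  exact congrArg ENNReal.ofReal h

theorem IsGlauber.tsum_measure_sampleEvent_le (hG : IsGlauber ψ P X U) (m : ℕ) :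
    ∑' t, P (sampleEvent X U i w y m t) ≤ P {ω | X 0 ω = y 0} *
      ∏ j ∈ range m, ENNReal.ofReal (sampleKernel ψ i w (y j) (y (j + 1))) := by
  induction m with
  | zero =>
    rw [tsum_eq_single 0 fun t ht => by simp [sampleEvent, ht]]
    simp [sampleEvent]
  | succ m ih =>
    calc ∑' t, P (sampleEvent X U i w y (m + 1) t)
        ≤ ∑' t, ∑' p : (fun p : ℕ × ℕ => p.1 + w + p.2 + 1) ⁻¹' {t},
            P (sampleEvent X U i w y m p.1.1)
              * ENNReal.ofReal (sampleMat ψ i w p.1.2 (y m) (y (m + 1))) :=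
          ENNReal.tsum_le_tsum fun t => (measure_biUnion_le P (Set.to_countable _) _).trans_eq
            (tsum_congr fun p => hG.measure_nextSample m p.1.1 p.1.2)
      _ = ∑' t, ∑' s, P (sampleEvent X U i w y m t)
            * ENNReal.ofReal (sampleMat ψ i w s (y m) (y (m + 1))) := by
          rw [ENNReal.tsum_fiberwise (fun p : ℕ × ℕ => P (sampleEvent X U i w y m p.1)
            * ENNReal.ofReal (sampleMat ψ i w p.2 (y m) (y (m + 1)))), 
            ENNReal.tsum_prod (f := fun t s => P (sampleEvent X U i w y m t)
              * ENNReal.ofReal (sampleMat ψ i w s (y m) (y (m + 1))))]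
      _ = (∑' t, P (sampleEvent X U i w y m t))
            * ENNReal.ofReal (sampleKernel ψ i w (y m) (y (m + 1))) := by
          simp only [ENNReal.tsum_mul_left, ENNReal.tsum_mul_right, sampleKernel,
            ENNReal.ofReal_tsum_of_nonneg (fun s => entryNonneg_sampleMat ψ i w s _ _)
              (summable_sampleMat ψ i w _ _)]
      _ ≤ _ := by
          rw [prod_range_succ, ← mul_assoc]
          gcongr

theorem IsGlauber.measure_samples_le (hG : IsGlauber ψ P X U) {d : ℕ} (hd : 3 ≤ d) (i : Fin n)
    (m : ℕ) (y : ℕ → Config n) :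
    P {ω | ∀ j ≤ m, X (tau d i (fun t => U t ω) j) ω = y j} ≤ P {ω | X 0 ω = y 0} *
      ∏ j ∈ range m, ENNReal.ofReal (sampleKernel ψ i (freeSteps d n) (y j) (y (j + 1))) := by
  refine le_trans (measure_mono_ae ?_) ((measure_iUnion_le _).trans
    (hG.tsum_measure_sampleEvent_le m))
  filter_upwards [hG.ae_frequently_site_eq i] with ω hω hy
  exact Set.mem_iUnion.2 ⟨_, mem_sampleEvent_tau hd hω m hy⟩

end Samples

/-! ### Concentration along a Markov chain -/

section Stochastic

variable {α : Type*} [Fintype α] [DecidableEq α] {K : Matrix α α ℝ} {f : α → ℝ}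

theorem abs_mulVec_le_one (hK : K ∈ rowStochastic ℝ α) (hf : ∀ x, |f x| ≤ 1) (x : α) :
    |(K *ᵥ f) x| ≤ 1 := by
  rw [← sum_row_of_mem_rowStochastic hK x]
  refine (abs_sum_le_sum_abs _ _).trans (sum_le_sum fun y _ => ?_)
  rw [abs_mul, abs_of_nonneg (nonneg_of_mem_rowStochastic hK)]
  exact mul_le_of_le_one_right (nonneg_of_mem_rowStochastic hK) (hf y)

theorem sum_mul_exp_centered_le (hK : K ∈ rowStochastic ℝ α) (hf : ∀ x, |f x| ≤ 1) (s : ℝ)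
    (x : α) : ∑ y, K x y * Real.exp (s * (f y - (K *ᵥ f) x)) ≤ Real.exp (4 * s ^ 2) := by
  set g := (K *ᵥ f) x
  have hexp (y : α) : Real.exp (s * (f y - g)) ≤ s * (f y - g) + Real.exp (4 * s ^ 2) := by
    have hsub : |f y - g| ≤ 2 :=
      (abs_sub _ _).trans (by linarith [hf y, abs_mulVec_le_one hK hf x])
    have hsq : (f y - g) ^ 2 ≤ 2 ^ 2 := sq_le_sq.2 (by simpa using hsub)
    refine (exp_le_add_exp_sq _).trans (add_le_add_right (Real.exp_le_exp.2 ?_) _)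
    nlinarith [sq_nonneg s]
  have hsum := sum_row_of_mem_rowStochastic hK x
  calc ∑ y, K x y * Real.exp (s * (f y - g))
      ≤ ∑ y, K x y * (s * (f y - g) + Real.exp (4 * s ^ 2)) := by
        gcongr with y
        exacts [nonneg_of_mem_rowStochastic hK, hexp y]
    _ = s * (∑ y, K x y * f y - (∑ y, K x y) * g) + (∑ y, K x y) * Real.exp (4 * s ^ 2) := by
        rw [sum_mul, sum_mul, ← sum_sub_distrib, mul_sum, ← sum_add_distrib]
        exact sum_congr rfl fun y _ => by ring
    _ = Real.exp (4 * s ^ 2) := by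
        rw [hsum, show ∑ y, K x y * f y = g from rfl]
        ring

end Stochastic

theorem sum_paths_le {α : Type*} [Fintype α] (κ : α → α → ENNReal) {q : ENNReal}
    (hκ : ∀ x, ∑ y, κ x y ≤ q) (T : ℕ) (a : α → ENNReal) :
    ∑ z : Fin (T + 1) → α, a (z 0) * ∏ m : Fin T, κ (z m.castSucc) (z m.succ)
      ≤ (∑ x, a x) * q ^ T := by
  induction T generalizing a with
  | zero =>
    rw [← (Fin.consEquiv fun _ => α).sum_comp, Fintype.sum_prod_type]
    simp [Fin.consEquiv]
  | succ T ih =>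
    calc ∑ z : Fin (T + 2) → α, a (z 0) * ∏ m : Fin (T + 1), κ (z m.castSucc) (z m.succ)
        = ∑ z : Fin (T + 1) → α, (∑ x, a x * κ x (z 0))
            * ∏ m : Fin T, κ (z m.castSucc) (z m.succ) := by
          rw [← (Fin.consEquiv fun _ => α).sum_comp, Fintype.sum_prod_type_right]
          refine sum_congr rfl fun z _ => ?_
          rw [sum_mul]
          refine sum_congr rfl fun x _ => ?_
          simp only [Fin.prod_univ_succ (n := T), Fin.consEquiv, Equiv.coe_fn_mk,
            Fin.castSucc_zero, Fin.cons_zero, Fin.cons_succ, ← Fin.succ_castSucc, mul_assoc]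
      _ ≤ (∑ y, ∑ x, a x * κ x y) * q ^ T := ih _
      _ = (∑ x, a x * ∑ y, κ x y) * q ^ T := by
          rw [sum_comm]
          simp only [mul_sum]
      _ ≤ (∑ x, a x * q) * q ^ T := by
          gcongr with x
          exact hκ x
      _ = (∑ x, a x) * q ^ (T + 1) := by rw [← sum_mul, pow_succ', mul_assoc]

/-- The sum over the first `T` steps of the path `y` of the differences between the value of `f` at
the next state and its conditional expectation for the transition matrix `K`, as a linear functional
of `f`. -/
def deviation {α : Type*} [Fintype α] (K : Matrix α α ℝ) (T : ℕ) (y : ℕ → α) :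
    (α → ℝ) →ₗ[ℝ] ℝ :=
  ∑ m : Fin T, (LinearMap.proj (y (m + 1)) - LinearMap.proj (y m) ∘ₗ K.mulVecLin)

theorem deviation_apply {α : Type*} [Fintype α] (K : Matrix α α ℝ) (T : ℕ) (y : ℕ → α)
    (f : α → ℝ) : deviation K T y f = ∑ m : Fin T, (f (y (m + 1)) - (K *ᵥ f) (y m)) := by
  simp [deviation]

/-- The finite-dimensional distributions of `Y` are bounded by those of a Markov chain with
transition matrix `K`. Only upper bounds on the probabilities of paths enter the concentration
inequality, so that nothing has to be said about null events or measurability. -/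
structure IsChain {Ω α : Type*} [MeasurableSpace Ω] [Fintype α] [DecidableEq α] (P : Measure Ω)
    (Y : ℕ → Ω → α) (K : Matrix α α ℝ) : Prop where
  mem_rowStochastic : K ∈ rowStochastic ℝ α
  initial : ∑ x, P {ω | Y 0 ω = x} ≤ 1
  path : ∀ (m : ℕ) (y : ℕ → α), P {ω | ∀ j ≤ m, Y j ω = y j} ≤ P {ω | Y 0 ω = y 0} *
    ∏ j ∈ range m, ENNReal.ofReal (K (y j) (y (j + 1)))

namespace IsChain

variable {Ω α : Type*} [MeasurableSpace Ω] [Fintype α] [DecidableEq α] {P : Measure Ω}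
  {Y : ℕ → Ω → α} {K : Matrix α α ℝ} {f : α → ℝ}

theorem path_fin (h : IsChain P Y K) (T : ℕ) (z : Fin (T + 1) → α) :
    P {ω | ∀ j : Fin (T + 1), Y j ω = z j} ≤ P {ω | Y 0 ω = z 0} *
      ∏ m : Fin T, ENNReal.ofReal (K (z m.castSucc) (z m.succ)) := by
  have hz (j : Fin (T + 1)) : z (Fin.ofNat (T + 1) j) = z j := by simp
  convert h.path T fun j => z (Fin.ofNat (T + 1) j) using 3
  · congr with ω
    exact ⟨fun hω j hj => (hω ⟨j, by omega⟩).trans (hz ⟨j, by omega⟩).symm,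
      fun hω j => (hω j (by omega)).trans (hz j)⟩
  · rfl
  · rw [prod_range]
    refine prod_congr rfl fun m _ => ?_
    rw [← hz m.castSucc, ← hz m.succ]
    rfl

theorem sum_path_mul_exp_le (h : IsChain P Y K) (hf : ∀ x, |f x| ≤ 1) (T : ℕ) (s : ℝ) :
    ∑ z : Fin (T + 1) → α, P {ω | ∀ j : Fin (T + 1), Y j ω = z j} * ENNReal.ofReal
        (Real.exp (s * ∑ m : Fin T, (f (z m.succ) - (K *ᵥ f) (z m.castSucc))))
      ≤ ENNReal.ofReal (Real.exp (4 * s ^ 2)) ^ T := by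
  set κ : α → α → ENNReal := fun x y =>
    ENNReal.ofReal (K x y) * ENNReal.ofReal (Real.exp (s * (f y - (K *ᵥ f) x))) with hκ
  have hκ_sum (x : α) : ∑ y, κ x y ≤ ENNReal.ofReal (Real.exp (4 * s ^ 2)) := by
    have hK (y : α) : 0 ≤ K x y := nonneg_of_mem_rowStochastic h.mem_rowStochastic
    simp only [hκ, ← ENNReal.ofReal_mul (hK _)]
    rw [← ENNReal.ofReal_sum_of_nonneg fun y _ => mul_nonneg (hK y) (Real.exp_pos _).le]
    exact ENNReal.ofReal_le_ofReal (sum_mul_exp_centered_le h.mem_rowStochastic hf s x)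
  calc _ ≤ ∑ z : Fin (T + 1) → α, P {ω | Y 0 ω = z 0}
          * ∏ m : Fin T, κ (z m.castSucc) (z m.succ) := by
        refine sum_le_sum fun z _ => ?_
        rw [mul_sum, Real.exp_sum, ENNReal.ofReal_prod_of_nonneg fun m _ => (Real.exp_pos _).le,
          prod_mul_distrib, ← mul_assoc]
        gcongr
        exact h.path_fin T z
    _ ≤ (∑ x, P {ω | Y 0 ω = x}) * ENNReal.ofReal (Real.exp (4 * s ^ 2)) ^ T :=
        sum_paths_le κ hκ_sum T fun x => P {ω | Y 0 ω = x}
    _ ≤ ENNReal.ofReal (Real.exp (4 * s ^ 2)) ^ T := mul_le_of_le_one_left zero_le h.initial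

theorem measure_deviation_le (h : IsChain P Y K) (hf : ∀ x, |f x| ≤ 1) (T : ℕ) {η : ℝ}
    (hη : 0 ≤ η) :
    P {ω | T * η ≤ deviation K T (Y · ω) f}
      ≤ ENNReal.ofReal (Real.exp (-(T * η ^ 2 / 16))) := by
  -- Chernoff bound; `s = η / 8` minimizes `4 * s ^ 2 - s * η`
  set s := η / 8 with hs
  set D : (Fin (T + 1) → α) → ℝ :=
    fun z => ∑ m : Fin T, (f (z m.succ) - (K *ᵥ f) (z m.castSucc)) with hD
  have hcover : {ω | T * η ≤ deviation K T (Y · ω) f} ⊆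
      ⋃ z ∈ univ.filter (T * η ≤ D ·), {ω | ∀ j : Fin (T + 1), Y j ω = z j} := fun ω hω =>
    Set.mem_biUnion (x := fun j : Fin (T + 1) => Y j ω)
      (by simpa [hD, deviation_apply] using hω) fun _ => rfl
  have hmarkov (z : Fin (T + 1) → α) (hz : T * η ≤ D z) :
      1 ≤ ENNReal.ofReal (Real.exp (-(s * (T * η)))) * ENNReal.ofReal (Real.exp (s * D z)) := by
    rw [← ENNReal.ofReal_mul (Real.exp_pos _).le, ← Real.exp_add, ENNReal.one_le_ofReal]
    have := mul_le_mul_of_nonneg_left hz (by positivity : 0 ≤ s)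
    exact Real.one_le_exp (by linarith)
  calc _ ≤ ∑ z ∈ univ.filter (T * η ≤ D ·), P {ω | ∀ j : Fin (T + 1), Y j ω = z j} :=
        (measure_mono hcover).trans (measure_biUnion_finset_le _ _)
    _ ≤ ∑ z ∈ univ.filter (T * η ≤ D ·), ENNReal.ofReal (Real.exp (-(s * (T * η)))) *
          (P {ω | ∀ j : Fin (T + 1), Y j ω = z j} * ENNReal.ofReal (Real.exp (s * D z))) :=
        sum_le_sum fun z hz => by
          rw [mul_left_comm]
          exact le_mul_of_one_le_right' (hmarkov z (mem_filter.1 hz).2)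
    _ ≤ ∑ z, ENNReal.ofReal (Real.exp (-(s * (T * η)))) *
          (P {ω | ∀ j : Fin (T + 1), Y j ω = z j} * ENNReal.ofReal (Real.exp (s * D z))) :=
        sum_le_sum_of_subset (filter_subset _ _)
    _ ≤ ENNReal.ofReal (Real.exp (-(s * (T * η)))) *
          ENNReal.ofReal (Real.exp (4 * s ^ 2)) ^ T := by
        rw [← mul_sum]
        gcongr
        exact h.sum_path_mul_exp_le hf T s
    _ = ENNReal.ofReal (Real.exp (-(T * η ^ 2 / 16))) := by
        rw [← ENNReal.ofReal_pow (Real.exp_pos _).le, ← ENNReal.ofReal_mul (Real.exp_pos _).le,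
          ← Real.exp_nat_mul, ← Real.exp_add, hs]
        ring_nf

theorem measure_abs_deviation_le (h : IsChain P Y K) (hf : ∀ x, |f x| ≤ 1) (T : ℕ) {η : ℝ}
    (hη : 0 ≤ η) :
    P {ω | ¬ |deviation K T (Y · ω) f| ≤ T * η}
      ≤ ENNReal.ofReal (2 * Real.exp (-(T * η ^ 2 / 16))) := by
  have hcover : {ω | ¬ |deviation K T (Y · ω) f| ≤ T * η} ⊆
      {ω | T * η ≤ deviation K T (Y · ω) f} ∪ {ω | T * η ≤ deviation K T (Y · ω) (-f)} := by
    intro ω hω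
    refine (lt_abs.1 (not_le.1 hω)).imp le_of_lt fun hneg => ?_
    change T * η ≤ deviation K T (Y · ω) (-f)
    rw [map_neg]
    exact hneg.le
  rw [two_mul, ENNReal.ofReal_add (Real.exp_pos _).le (Real.exp_pos _).le]
  exact (measure_mono hcover).trans ((measure_union_le _ _).trans (add_le_add
    (h.measure_deviation_le hf T hη)
    (h.measure_deviation_le (f := -f) (fun x => by simpa using hf x) T hη)))

theorem measure_not_forall_abs_deviation_le (h : IsChain P Y K) {ι : Type*} (s : Finset ι)
    {g : ι → α → ℝ} (hg : ∀ j ∈ s, ∀ x, |g j x| ≤ 1) (T : ℕ) {η : ℝ} (hη : 0 ≤ η) :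
    P {ω | ¬ ∀ j ∈ s, |deviation K T (Y · ω) (g j)| ≤ T * η}
      ≤ ENNReal.ofReal (#s * (2 * Real.exp (-(T * η ^ 2 / 16)))) := by
  have hunion : {ω | ¬ ∀ j ∈ s, |deviation K T (Y · ω) (g j)| ≤ T * η}
      = ⋃ j ∈ s, {ω | ¬ |deviation K T (Y · ω) (g j)| ≤ T * η} := by
    ext ω
    simp
  calc _ ≤ ∑ j ∈ s, P {ω | ¬ |deviation K T (Y · ω) (g j)| ≤ T * η} :=
        hunion ▸ measure_biUnion_finset_le _ _
    _ ≤ ∑ _j ∈ s, ENNReal.ofReal (2 * Real.exp (-(T * η ^ 2 / 16))) :=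
        sum_le_sum fun j hj => h.measure_abs_deviation_le (hg j hj) T hη
    _ = _ := by
        rw [sum_const, nsmul_eq_mul, ENNReal.ofReal_mul (p := (#s : ℝ)) (by positivity),
          ENNReal.ofReal_natCast]

end IsChain

theorem IsGlauber.isChain {Ω : Type*} [MeasurableSpace Ω] {ψ : MPoly n} {P : Measure Ω}
    [IsProbabilityMeasure P] {X : ℕ → Ω → Config n} {U : ℕ → Ω → Fin n}
    (hG : IsGlauber ψ P X U) {d : ℕ} (hd : 3 ≤ d) (i : Fin n) :
    IsChain P (fun m ω => X (tau d i (fun t => U t ω) m) ω)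
      (sampleKernel ψ i (freeSteps d n)) where
  mem_rowStochastic := sampleKernel_mem_rowStochastic ψ i _
  initial := (sum_measure_preimage_singleton (μ := P) univ
    fun x _ => hG.measurable_config 0 x).le.trans prob_le_one
  path := hG.measure_samples_le hd i

/-! ### Node-wise logistic regression -/

theorem pderiv_varsIn_neighbors (ψ : MPoly n) (i : Fin n) :
    (ψ.pderiv i).VarsIn (neighbors ψ i) := fun S hS j hj => by
  simpa [neighbors] using ⟨S, hj, hS⟩

theorem notMem_neighbors (ψ : MPoly n) (i : Fin n) : i ∉ neighbors ψ i := by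
  simp +contextual [neighbors, MPoly.pderiv]

theorem IsMRF.pderiv_mem_feasible {k d : ℕ} {lam : ℝ} {ψ : MPoly n} (h : IsMRF k d lam ψ)
    (i : Fin n) : ψ.pderiv i ∈ feasible (neighbors ψ i) k lam :=
  ⟨pderiv_varsIn_neighbors ψ i, h.degree.pderiv i, h.width i⟩

/-- Half of the derivative of the negative loss of the sample `x`, at the polynomial `p`, with
respect to the value of `p` at `x`. -/
def score (i : Fin n) (p : MPoly n) (x : Config n) : ℝ :=
  spin x i * sigm (-(2 * spin x i * p.eval x))

theorem abs_score_le_one (i : Fin n) (p : MPoly n) (x : Config n) : |score i p x| ≤ 1 := by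
  rw [score, abs_mul, abs_spin, one_mul, abs_of_pos (sigm_pos _)]
  exact (sigm_lt_one _).le

/-- When `p = ∂_i ψ`, the two values `σ(2p) σ(-2p)` and `-σ(-2p) σ(2p)` of the weighted score
cancel: the score of the truth is a martingale difference. -/
theorem updOp_score_mul (ψ : MPoly n) {i : Fin n} {N : Finset (Fin n)} {f : Config n → ℝ}
    (hψ : (ψ.pderiv i).VarsIn N) (hi : i ∉ N) (hf : ∀ x e, f (Function.update x i e) = f x) :
    updOp ψ i (score i (ψ.pderiv i) * f) = 0 := by
  funext x
  simp only [updOp_eq, score, Pi.mul_apply, hf, hψ.eval_update hi, spin, Function.update_self,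
    ← sigm_neg]
  norm_num
  ring

theorem MPoly.eval_eq_sum_smul_chi (p : MPoly n) : p.eval = ∑ S, p S • chi S := by
  funext x
  simp [MPoly.eval_eq_sum_chi]

theorem MPoly.abs_map_mul_eval_le {p : MPoly n} {F : Finset (Finset (Fin n))}
    (hF : ∀ S, p S ≠ 0 → S ∈ F) (L : (Config n → ℝ) →ₗ[ℝ] ℝ) {g : Config n → ℝ} {b : ℝ}
    (hg : ∀ S ∈ F, |L (g * chi S)| ≤ b) : |L (g * p.eval)| ≤ p.l1Norm * b := by
  rw [p.eval_eq_sum_smul_chi, mul_sum, map_sum, MPoly.l1Norm, sum_mul]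
  refine (abs_sum_le_sum_abs _ _).trans (sum_le_sum fun S _ => ?_)
  rw [mul_smul_comm, map_smul, smul_eq_mul, abs_mul]
  rcases eq_or_ne (p S) 0 with hS | hS
  · simp [hS]
  · gcongr
    exact hg S (hF S hS)

/-- The initial configuration and the samples `y 1, …, y T` deviate by at most `η` on average from
their conditional means, in all second moments of monomials in `F` and in all derivatives of the
loss at `p`. -/
structure Typical (K : Matrix (Config n) (Config n) ℝ) (i : Fin n) (F : Finset (Finset (Fin n)))
    (p : MPoly n) (T : ℕ) (η : ℝ) (y : ℕ → Config n) : Prop where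
  chi_mul_chi : ∀ SS' ∈ F ×ˢ F, |deviation K T y (chi SS'.1 * chi SS'.2)| ≤ T * η
  score_mul_chi : ∀ S ∈ F, |deviation K T y (score i p * chi S)| ≤ T * η

namespace Typical

variable {K : Matrix (Config n) (Config n) ℝ} {i : Fin n} {F : Finset (Finset (Fin n))}
  {q r : MPoly n} {T : ℕ} {η : ℝ} {y : ℕ → Config n}

theorem le_sum_eval_sq (h : Typical K i F q T η y) (hF : ∀ S, r S ≠ 0 → S ∈ F) :
    ∑ m : Fin T, (K *ᵥ r.eval ^ 2) (y m) - r.l1Norm * (r.l1Norm * (T * η))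
      ≤ ∑ m : Fin T, r.eval (y (m + 1)) ^ 2 := by
  have hdev : |deviation K T y (r.eval * r.eval)| ≤ r.l1Norm * (r.l1Norm * (T * η)) := by
    refine MPoly.abs_map_mul_eval_le hF _ fun S hS => ?_
    rw [mul_comm]
    exact MPoly.abs_map_mul_eval_le hF _ fun S' hS' =>
      h.chi_mul_chi (S, S') (mem_product.2 ⟨hS, hS'⟩)
  rw [← sq, deviation_apply, sum_sub_distrib] at hdev
  have hlower := neg_le_of_abs_le hdev
  simp only [Pi.pow_apply] at hlower
  linarith

theorem sum_score_mul_eval_le (h : Typical K i F q T η y) (hF : ∀ S, r S ≠ 0 → S ∈ F)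
    (hK : K *ᵥ (score i q * r.eval) = 0) :
    ∑ m : Fin T, score i q (y (m + 1)) * r.eval (y (m + 1)) ≤ r.l1Norm * (T * η) := by
  have hdev := (le_abs_self _).trans (MPoly.abs_map_mul_eval_le hF _ h.score_mul_chi)
  simpa [deviation_apply, hK] using hdev

end Typical

section Loss

variable {T : ℕ} {lam : ℝ} {p q : MPoly n}

theorem mul_empLoss (i : Fin n) (Z : Fin T → Config n) (p : MPoly n) :
    T * empLoss i Z p = ∑ m, logisticLoss (2 * spin (Z m) i * p.eval (Z m)) := by
  rcases T.eq_zero_or_pos with rfl | hT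
  · simp
  · rw [empLoss]
    field

theorem logisticLoss_add_le (hp : p.l1Norm ≤ lam) (hq : q.l1Norm ≤ lam) (i : Fin n)
    (x : Config n) :
    logisticLoss (2 * spin x i * q.eval x) - 2 * (score i q x * (p - q).eval x)
        + Real.exp (-(2 * lam)) / 2 * (p - q).eval x ^ 2
      ≤ logisticLoss (2 * spin x i * p.eval x) := by
  have hmem {p : MPoly n} (hp : p.l1Norm ≤ lam) :
      2 * spin x i * p.eval x ∈ Set.Icc (-(2 * lam)) (2 * lam) := by
    refine abs_le.1 ?_
    rw [abs_mul, abs_mul, abs_spin, abs_two, mul_one]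
    linarith [p.abs_eval_le x]
  have hspin : spin x i ^ 2 = 1 := by rw [← sq_abs, abs_spin, one_pow]
  have htangent := tangent_add_sq_le_of_strongConvexOn (strongConvexOn_logisticLoss (2 * lam))
    (hmem hq) (hmem hp) (hasDerivAt_logisticLoss _)
  rw [← mul_sub, ← MPoly.eval_sub, mul_pow, mul_pow, hspin] at htangent
  refine htangent.trans_eq' ?_
  rw [score]
  ring

theorem mul_empLoss_add_le (hp : p.l1Norm ≤ lam) (hq : q.l1Norm ≤ lam) (i : Fin n)
    (Z : Fin T → Config n) :
    T * empLoss i Z q - 2 * ∑ m, score i q (Z m) * (p - q).eval (Z m)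
        + Real.exp (-(2 * lam)) / 2 * ∑ m, (p - q).eval (Z m) ^ 2 ≤ T * empLoss i Z p := by
  rw [mul_empLoss, mul_empLoss, mul_sum, mul_sum, ← sum_sub_distrib, ← sum_add_distrib]
  exact sum_le_sum fun m _ => logisticLoss_add_le hp hq i (Z m)

end Loss

section Recovery

variable {d k : ℕ} {lam : ℝ} {ψ : MPoly n}

theorem Typical.supNorm_sq_le (hM : IsMRF k d lam ψ) (hd : 3 ≤ d) (hlam : 0 ≤ lam) {i : Fin n}
    {T : ℕ} (hT : 0 < T) {η slack : ℝ} (hη : 0 ≤ η) {y : ℕ → Config n}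
    (h : Typical (sampleKernel ψ i (freeSteps d n)) i (monos (neighbors ψ i) k) (ψ.pderiv i)
      T η y) {p : MPoly n} (hp : p ∈ feasible (neighbors ψ i) k lam)
    (hloss : empLoss i (fun m : Fin T => y (m + 1)) p
      ≤ empLoss i (fun m : Fin T => y (m + 1)) (ψ.pderiv i) + slack) :
    Real.exp (-(2 * lam)) / 2 * spread d k lam * (p - ψ.pderiv i).supNorm ^ 2
      ≤ slack + 4 * lam * η + 2 * Real.exp (-(2 * lam)) * lam ^ 2 * η := by
  have hT' : (0 : ℝ) < T := Nat.cast_pos.2 hT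
  have hi := notMem_neighbors ψ i
  have hq := hM.pderiv_mem_feasible i
  set q := ψ.pderiv i
  set r := p - q with hr
  set c := Real.exp (-(2 * lam))
  have hvars : r.VarsIn (neighbors ψ i) := MPoly.VarsIn.sub hp.1 hq.1
  have hdeg : r.DegreeLE k := hp.2.1.sub hq.2.1
  have hF (S : Finset (Fin n)) (hS : r S ≠ 0) : S ∈ monos (neighbors ψ i) k :=
    mem_monos.2 ⟨hvars S hS, hdeg S hS⟩
  have hr1 : r.l1Norm ≤ 2 * lam := (p.l1Norm_sub_le q).trans (by linarith [hp.2.2, hq.2.2])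
  have hspread : T * (spread d k lam * r.supNorm ^ 2)
      ≤ ∑ m : Fin T, (sampleKernel ψ i (freeSteps d n) *ᵥ r.eval ^ 2) (y m) := by
    have := card_nsmul_le_sum univ (fun m : Fin T =>
      (sampleKernel ψ i (freeSteps d n) *ᵥ r.eval ^ 2) (y m)) _ fun m _ =>
        spread_mul_supNorm_sq_le (by omega) hlam hi (hM.card_neighbors i)
          (fun j _ => hM.width j) hvars hdeg (le_freeSteps hd i.pos) _
    simpa using this
  have hmoment : T * (spread d k lam * r.supNorm ^ 2) - 2 * lam * (2 * lam * (T * η))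
      ≤ ∑ m : Fin T, r.eval (y (m + 1)) ^ 2 := by
    refine le_trans ?_ (h.le_sum_eval_sq hF)
    have := r.l1Norm_nonneg
    gcongr
  have hscore : ∑ m : Fin T, score i q (y (m + 1)) * r.eval (y (m + 1)) ≤ 2 * lam * (T * η) := by
    refine (h.sum_score_mul_eval_le hF (sampleKernel_mulVec_eq_zero i _
      (updOp_score_mul ψ hq.1 hi fun x e => hvars.eval_update hi x e))).trans ?_
    gcongr
  have hconvex := mul_empLoss_add_le hp.2.2 hq.2.2 i fun m : Fin T => y (m + 1)
  have hloss' := mul_le_mul_of_nonneg_left hloss hT'.le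
  have hc := mul_le_mul_of_nonneg_left hmoment (by positivity : 0 ≤ c / 2)
  refine le_of_mul_le_mul_left ?_ hT'
  rw [← hr] at hconvex
  linarith

theorem IsGlauber.measure_not_typical_le {Ω : Type*} [MeasurableSpace Ω] {P : Measure Ω}
    [IsProbabilityMeasure P] {X : ℕ → Ω → Config n} {U : ℕ → Ω → Fin n}
    (hG : IsGlauber ψ P X U) (hM : IsMRF k d lam ψ) (hd : 3 ≤ d) (i : Fin n) (T : ℕ) {η : ℝ}
    (hη : 0 ≤ η) :
    P {ω | ¬ Typical (sampleKernel ψ i (freeSteps d n)) i (monos (neighbors ψ i) k)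
        (ψ.pderiv i) T η (fun m => X (tau d i (fun t => U t ω) m) ω)}
      ≤ ENNReal.ofReal (4 * ((d + 1) ^ k) ^ 2 * Real.exp (-(T * η ^ 2 / 16))) := by
  set K := sampleKernel ψ i (freeSteps d n)
  set F := monos (neighbors ψ i) k
  set Y : ℕ → Ω → Config n := fun m ω => X (tau d i (fun t => U t ω) m) ω
  set b := Real.exp (-(T * η ^ 2 / 16))
  have hchain : IsChain P Y K := hG.isChain hd i
  have hmoments := hchain.measure_not_forall_abs_deviation_le (F ×ˢ F)
    (g := fun SS' => chi SS'.1 * chi SS'.2) (fun SS' _ x => by simp [abs_mul, abs_chi]) T hη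
  have hscores := hchain.measure_not_forall_abs_deviation_le F
    (g := fun S => score i (ψ.pderiv i) * chi S)
    (fun S _ x => by simpa [abs_mul, abs_chi] using abs_score_le_one i _ x) T hη
  have hcover : {ω | ¬ Typical K i F (ψ.pderiv i) T η (Y · ω)}
      ⊆ {ω | ¬ ∀ SS' ∈ F ×ˢ F, |deviation K T (Y · ω) (chi SS'.1 * chi SS'.2)| ≤ T * η}
        ∪ {ω | ¬ ∀ S ∈ F, |deviation K T (Y · ω) (score i (ψ.pderiv i) * chi S)| ≤ T * η} :=
    fun ω hω => not_and_or.1 fun h => hω ⟨h.1, h.2⟩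
  have hcard : (#F : ℝ) ≤ (d + 1) ^ k := by
    exact_mod_cast card_monos_le (hM.card_neighbors i) k
  have hone : (1 : ℝ) ≤ (d + 1) ^ k := one_le_pow₀ (by linarith [d.cast_nonneg (α := ℝ)])
  refine (measure_mono hcover).trans ((measure_union_le _ _).trans
    ((add_le_add hmoments hscores).trans ?_))
  rw [← ENNReal.ofReal_add (by positivity) (by positivity), card_product, Nat.cast_mul]
  refine ENNReal.ofReal_le_ofReal ?_
  calc (#F * #F * (2 * b) + #F * (2 * b) : ℝ)
      ≤ (d + 1) ^ k * (d + 1) ^ k * (2 * b) + (d + 1) ^ k * (d + 1) ^ k * (2 * b) := by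
        gcongr
        exact hcard.trans (le_mul_of_one_le_right (by positivity) hone)
    _ = 4 * ((d + 1) ^ k) ^ 2 * b := by ring

end Recovery

theorem isClosed_feasible (N : Finset (Fin n)) (k : ℕ) (lam : ℝ) :
    IsClosed (feasible N k lam) := by
  have himp (S : Finset (Fin n)) (Q : Prop) : IsClosed {p : MPoly n | p S ≠ 0 → Q} := by
    by_cases hQ : Q
    · simp [hQ]
    · simpa [hQ] using isClosed_eq (continuous_apply S) continuous_const
  have hl1 : IsClosed {p : MPoly n | p.l1Norm ≤ lam} :=
    isClosed_le (continuous_finsetSum _ fun S _ => (continuous_apply S).abs) continuous_const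
  simp only [feasible, MPoly.DegreeLE, Set.ofPred_and, Set.ofPred_forall]
  exact (isClosed_iInter fun S => himp S _).inter ((isClosed_iInter fun S => himp S _).inter hl1)

theorem isCompact_feasible (N : Finset (Fin n)) (k : ℕ) (lam : ℝ) :
    IsCompact (feasible N k lam) := by
  refine (isCompact_univ_pi fun _ => isCompact_Icc (a := -lam) (b := lam)).of_isClosed_subset
    (isClosed_feasible N k lam) fun p hp S _ => abs_le.1 (le_trans ?_ hp.2.2)
  exact single_le_sum (f := fun S => |p S|) (fun _ _ => abs_nonneg _) (mem_univ S)

theorem continuous_empLoss {T : ℕ} (i : Fin n) (Z : Fin T → Config n) :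
    Continuous (empLoss i Z) := by
  have hloss : Continuous logisticLoss :=
    continuous_iff_continuousAt.2 fun z => (hasDerivAt_logisticLoss z).continuousAt
  have heval (x : Config n) : Continuous fun p : MPoly n => p.eval x :=
    continuous_finsetSum _ fun S _ => (continuous_apply S).mul_const _
  exact (continuous_finsetSum _ fun m _ => hloss.comp ((heval _).const_mul _)).const_mul _

theorem exists_isLogReg {T : ℕ} (i : Fin n) (N : Finset (Fin n)) (k : ℕ) {lam : ℝ}
    (hlam : 0 ≤ lam) (Z : Fin T → Config n) : ∃ p, IsLogReg i N k lam Z p := by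
  have hzero : (0 : MPoly n) ∈ feasible N k lam := by
    simp [feasible, MPoly.DegreeLE, MPoly.l1Norm, hlam]
  obtain ⟨p, hp, hmin⟩ := (isCompact_feasible N k lam).exists_isMinOn ⟨0, hzero⟩
    (continuous_empLoss i Z).continuousOn
  exact ⟨p, hp, fun q hq => hmin hq⟩

/-! ### Exponentiated gradient descent -/

theorem exp_add_le_exp {v c : ℝ} (h : v ^ 2 ≤ c) : Real.exp c + v ≤ Real.exp (v + 2 * c) := by
  have hc : 0 ≤ c := (sq_nonneg v).trans h
  have hone_sub : 0 ≤ 1 - Real.exp (-c) := sub_nonneg.2 (Real.exp_le_one_iff.2 (by linarith))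
  have hone_sub_sq : (1 - Real.exp (-c)) ^ 2 ≤ c := by
    nlinarith [Real.one_sub_le_exp_neg c, Real.exp_pos (-c)]
  have hv : v * Real.exp (-c) ≤ v + c := by nlinarith [sq_nonneg (v + (1 - Real.exp (-c)))]
  calc Real.exp c + v = Real.exp c * (1 + v * Real.exp (-c)) := by
        rw [mul_add, mul_one, mul_left_comm, ← Real.exp_add, add_neg_cancel, Real.exp_zero, mul_one]
    _ ≤ Real.exp c * (v + c + 1) := by
        refine mul_le_mul_of_nonneg_left ?_ (Real.exp_pos c).le
        linarith
    _ ≤ Real.exp c * Real.exp (v + c) := by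
        gcongr
        exact Real.add_one_le_exp _
    _ = Real.exp (v + 2 * c) := by
        rw [← Real.exp_add]
        ring_nf

theorem cosh_add_le (x y : ℝ) :
    Real.cosh (x + y) ≤ y * Real.sinh x + Real.exp (y ^ 2) * Real.cosh x := by
  have hy := mul_le_mul_of_nonneg_left (exp_le_add_exp_sq y) (Real.exp_pos x).le
  have hneg := mul_le_mul_of_nonneg_left (exp_le_add_exp_sq (-y)) (Real.exp_pos (-x)).le
  rw [← Real.exp_add] at hy hneg
  rw [neg_sq, ← neg_add] at hneg
  rw [Real.cosh_eq, Real.cosh_eq, Real.sinh_eq]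
  linarith

theorem abs_sinh_le_cosh (x : ℝ) : |Real.sinh x| ≤ Real.cosh x := by
  rw [Real.abs_sinh, ← Real.cosh_abs x]
  exact (Real.sinh_lt_cosh _).le

section Hedge

variable {ι : Type*} {F : Finset ι} {a b : ℝ}

/-- The potential of exponentiated gradient descent with step size `a` over the `ℓ¹` unit ball in
the coordinates `F`, after the gradients have accumulated to `G`: half the total weight of the
vertices of that ball, the vertex `±e_j` having weight `exp (∓ a * G j)`. -/
def hedgeWeight (F : Finset ι) (a : ℝ) (G : ι → ℝ) : ℝ :=
  ∑ j ∈ F, Real.cosh (a * G j)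

/-- The iterate of exponentiated gradient descent: the weighted mean of the vertices `±e_j`. -/
def hedgePoint (F : Finset ι) (a : ℝ) (G : ι → ℝ) (j : ι) : ℝ :=
  -(Real.sinh (a * G j) / hedgeWeight F a G)

theorem hedgeWeight_pos (hF : F.Nonempty) (a : ℝ) (G : ι → ℝ) : 0 < hedgeWeight F a G :=
  sum_pos (fun _ _ => Real.cosh_pos _) hF

theorem sum_abs_hedgePoint_le (F : Finset ι) (a : ℝ) (G : ι → ℝ) :
    ∑ j ∈ F, |hedgePoint F a G j| ≤ 1 := by
  have hW : 0 ≤ hedgeWeight F a G := sum_nonneg fun _ _ => (Real.cosh_pos _).le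
  simp only [hedgePoint, abs_neg, abs_div, abs_of_nonneg hW, ← sum_div]
  exact div_le_one_of_le₀ (sum_le_sum fun j _ => abs_sinh_le_cosh _) hW

theorem abs_sum_mul_le {g u : ι → ℝ} (hg : ∀ j ∈ F, |g j| ≤ b) :
    |∑ j ∈ F, g j * u j| ≤ b * ∑ j ∈ F, |u j| := by
  rw [mul_sum]
  refine (abs_sum_le_sum_abs _ _).trans (sum_le_sum fun j hj => ?_)
  rw [abs_mul]
  exact mul_le_mul_of_nonneg_right (hg j hj) (abs_nonneg _)

theorem hedgeWeight_add_le (hF : F.Nonempty) (a : ℝ) (G : ι → ℝ) {g : ι → ℝ}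
    (hg : ∀ j ∈ F, |g j| ≤ b) :
    hedgeWeight F a (G + g) ≤ hedgeWeight F a G *
      Real.exp (-(a * ∑ j ∈ F, g j * hedgePoint F a G j) + 2 * (a * b) ^ 2) := by
  have hW := hedgeWeight_pos hF a G
  set W := hedgeWeight F a G
  set v := -(a * ∑ j ∈ F, g j * hedgePoint F a G j)
  have hb : 0 ≤ b := (abs_nonneg _).trans (hg _ hF.choose_spec)
  have hv : v ^ 2 ≤ (a * b) ^ 2 := by
    rw [neg_sq, mul_pow, mul_pow]
    refine mul_le_mul_of_nonneg_left (sq_le_sq.2 ?_) (sq_nonneg a)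
    refine (abs_sum_mul_le hg).trans ?_
    rw [abs_of_nonneg hb]
    exact mul_le_of_le_one_right hb (sum_abs_hedgePoint_le F a G)
  have hv_mul : v * W = ∑ j ∈ F, a * g j * Real.sinh (a * G j) := by
    simp only [v, hedgePoint, mul_neg, sum_neg_distrib, neg_neg, mul_sum, sum_mul]
    refine sum_congr rfl fun j _ => ?_
    change a * (g j * (Real.sinh (a * G j) / W)) * W = _
    field
  calc hedgeWeight F a (G + g)
      ≤ ∑ j ∈ F, (a * g j * Real.sinh (a * G j)
          + Real.exp ((a * b) ^ 2) * Real.cosh (a * G j)) := by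
        refine sum_le_sum fun j hj => ?_
        rw [Pi.add_apply, mul_add]
        refine (cosh_add_le _ _).trans ?_
        have := (Real.cosh_pos (a * G j)).le
        rw [mul_pow, mul_pow, ← sq_abs (g j)]
        gcongr
        exact hg j hj
    _ = W * (Real.exp ((a * b) ^ 2) + v) := by
        rw [sum_add_distrib, ← hv_mul, ← mul_sum]
        change _ + _ * W = _
        ring
    _ ≤ W * Real.exp (v + 2 * (a * b) ^ 2) := by
        gcongr
        exact exp_add_le_exp hv

variable {G : ℕ → ι → ℝ}

theorem hedgeWeight_le (hF : F.Nonempty) (a : ℝ) (hG₀ : G 0 = 0)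
    (hG : ∀ r, ∀ j ∈ F, |G (r + 1) j - G r j| ≤ b) (R : ℕ) :
    hedgeWeight F a (G R) ≤ #F * Real.exp (-(a * ∑ r ∈ range R, ∑ j ∈ F,
      (G (r + 1) j - G r j) * hedgePoint F a (G r) j) + 2 * (a * b) ^ 2 * R) := by
  induction R with
  | zero => simp [hedgeWeight, hG₀]
  | succ R ih =>
    have hstep := hedgeWeight_add_le (g := G (R + 1) - G R) hF a (G R) (hG R)
    rw [add_sub_cancel] at hstep
    refine hstep.trans ((mul_le_mul_of_nonneg_right ih (Real.exp_pos _).le).trans_eq ?_)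
    rw [mul_assoc, ← Real.exp_add, sum_range_succ]
    simp only [Pi.sub_apply]
    push_cast
    ring_nf

theorem mul_abs_le_log_two_mul_hedgeWeight (a : ℝ) (G : ι → ℝ) {j : ι} (hj : j ∈ F) :
    a * |G j| ≤ Real.log (2 * hedgeWeight F a G) := by
  have hcosh : Real.cosh (a * G j) ≤ hedgeWeight F a G :=
    single_le_sum (f := fun j => Real.cosh (a * G j)) (fun _ _ => (Real.cosh_pos _).le) hj
  have hexp : Real.exp (a * |G j|) ≤ 2 * Real.cosh (a * G j) := by
    rcases abs_choice (G j) with h | h <;> rw [h, Real.cosh_eq, mul_div_cancel₀ _ two_ne_zero]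
    · linarith [Real.exp_pos (-(a * G j))]
    · rw [mul_neg]
      linarith [Real.exp_pos (a * G j)]
  rw [Real.le_log_iff_exp_le (by linarith [Real.exp_pos (a * |G j|)])]
  linarith

theorem hedge_regret_le (hF : F.Nonempty) (ha : 0 < a) (hG₀ : G 0 = 0)
    (hG : ∀ r, ∀ j ∈ F, |G (r + 1) j - G r j| ≤ b) {u : ι → ℝ} (hu : ∑ j ∈ F, |u j| ≤ 1)
    (R : ℕ) :
    ∑ r ∈ range R, ∑ j ∈ F, (G (r + 1) j - G r j) * (hedgePoint F a (G r) j - u j)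
      ≤ Real.log (2 * #F) / a + 2 * a * b ^ 2 * R := by
  set V := ∑ r ∈ range R, ∑ j ∈ F, (G (r + 1) j - G r j) * hedgePoint F a (G r) j
  set B := Real.log (2 * #F) / a - V + 2 * a * b ^ 2 * R with hB
  have hbound (j : ι) (hj : j ∈ F) : |G R j| ≤ B := by
    have hlog : a * |G R j| ≤ a * B :=
      calc a * |G R j| ≤ Real.log (2 * hedgeWeight F a (G R)) :=
            mul_abs_le_log_two_mul_hedgeWeight a (G R) hj
        _ ≤ Real.log (2 * #F * Real.exp (-(a * V) + 2 * (a * b) ^ 2 * R)) := by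
            rw [mul_assoc]
            have := hedgeWeight_pos hF a (G R)
            gcongr
            exact hedgeWeight_le hF a hG₀ hG R
        _ = a * B := by
            rw [Real.log_mul (by simp [hF.ne_empty]) (Real.exp_ne_zero _), Real.log_exp, hB]
            field
    exact le_of_mul_le_mul_left hlog ha
  have hB₀ : 0 ≤ B := (abs_nonneg _).trans (hbound _ hF.choose_spec)
  have htelescope : ∑ r ∈ range R, ∑ j ∈ F, (G (r + 1) j - G r j) * u j = ∑ j ∈ F, G R j * u j := by
    rw [sum_comm]
    refine sum_congr rfl fun j _ => ?_
    rw [← sum_mul, sum_range_sub (fun r => G r j), hG₀, Pi.zero_apply, sub_zero]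
  have hcompare : -∑ j ∈ F, G R j * u j ≤ B :=
    (neg_le_abs _).trans ((abs_sum_mul_le hbound).trans (mul_le_of_le_one_right hB₀ hu))
  simp only [mul_sub, sum_sub_distrib, htelescope]
  linarith

end Hedge

/-- The partial derivatives of the empirical loss with respect to the coefficients. -/
def lossGrad {T : ℕ} (i : Fin n) (Z : Fin T → Config n) (p : MPoly n) (S : Finset (Fin n)) : ℝ :=
  -(2 / T * ∑ m, score i p (Z m) * chi S (Z m))

/-- The point of exponentiated gradient descent in the `ℓ¹` ball of radius `lam`, as a
polynomial with monomials in `F`. -/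
def hedgePoly (F : Finset (Finset (Fin n))) (lam a : ℝ) (G : Finset (Fin n) → ℝ) : MPoly n :=
  fun S => if S ∈ F then lam * hedgePoint F a G S else 0

/-- The accumulated gradient after `r` rounds of exponentiated gradient descent for the empirical
loss. -/
def hedgeGrad {T : ℕ} (i : Fin n) (F : Finset (Finset (Fin n))) (lam a : ℝ)
    (Z : Fin T → Config n) : ℕ → Finset (Fin n) → ℝ
  | 0 => 0
  | r + 1 => hedgeGrad i F lam a Z r + lossGrad i Z (hedgePoly F lam a (hedgeGrad i F lam a Z r))

/-- The average of the iterates of exponentiated gradient descent in `R` rounds. -/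
def hedgeAvg {T : ℕ} (i : Fin n) (F : Finset (Finset (Fin n))) (lam a : ℝ) (R : ℕ)
    (Z : Fin T → Config n) : MPoly n :=
  (R : ℝ)⁻¹ • ∑ r ∈ range R, hedgePoly F lam a (hedgeGrad i F lam a Z r)

section LossDescent

variable {T : ℕ} {F : Finset (Finset (Fin n))} {lam : ℝ}

theorem abs_lossGrad_le (i : Fin n) (Z : Fin T → Config n) (p : MPoly n) (S : Finset (Fin n)) :
    |lossGrad i Z p S| ≤ 2 := by
  have hsum : |∑ m, score i p (Z m) * chi S (Z m)| ≤ T := by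
    refine (abs_sum_le_sum_abs _ _).trans ?_
    simpa [abs_mul, abs_chi] using sum_le_sum fun m (_ : m ∈ univ) => abs_score_le_one i p (Z m)
  rw [lossGrad, abs_neg, abs_mul, abs_of_nonneg (by positivity), div_mul_eq_mul_div]
  exact div_le_of_le_mul₀ (by positivity) (by norm_num) (by linarith)

theorem sum_lossGrad_mul (i : Fin n) (Z : Fin T → Config n) (p r : MPoly n) :
    ∑ S, lossGrad i Z p S * r S = -(2 / T * ∑ m, score i p (Z m) * r.eval (Z m)) := by
  simp only [lossGrad, MPoly.eval_eq_sum_chi r, mul_sum, sum_mul, neg_mul, sum_neg_distrib]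
  rw [sum_comm]
  congr! 3 with m _ S _
  ring

theorem empLoss_add_lossGrad_le (i : Fin n) (Z : Fin T → Config n) (p q : MPoly n) :
    empLoss i Z q + ∑ S, lossGrad i Z q S * (p - q) S ≤ empLoss i Z p := by
  rcases T.eq_zero_or_pos with rfl | hT
  · simp [empLoss, lossGrad]
  have hconvex := mul_empLoss_add_le (le_max_left p.l1Norm q.l1Norm) (le_max_right _ _) i Z
  have hsq : 0 ≤ Real.exp (-(2 * max p.l1Norm q.l1Norm)) / 2 * ∑ m, (p - q).eval (Z m) ^ 2 := by
    positivity
  have hT' : (0 : ℝ) < T := Nat.cast_pos.2 hT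
  refine le_of_mul_le_mul_left ?_ hT'
  rw [sum_lossGrad_mul, mul_add, mul_neg, ← mul_assoc, mul_div_cancel₀ _ hT'.ne']
  linarith

theorem hedgePoly_of_notMem {lam a : ℝ} {G : Finset (Fin n) → ℝ} {S : Finset (Fin n)}
    (hS : S ∉ F) : hedgePoly F lam a G S = 0 :=
  if_neg hS

theorem l1Norm_hedgePoly_le (hlam : 0 ≤ lam) (a : ℝ) (G : Finset (Fin n) → ℝ) :
    (hedgePoly F lam a G).l1Norm ≤ lam := by
  rw [MPoly.l1Norm, ← sum_subset (subset_univ F) fun S _ hS => by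
    rw [hedgePoly_of_notMem hS, abs_zero]]
  calc ∑ S ∈ F, |hedgePoly F lam a G S| = lam * ∑ S ∈ F, |hedgePoint F a G S| := by
        rw [mul_sum]
        exact sum_congr rfl fun S hS => by
          rw [hedgePoly, if_pos hS, abs_mul, abs_of_nonneg hlam]
    _ ≤ lam := mul_le_of_le_one_right hlam (sum_abs_hedgePoint_le F a G)

theorem hedgeAvg_of_notMem (i : Fin n) (a : ℝ) (R : ℕ) (Z : Fin T → Config n)
    {S : Finset (Fin n)} (hS : S ∉ F) : hedgeAvg i F lam a R Z S = 0 := by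
  simp [hedgeAvg, hedgePoly_of_notMem hS]

theorem l1Norm_hedgeAvg_le (hlam : 0 ≤ lam) (i : Fin n) (a : ℝ) (R : ℕ) (Z : Fin T → Config n) :
    (hedgeAvg i F lam a R Z).l1Norm ≤ lam := by
  calc _ ≤ ∑ S, (R : ℝ)⁻¹ * ∑ r ∈ range R, |hedgePoly F lam a (hedgeGrad i F lam a Z r) S| := by
        refine sum_le_sum fun S _ => ?_
        rw [hedgeAvg, Pi.smul_apply, Finset.sum_apply, smul_eq_mul, abs_mul,
          abs_of_nonneg (by positivity)]
        gcongr
        exact abs_sum_le_sum_abs _ _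
    _ = (R : ℝ)⁻¹ * ∑ r ∈ range R, (hedgePoly F lam a (hedgeGrad i F lam a Z r)).l1Norm := by
        rw [← mul_sum, sum_comm]
        rfl
    _ ≤ (R : ℝ)⁻¹ * (R * lam) := by
        gcongr
        simpa using sum_le_sum fun r (_ : r ∈ range R) => l1Norm_hedgePoly_le hlam a _
    _ ≤ lam := by
        rw [← mul_assoc]
        exact mul_le_of_le_one_left hlam (inv_mul_le_one_of_le₀ le_rfl R.cast_nonneg)

theorem hedgeAvg_mem_feasible (i : Fin n) (N : Finset (Fin n)) (k : ℕ) (hlam : 0 ≤ lam) (a : ℝ)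
    (R : ℕ) (Z : Fin T → Config n) : hedgeAvg i (monos N k) lam a R Z ∈ feasible N k lam := by
  have hsupport (S : Finset (Fin n)) (hS : hedgeAvg i (monos N k) lam a R Z S ≠ 0) :
      S ⊆ N ∧ #S ≤ k :=
    mem_monos.1 (not_imp_comm.1 (hedgeAvg_of_notMem i a R Z) hS)
  exact ⟨fun S hS => (hsupport S hS).1, fun S hS => (hsupport S hS).2,
    l1Norm_hedgeAvg_le hlam i a R Z⟩

variable {a : ℝ} {q : MPoly n}

theorem sum_lossGrad_mul_hedgePoly_sub_le (hF : F.Nonempty) (hlam : 0 < lam) (ha : 0 < a)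
    (hq : q.l1Norm ≤ lam) (hqF : ∀ S, q S ≠ 0 → S ∈ F) (i : Fin n) (R : ℕ)
    (Z : Fin T → Config n) :
    ∑ r ∈ range R, ∑ S, lossGrad i Z (hedgePoly F lam a (hedgeGrad i F lam a Z r)) S *
        (hedgePoly F lam a (hedgeGrad i F lam a Z r) - q) S
      ≤ lam * (Real.log (2 * #F) / a + 8 * a * R) := by
  set G := hedgeGrad i F lam a Z
  have hstep (r : ℕ) (S : Finset (Fin n)) :
      G (r + 1) S - G r S = lossGrad i Z (hedgePoly F lam a (G r)) S := by
    simp [G, hedgeGrad]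
  have hunit : ∑ S ∈ F, |q S / lam| ≤ 1 := by
    simp only [abs_div, abs_of_pos hlam, ← sum_div]
    exact div_le_one_of_le₀ ((sum_le_univ_sum_of_nonneg fun _ => abs_nonneg _).trans hq) hlam.le
  have hregret := hedge_regret_le hF ha (G := G) rfl
    (fun r S _ => (hstep r S).symm ▸ abs_lossGrad_le i Z _ S) hunit R
  calc _ = ∑ r ∈ range R, ∑ S ∈ F,
          lam * ((G (r + 1) S - G r S) * (hedgePoint F a (G r) S - q S / lam)) := by
        refine sum_congr rfl fun r _ => ?_
        rw [← sum_subset (subset_univ F) fun S _ hS => by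
          simp [hedgePoly_of_notMem hS, not_imp_comm.1 (hqF S) hS]]
        refine sum_congr rfl fun S hS => ?_
        rw [hstep, Pi.sub_apply, hedgePoly, if_pos hS]
        field
    _ = lam * ∑ r ∈ range R, ∑ S ∈ F,
          (G (r + 1) S - G r S) * (hedgePoint F a (G r) S - q S / lam) := by
        simp only [mul_sum]
    _ ≤ lam * (Real.log (2 * #F) / a + 8 * a * R) := by
        gcongr
        linarith

theorem empLoss_smul_sum_le (i : Fin n) (Z : Fin T → Config n) {R : ℕ} (hR : R ≠ 0)
    (p : ℕ → MPoly n) :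
    R * empLoss i Z ((R : ℝ)⁻¹ • ∑ r ∈ range R, p r) ≤ ∑ r ∈ range R, empLoss i Z (p r) := by
  set A := (R : ℝ)⁻¹ • ∑ r ∈ range R, p r with hA
  have hmean : ∑ r ∈ range R, (p r - A) = 0 := by
    rw [sum_sub_distrib, sum_const, card_range, ← Nat.cast_smul_eq_nsmul ℝ,
      hA, smul_inv_smul₀ (Nat.cast_ne_zero.2 hR), sub_self]
  have hcancel : ∑ r ∈ range R, ∑ S, lossGrad i Z A S * (p r - A) S = 0 := by
    rw [sum_comm]
    refine sum_eq_zero fun S _ => ?_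
    rw [← mul_sum, ← Finset.sum_apply, hmean, Pi.zero_apply, mul_zero]
  have htangent := sum_le_sum fun r (_ : r ∈ range R) => empLoss_add_lossGrad_le i Z (p r) A
  rwa [sum_add_distrib, hcancel, add_zero, sum_const, card_range, nsmul_eq_mul] at htangent

theorem empLoss_hedgeAvg_le (hF : F.Nonempty) (hlam : 0 < lam) (ha : 0 < a)
    (hq : q.l1Norm ≤ lam) (hqF : ∀ S, q S ≠ 0 → S ∈ F) (i : Fin n) {R : ℕ} (hR : R ≠ 0)
    (Z : Fin T → Config n) :
    empLoss i Z (hedgeAvg i F lam a R Z)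
      ≤ empLoss i Z q + lam * (Real.log (2 * #F) / (a * R) + 8 * a) := by
  have hR' : (0 : ℝ) < R := by positivity
  set p : ℕ → MPoly n := fun r => hedgePoly F lam a (hedgeGrad i F lam a Z r)
  have htangent (r : ℕ) :
      empLoss i Z (p r) ≤ empLoss i Z q + ∑ S, lossGrad i Z (p r) S * (p r - q) S := by
    have := empLoss_add_lossGrad_le i Z q (p r)
    rw [← neg_sub (p r) q] at this
    simp only [Pi.neg_apply, mul_neg, sum_neg_distrib] at this
    linarith
  have hregret := sum_lossGrad_mul_hedgePoly_sub_le hF hlam ha hq hqF i R Z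
  refine le_of_mul_le_mul_left ?_ hR'
  calc R * empLoss i Z (hedgeAvg i F lam a R Z) ≤ ∑ r ∈ range R, empLoss i Z (p r) :=
        empLoss_smul_sum_le i Z hR p
    _ ≤ ∑ r ∈ range R, (empLoss i Z q + ∑ S, lossGrad i Z (p r) S * (p r - q) S) :=
        sum_le_sum fun r _ => htangent r
    _ ≤ R * empLoss i Z q + lam * (Real.log (2 * #F) / a + 8 * a * R) := by
        rw [sum_add_distrib, sum_const, card_range, nsmul_eq_mul]
        gcongr
    _ = R * (empLoss i Z q + lam * (Real.log (2 * #F) / (a * R) + 8 * a)) := by field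

end LossDescent

/-! ### Straight-line programs -/

/-- Every program that has the functions in `A` in its registers can be continued by `c`
instructions to a program that has the functions in `F` in its registers, too. -/
def Reach {D : Type*} (A : Set (D → ℝ)) (c : ℕ) (F : Set (D → ℝ)) : Prop :=
  ∀ (inputs : Set (D → ℝ)) (m : ℕ) (R : Set (D → ℝ)), Computes inputs m R → A ⊆ R →
    ∃ R', Computes inputs (m + c) R' ∧ R ⊆ R' ∧ F ⊆ R'

namespace Reach

variable {D : Type*} {A A' F F' : Set (D → ℝ)} {c c' : ℕ} {f g : D → ℝ}

theorem of_subset (h : F ⊆ A) : Reach A 0 F := fun _ _ _ hR hA => ⟨_, hR, subset_rfl, h.trans hA⟩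

theorem of_mem (h : f ∈ A) : Reach A 0 {f} := of_subset (Set.singleton_subset_iff.2 h)

theorem of_computes_insert (h : ∀ {inputs m R}, Computes inputs m R → A ⊆ R →
    Computes inputs (m + 1) (insert f R)) : Reach A 1 {f} := fun _ _ _ hR hA =>
  ⟨_, h hR hA, Set.subset_insert _ _, Set.singleton_subset_iff.2 (Set.mem_insert _ _)⟩

theorem mono_left (h : Reach A c F) (hA : A ⊆ A') : Reach A' c F :=
  fun inputs m R hR hA' => h inputs m R hR (hA.trans hA')

theorem mono_right (h : Reach A c F) (hF : F' ⊆ F) : Reach A c F' := fun inputs m R hR hA =>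
  (h inputs m R hR hA).imp fun _ hR' => ⟨hR'.1, hR'.2.1, hF.trans hR'.2.2⟩

theorem trans (h : Reach A c F) (h' : Reach (A ∪ F) c' F') : Reach A (c + c') (F ∪ F') := by
  intro inputs m R hR hA
  obtain ⟨R₁, hR₁, hRR₁, hFR₁⟩ := h inputs m R hR hA
  obtain ⟨R₂, hR₂, hR₁R₂, hFR₂⟩ := h' inputs _ R₁ hR₁ (Set.union_subset (hA.trans hRR₁) hFR₁)
  exact ⟨R₂, by rwa [← add_assoc], hRR₁.trans hR₁R₂, Set.union_subset (hFR₁.trans hR₁R₂) hFR₂⟩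

theorem union (h : Reach A c F) (h' : Reach A c' F') : Reach A (c + c') (F ∪ F') :=
  h.trans (h'.mono_left Set.subset_union_left)

theorem comp (h : Reach A c F) (h' : Reach F c' F') : Reach A (c + c') F' :=
  (h.trans (h'.mono_left Set.subset_union_right)).mono_right Set.subset_union_right

theorem const (A : Set (D → ℝ)) (b : ℝ) : Reach A 1 {fun _ => b} :=
  of_computes_insert fun hR _ => hR.const b

theorem mono (h : Reach A c F) (hc : c ≤ c') : Reach A c' F := by
  induction hc with
  | refl => exact h
  | step _ ih => exact (ih.union (const A 0)).mono_right Set.subset_union_left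

theorem add (hf : Reach A c {f}) (hg : Reach A c' {g}) :
    Reach A (c + c' + 1) {fun z => f z + g z} :=
  (hf.union hg).comp (of_computes_insert fun hR h => hR.add (h (.inl rfl)) (h (.inr rfl)))

theorem sub (hf : Reach A c {f}) (hg : Reach A c' {g}) :
    Reach A (c + c' + 1) {fun z => f z - g z} :=
  (hf.union hg).comp (of_computes_insert fun hR h => hR.sub (h (.inl rfl)) (h (.inr rfl)))

theorem mul (hf : Reach A c {f}) (hg : Reach A c' {g}) :
    Reach A (c + c' + 1) {fun z => f z * g z} :=
  (hf.union hg).comp (of_computes_insert fun hR h => hR.mul (h (.inl rfl)) (h (.inr rfl)))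

theorem div (hf : Reach A c {f}) (hg : Reach A c' {g}) :
    Reach A (c + c' + 1) {fun z => f z / g z} :=
  (hf.union hg).comp (of_computes_insert fun hR h => hR.div (h (.inl rfl)) (h (.inr rfl)))

theorem exp (hf : Reach A c {f}) : Reach A (c + 1) {fun z => Real.exp (f z)} :=
  hf.comp (of_computes_insert fun hR h => hR.exp (h rfl))

theorem const_mul (b : ℝ) (hf : Reach A c {f}) : Reach A (c + 2) {fun z => b * f z} :=
  ((const A b).mul hf).mono (by omega)

theorem neg (hf : Reach A c {f}) : Reach A (c + 2) {fun z => -f z} := by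
  simpa only [neg_one_mul] using hf.const_mul (-1)

theorem cosh (hf : Reach A c {f}) : Reach A (2 * c + 7) {fun z => Real.cosh (f z)} := by
  simp only [Real.cosh_eq]
  exact ((hf.exp.add hf.neg.exp).div (const A 2)).mono (by omega)

theorem sinh (hf : Reach A c {f}) : Reach A (2 * c + 7) {fun z => Real.sinh (f z)} := by
  simp only [Real.sinh_eq]
  exact ((hf.exp.sub hf.neg.exp).div (const A 2)).mono (by omega)

theorem sum {ι : Type*} (s : Finset ι) {f : ι → D → ℝ} (h : ∀ j ∈ s, Reach A c {f j}) :
    Reach A (#s * (c + 1) + 1) {fun z => ∑ j ∈ s, f j z} := by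
  classical
  induction s using Finset.induction_on with
  | empty => simpa using const A 0
  | insert j s hj ih =>
    have hadd := (h j (mem_insert_self j s)).add (ih fun l hl => h l (mem_insert_of_mem hl))
    simp only [sum_insert hj, card_insert_of_notMem hj]
    exact hadd.mono (by ring_nf; omega)

theorem prod {ι : Type*} (s : Finset ι) {f : ι → D → ℝ} (h : ∀ j ∈ s, Reach A c {f j}) :
    Reach A (#s * (c + 1) + 1) {fun z => ∏ j ∈ s, f j z} := by
  classical
  induction s using Finset.induction_on with
  | empty => simpa using const A 1
  | insert j s hj ih =>
    have hmul := (h j (mem_insert_self j s)).mul (ih fun l hl => h l (mem_insert_of_mem hl))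
    simp only [prod_insert hj, card_insert_of_notMem hj]
    exact hmul.mono (by ring_nf; omega)

theorem biUnion {ι : Type*} (s : Finset ι) {F : ι → Set (D → ℝ)}
    (h : ∀ j ∈ s, Reach A c (F j)) : Reach A (#s * c) (⋃ j ∈ s, F j) := by
  classical
  induction s using Finset.induction_on with
  | empty => simpa using of_subset (Set.empty_subset A)
  | insert j s hj ih =>
    have hunion := (h j (mem_insert_self j s)).union (ih fun l hl => h l (mem_insert_of_mem hl))
    rw [set_biUnion_insert, card_insert_of_notMem hj]
    exact hunion.mono (by ring_nf; omega)

theorem image {ι : Type*} (s : Finset ι) {f : ι → D → ℝ} (h : ∀ j ∈ s, Reach A c {f j}) :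
    Reach A (#s * c) (f '' s) := by
  rw [Set.image_eq_iUnion]
  exact biUnion s h

end Reach

section Program

variable {D : Type*} {A : Set (D → ℝ)} {i : Fin n} {N : Finset (Fin n)} {k L T : ℕ} {lam a : ℝ}

theorem reach_chi {S : Finset (Fin n)} (hS : #S ≤ L) {x : D → Config n}
    (hx : ∀ j ∈ S, (fun z => spin (x z) j) ∈ A) : Reach A (L + 1) {fun z => chi S (x z)} :=
  (Reach.prod S fun j hj => Reach.of_mem (hx j hj)).mono (by omega)

section Descent

variable {F : Finset (Finset (Fin n))} {G : D → Finset (Fin n) → ℝ}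

theorem reach_hedgePoly (hF : #F ≤ L) (hG : ∀ S ∈ F, (fun z => G z S) ∈ A) {S : Finset (Fin n)}
    (hS : S ∈ F) : Reach A (12 * L + 17) {fun z => hedgePoly F lam a (G z) S} := by
  have hmul (S) (hS : S ∈ F) := (Reach.of_mem (hG S hS)).const_mul a
  have hweight : Reach A (12 * L + 1) {fun z => hedgeWeight F a (G z)} :=
    (Reach.sum F fun S hS => (hmul S hS).cosh).mono (by omega)
  simp only [hedgePoly, if_pos hS, hedgePoint]
  exact (((hmul S hS).sinh.div hweight).neg.const_mul lam).mono (by omega)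

variable (hL : 1 ≤ L) (hk : k ≤ L) (hF : #(monos N k) ≤ L)
  (hG : ∀ S ∈ monos N k, (fun z => G z S) ∈ A)

include hL hk hF hG

theorem reach_eval_hedgePoly {x : D → Config n} (hx : ∀ j ∈ N, (fun z => spin (x z) j) ∈ A) :
    Reach A (34 * L ^ 2) {fun z => (hedgePoly (monos N k) lam a (G z)).eval (x z)} := by
  have heval (z : D) : (hedgePoly (monos N k) lam a (G z)).eval (x z)
      = ∑ S ∈ monos N k, hedgePoly (monos N k) lam a (G z) S * chi S (x z) := by
    rw [MPoly.eval_eq_sum_chi]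
    refine (sum_subset (subset_univ _) fun S _ hS => ?_).symm
    rw [hedgePoly_of_notMem hS, zero_mul]
  have hterm (S) (hS : S ∈ monos N k) := (reach_hedgePoly (lam := lam) (a := a) hF hG hS).mul
    (reach_chi ((mem_monos.1 hS).2.trans hk) fun j hj => hx j ((mem_monos.1 hS).1 hj))
  simp only [heval]
  refine (Reach.sum _ hterm).mono ?_
  calc _ ≤ L * (12 * L + 17 + (L + 1) + 1 + 1) + 1 := by gcongr
    _ ≤ 34 * L ^ 2 := by nlinarith

theorem reach_score_hedgePoly {x : D → Config n}
    (hx : ∀ j ∈ insert i N, (fun z => spin (x z) j) ∈ A) :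
    Reach A (34 * L ^ 2 + 9) {fun z => score i (hedgePoly (monos N k) lam a (G z)) (x z)} := by
  have hspin : Reach A 0 {fun z => spin (x z) i} := Reach.of_mem (hx i (mem_insert_self i N))
  have hexp := ((hspin.const_mul 2).mul (reach_eval_hedgePoly (lam := lam) (a := a) hL hk hF hG
    fun j hj => hx j (mem_insert_of_mem hj))).exp
  simp only [score, sigm, neg_neg]
  exact (hspin.mul ((Reach.const A 1).div ((Reach.const A 1).add hexp))).mono (by omega)

theorem reach_lossGrad_hedgePoly (hT : T ≤ L) {Z : D → Fin T → Config n}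
    (hZ : ∀ m, ∀ j ∈ insert i N, (fun z => spin (Z z m) j) ∈ A) {S : Finset (Fin n)}
    (hS : S ∈ monos N k) :
    Reach A (52 * L ^ 3)
      {fun z => lossGrad i (Z z) (hedgePoly (monos N k) lam a (G z)) S} := by
  have hterm (m : Fin T) :=
    (reach_score_hedgePoly (lam := lam) (a := a) hL hk hF hG (hZ m)).mul
      (reach_chi ((mem_monos.1 hS).2.trans hk) fun j hj =>
        hZ m j (mem_insert_of_mem ((mem_monos.1 hS).1 hj)))
  refine ((Reach.sum univ fun m _ => hterm m).const_mul (2 / T)).neg.mono ?_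
  rw [card_univ, Fintype.card_fin]
  calc _ ≤ L * (34 * L ^ 2 + 9 + (L + 1) + 1 + 1) + 1 + 2 + 2 := by gcongr
    _ ≤ 52 * L ^ 3 := by
      have hL₁ : 1 ≤ L ^ 3 := Nat.one_le_pow _ _ hL
      have hL₂ : L ^ 1 ≤ L ^ 3 := Nat.pow_le_pow_right hL (by norm_num)
      have hL₃ : L ^ 2 ≤ L ^ 3 := Nat.pow_le_pow_right hL (by norm_num)
      ring_nf at *
      omega

end Descent

variable (hL : 1 ≤ L) (hk : k ≤ L) (hF : #(monos N k) ≤ L) (hT : T ≤ L) {Z : D → Fin T → Config n}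
  (hZ : ∀ m, ∀ j ∈ insert i N, (fun z => spin (Z z m) j) ∈ A) (lam a : ℝ)

include hL hk hF hT hZ

theorem reach_hedgeGrad (R : ℕ) :
    Reach A (53 * L ^ 4 * R + 1)
      (Set.image2 (fun r S z => hedgeGrad i (monos N k) lam a (Z z) r S) (Set.Iic R)
        (monos N k)) := by
  induction R with
  | zero =>
    refine (Reach.const A 0).mono_right ?_
    rintro _ ⟨r, hr, S, -, rfl⟩
    obtain rfl : r = 0 := Nat.le_zero.1 hr
    rfl
  | succ R ih =>
    set St := Set.image2 (fun r S z => hedgeGrad i (monos N k) lam a (Z z) r S) (Set.Iic R)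
      (monos N k)
    have hSt (S) (hS : S ∈ monos N k) :
        (fun z => hedgeGrad i (monos N k) lam a (Z z) R S) ∈ A ∪ St :=
      .inr ⟨R, Set.self_mem_Iic, S, hS, rfl⟩
    have hnext (S) (hS : S ∈ monos N k) := (Reach.of_mem (hSt S hS)).add
      (reach_lossGrad_hedgePoly (lam := lam) (a := a) hL hk hF hSt hT
        (fun m j hj => .inl (hZ m j hj)) hS)
    refine Reach.mono_right (F := _ ∪ _) ((ih.trans (Reach.image _ hnext)).mono ?_) ?_
    · calc _ ≤ 53 * L ^ 4 * R + 1 + L * (0 + 52 * L ^ 3 + 1) := by gcongr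
        _ ≤ 53 * L ^ 4 * (R + 1) + 1 := by
          have : L ^ 1 ≤ L ^ 4 := Nat.pow_le_pow_right hL (by norm_num)
          linarith
    · rintro _ ⟨r, hr, S, hS, rfl⟩
      rcases Nat.le_succ_iff.1 hr with hr | rfl
      · exact .inl ⟨r, hr, S, hS, rfl⟩
      · exact .inr ⟨S, hS, rfl⟩

theorem reach_hedgeAvg {R : ℕ} (hR : 1 ≤ R) :
    Reach A (87 * L ^ 4 * R)
      ((fun S z => hedgeAvg i (monos N k) lam a R (Z z) S) '' monos N k) := by
  have hgrad := reach_hedgeGrad hL hk hF hT hZ lam a R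
  set St := Set.image2 (fun r S z => hedgeGrad i (monos N k) lam a (Z z) r S) (Set.Iic R)
    (monos N k)
  have havg (S) (hS : S ∈ monos N k) : Reach (A ∪ St) (R * (12 * L + 18) + 3)
      {fun z => hedgeAvg i (monos N k) lam a R (Z z) S} := by
    have hsum := Reach.sum (A := A ∪ St) (range R) fun r hr =>
      reach_hedgePoly (lam := lam) (a := a) hF
        (G := fun z S => hedgeGrad i (monos N k) lam a (Z z) r S)
        (fun S hS => .inr ⟨r, (mem_range.1 hr).le, S, hS, rfl⟩) hS
    simp only [hedgeAvg, Pi.smul_apply, Finset.sum_apply, smul_eq_mul]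
    exact (hsum.const_mul _).mono (by rw [card_range])
  refine ((hgrad.trans (Reach.image _ havg)).mono_right Set.subset_union_right).mono ?_
  calc _ ≤ 53 * L ^ 4 * R + 1 + L * (R * (12 * L + 18) + 3) := by gcongr
    _ ≤ 53 * L ^ 4 * R + 1 * R + L * (R * (12 * L + 18) + 3 * R) := by nlinarith
    _ = (53 * L ^ 4 + 1 + 12 * L ^ 2 + 21 * L) * R := by ring
    _ ≤ 87 * L ^ 4 * R := by
      have hL₁ : 1 ≤ L ^ 4 := Nat.one_le_pow _ _ hL
      have hL₂ : L ^ 1 ≤ L ^ 4 := Nat.pow_le_pow_right hL (by norm_num)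
      have hL₃ : L ^ 2 ≤ L ^ 4 := Nat.pow_le_pow_right hL (by norm_num)
      gcongr
      linarith

end Program

theorem exists_computes_assemble_hedgeAvg {N : Fin n → Finset (Fin n)} {k L T : ℕ} (hn : 1 ≤ n)
    (hL : 1 ≤ L) (hk : k ≤ L) (hF : ∀ i, #(monos (N i) k) ≤ L) (hT : T ≤ L) (lam a : ℝ) {R : ℕ}
    (hR : 1 ≤ R) :
    ∃ Q : Set ((Fin n → Fin T → Config n) → ℝ),
      Computes (dataInputs T N) (n * (88 * L ^ 4 * R)) Q ∧
      ∀ S, (fun z => assemble (fun i => hedgeAvg i (monos (N i) k) lam a R (z i)) S) ∈ Q := by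
  have hnode (i : Fin n) := reach_hedgeAvg (A := dataInputs T N) (Z := fun z => z i)
    hL hk (hF i) hT (fun m j hj => ⟨i, m, j, hj, rfl⟩) lam a hR
  have hnodes := Reach.biUnion univ fun i _ => hnode i
  have hcost : #(univ : Finset (Fin n)) * (87 * L ^ 4 * R) + 1 ≤ n * (88 * L ^ 4 * R) := by
    have : 1 ≤ n * (L ^ 4 * R) := Nat.mul_pos hn (Nat.mul_pos (pow_pos hL 4) hR)
    rw [card_univ, Fintype.card_fin]
    linarith
  obtain ⟨Q, hQ, -, hmem⟩ :=
    ((hnodes.union (Reach.const _ 0)).mono hcost) _ 0 _ Computes.start subset_rfl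
  refine ⟨Q, by rwa [zero_add] at hQ, fun S => hmem ?_⟩
  by_cases hS : S.Nonempty
  · simp only [assemble, dif_pos hS]
    by_cases hS' : S.erase (S.min' hS) ∈ monos (N (S.min' hS)) k
    · exact .inl (Set.mem_biUnion (mem_univ (S.min' hS)) ⟨_, hS', rfl⟩)
    · simp [hedgeAvg_of_notMem _ _ _ _ hS']
  · simp [assemble, hS]

/-! ### Sample size and accuracy -/

theorem exp_le_rpow {x z : ℝ} (hx : Real.exp 1 ≤ x) (hz : 0 ≤ z) : Real.exp z ≤ x ^ z := by
  rw [← Real.exp_one_rpow z]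
  exact Real.rpow_le_rpow (Real.exp_pos 1).le hx hz

theorem one_add_sq_le_rpow {x z : ℝ} (hx : Real.exp 1 ≤ x) (hz : 0 ≤ z) :
    (1 + z) ^ 2 ≤ x ^ (2 * z) := calc
  (1 + z) ^ 2 ≤ Real.exp z ^ 2 := by gcongr; linarith [Real.add_one_le_exp z]
  _ = Real.exp (2 * z) := by rw [← Real.exp_nat_mul, Nat.cast_ofNat]
  _ ≤ x ^ (2 * z) := exp_le_rpow hx (by linarith)

theorem add_one_pow_le_pow_two_mul {x : ℝ} (hx : 3 ≤ x) (k : ℕ) : (x + 1) ^ k ≤ x ^ (2 * k) := by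
  rw [pow_mul]
  gcongr
  nlinarith

theorem one_add_add_one_pow_le_pow {x : ℝ} (hx : 3 ≤ x) {k : ℕ} (hk : 1 ≤ k) :
    1 + (x + 1) ^ k ≤ x ^ (3 * k) := calc
  1 + (x + 1) ^ k ≤ x ^ (2 * k) + x ^ (2 * k) := by
    gcongr
    · exact one_le_pow₀ (by linarith)
    · exact add_one_pow_le_pow_two_mul hx k
  _ ≤ x ^ k * x ^ (2 * k) := by
    have : x ≤ x ^ k := le_self_pow₀ (by linarith) (by omega)
    rw [← two_mul]
    gcongr
    linarith
  _ = x ^ (3 * k) := by rw [← pow_add]; congr 1; ring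

/-- The excess empirical loss that a feasible polynomial may have if all its coefficients are to be
within `ε` of those of the derivative of the Hamiltonian. -/
def tolerance (d k : ℕ) (lam ε : ℝ) : ℝ :=
  Real.exp (-(2 * lam)) / 4 * spread d k lam * ε ^ 2

/-- The deviation of empirical means from conditional means whose effect on the loss is at most
`tolerance`. -/
def deviationTolerance (d k : ℕ) (lam ε : ℝ) : ℝ :=
  tolerance d k lam ε / (4 * lam + 2 * lam ^ 2)

section Rates

variable {d k T : ℕ} {lam₀ lam ε δ : ℝ}

theorem exp_one_le_natCast (hd : 3 ≤ d) : Real.exp 1 ≤ d := by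
  have : (3 : ℝ) ≤ d := by exact_mod_cast hd
  linarith [Real.exp_one_lt_d9]

theorem spread_pos (hd : 1 ≤ d) : 0 < spread d k lam := by
  have : (0 : ℝ) < d := by exact_mod_cast hd
  unfold spread
  positivity

theorem tolerance_pos (hd : 1 ≤ d) (hε : 0 < ε) : 0 < tolerance d k lam ε := by
  have := spread_pos (k := k) (lam := lam) hd
  unfold tolerance
  positivity

theorem deviationTolerance_pos (hd : 1 ≤ d) (hlam : 0 < lam) (hε : 0 < ε) :
    0 < deviationTolerance d k lam ε := div_pos (tolerance_pos hd hε) (by positivity)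

theorem inv_spread_le_rpow (hd : 3 ≤ d) (hk : 1 ≤ k) (hlam : 0 ≤ lam) :
    (spread d k lam)⁻¹ ≤ (d : ℝ) ^ ((11 + 2 * lam) * (k : ℝ) ^ 2) := by
  have hd3 : (3 : ℝ) ≤ d := by exact_mod_cast hd
  have hd0 : (0 : ℝ) < d := by linarith
  have hk1 : (1 : ℝ) ≤ k := by exact_mod_cast hk
  have hbase : 6 * d * Real.exp (2 * lam) ≤ (d : ℝ) ^ (3 + 2 * lam) := by
    rw [Real.rpow_add hd0]
    gcongr
    · rw [show (3 : ℝ) = (3 : ℕ) by norm_num, Real.rpow_natCast]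
      nlinarith [sq_nonneg ((d : ℝ) - 3)]
    · exact exp_le_rpow (exp_one_le_natCast hd) (by linarith)
  calc (spread d k lam)⁻¹
      = (1 + d) * (6 * d * Real.exp (2 * lam)) ^ k * (1 + (d + 1) ^ k) ^ (2 * k) := by
        rw [spread, Real.exp_neg, ← inv_inv (6 * (d : ℝ) * _), inv_pow]
        simp only [div_eq_mul_inv, one_mul, mul_inv, inv_inv]
        ring_nf
    _ ≤ (d : ℝ) ^ 2 * ((d : ℝ) ^ (3 + 2 * lam)) ^ k * ((d : ℝ) ^ (3 * k)) ^ (2 * k) := by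
        gcongr
        · nlinarith
        · exact one_add_add_one_pow_le_pow hd3 hk
    _ = (d : ℝ) ^ (2 + (3 + 2 * lam) * k + 6 * (k : ℝ) ^ 2) := by
        simp only [← Real.rpow_natCast, ← Real.rpow_mul hd0.le, ← Real.rpow_add hd0]
        congr 1
        push_cast
        rw [Real.rpow_two]
        ring
    _ ≤ (d : ℝ) ^ ((11 + 2 * lam) * (k : ℝ) ^ 2) := by
        gcongr
        · linarith
        · nlinarith [mul_nonneg hlam (by linarith : (0 : ℝ) ≤ k)]

theorem inv_tolerance_le (hd : 3 ≤ d) (hk : 1 ≤ k) (hlam : 0 ≤ lam) :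
    (tolerance d k lam ε)⁻¹ ≤ (d : ℝ) ^ ((13 + 4 * lam) * (k : ℝ) ^ 2) / ε ^ 2 := by
  have hd3 : (3 : ℝ) ≤ d := by exact_mod_cast hd
  have hd0 : (0 : ℝ) < d := by linarith
  have hk1 : (1 : ℝ) ≤ (k : ℝ) ^ 2 := one_le_pow₀ (by exact_mod_cast hk)
  calc (tolerance d k lam ε)⁻¹
      = 4 * Real.exp (2 * lam) * (spread d k lam)⁻¹ / ε ^ 2 := by
        rw [tolerance, Real.exp_neg]
        field_simp
    _ ≤ (d : ℝ) ^ (2 : ℝ) * (d : ℝ) ^ (2 * lam) * (d : ℝ) ^ ((11 + 2 * lam) * (k : ℝ) ^ 2)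
          / ε ^ 2 := by
        gcongr
        · exact inv_nonneg.2 (spread_pos (by omega)).le
        · rw [Real.rpow_two]
          nlinarith
        · exact exp_le_rpow (exp_one_le_natCast hd) (by linarith)
        · exact inv_spread_le_rpow hd hk hlam
    _ = (d : ℝ) ^ (2 + 2 * lam + (11 + 2 * lam) * (k : ℝ) ^ 2) / ε ^ 2 := by
        rw [← Real.rpow_add hd0, ← Real.rpow_add hd0]
    _ ≤ (d : ℝ) ^ ((13 + 4 * lam) * (k : ℝ) ^ 2) / ε ^ 2 := by
        gcongr
        · linarith
        · nlinarith

theorem log_four_mul_div_le (hd : 3 ≤ d) (hk : 1 ≤ k) (hδ : 0 < δ) (hδ1 : δ < 1) :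
    Real.log (4 * (((d : ℝ) + 1) ^ k) ^ 2 / δ) ≤ 6 * k * Real.log (d / δ) := by
  have hd3 : (3 : ℝ) ≤ d := by exact_mod_cast hd
  have hnum : 4 * (((d : ℝ) + 1) ^ k) ^ 2 ≤ (d : ℝ) ^ (6 * k) := calc
    4 * (((d : ℝ) + 1) ^ k) ^ 2 ≤ (d : ℝ) ^ 2 * ((d : ℝ) ^ (2 * k)) ^ 2 := by
      gcongr
      · nlinarith
      · exact add_one_pow_le_pow_two_mul hd3 k
    _ = (d : ℝ) ^ (2 + 4 * k) := by rw [← pow_mul, ← pow_add]; congr 1; ring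
    _ ≤ (d : ℝ) ^ (6 * k) := pow_le_pow_right₀ (by linarith) (by omega)
  calc Real.log (4 * (((d : ℝ) + 1) ^ k) ^ 2 / δ) ≤ Real.log ((d / δ) ^ (6 * k)) := by
        rw [div_pow]
        gcongr
        exact pow_le_of_le_one hδ.le hδ1.le (by omega)
    _ = 6 * k * Real.log (d / δ) := by rw [Real.log_pow]; push_cast; ring

/-- The constant of the theorem. The first summand turns an exponent that does not grow with `lam`
into one that is proportional to `lam`. -/
def mainConst (lam₀ : ℝ) : ℝ := 45 / lam₀ + 10

theorem ten_le_mainConst (hlam₀ : 0 < lam₀) : 10 ≤ mainConst lam₀ := by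
  have : 0 < 45 / lam₀ := by positivity
  unfold mainConst
  linarith

theorem rpow_le_rpow_mainConst (hd : 3 ≤ d) (hlam₀ : 0 < lam₀) (hlam : lam₀ ≤ lam) {t : ℝ}
    (ht : t ≤ (45 + 10 * lam) * (k : ℝ) ^ 2) :
    (d : ℝ) ^ t ≤ (d : ℝ) ^ (mainConst lam₀ * lam * (k : ℝ) ^ 2) := by
  have hC : 45 + 10 * lam ≤ mainConst lam₀ * lam := by
    have : 45 ≤ 45 / lam₀ * lam := by
      rw [div_mul_eq_mul_div, le_div_iff₀ hlam₀]
      linarith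
    unfold mainConst
    linarith
  exact Real.rpow_le_rpow_of_exponent_le (by exact_mod_cast (by omega : 1 ≤ d))
    (ht.trans (by gcongr))

theorem inv_sq_deviationTolerance_le (hd : 3 ≤ d) (hk : 1 ≤ k) (hlam₀ : 0 < lam₀)
    (hlam : lam₀ ≤ lam) (hε : 0 < ε) :
    96 * ((deviationTolerance d k lam ε)⁻¹) ^ 2
      ≤ lam ^ 2 * (d : ℝ) ^ (mainConst lam₀ * lam * (k : ℝ) ^ 2) / ε ^ 4 := by
  have hl : 0 < lam := hlam₀.trans_le hlam
  have hd3 : (3 : ℝ) ≤ d := by exact_mod_cast hd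
  have hd0 : (0 : ℝ) < d := by linarith
  have hk1 : (1 : ℝ) ≤ (k : ℝ) ^ 2 := one_le_pow₀ (by exact_mod_cast hk)
  have htol := tolerance_pos (k := k) (lam := lam) (by omega : 1 ≤ d) hε
  have hcoef : 384 * (2 + lam) ^ 2 ≤ (d : ℝ) ^ 7 * (d : ℝ) ^ (2 * lam) := calc
    384 * (2 + lam) ^ 2 ≤ 3 ^ 7 * (1 + lam) ^ 2 := by nlinarith
    _ ≤ (d : ℝ) ^ 7 * (d : ℝ) ^ (2 * lam) := by
      gcongr
      exact one_add_sq_le_rpow (exp_one_le_natCast hd) hl.le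
  calc 96 * ((deviationTolerance d k lam ε)⁻¹) ^ 2
      = lam ^ 2 * (384 * (2 + lam) ^ 2) * ((tolerance d k lam ε)⁻¹) ^ 2 := by
        rw [deviationTolerance]
        field_simp
        ring
    _ ≤ lam ^ 2 * ((d : ℝ) ^ 7 * (d : ℝ) ^ (2 * lam))
          * ((d : ℝ) ^ ((13 + 4 * lam) * (k : ℝ) ^ 2) / ε ^ 2) ^ 2 := by
        gcongr
        exact inv_tolerance_le hd hk hl.le
    _ = lam ^ 2 * (d : ℝ) ^ (7 + 2 * lam + (13 + 4 * lam) * (k : ℝ) ^ 2 * 2) / ε ^ 4 := by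
        rw [div_pow, ← pow_mul]
        simp only [← Real.rpow_natCast, Nat.cast_ofNat, ← Real.rpow_mul hd0.le, Real.rpow_add hd0]
        ring_nf
    _ ≤ lam ^ 2 * (d : ℝ) ^ (mainConst lam₀ * lam * (k : ℝ) ^ 2) / ε ^ 4 := by
        gcongr lam ^ 2 * ?_ / ε ^ 4
        exact rpow_le_rpow_mainConst hd hlam₀ hlam (by nlinarith)

theorem rate_pos {C : ℝ} (hd : 1 ≤ d) (hk : 1 ≤ k) (hlam : 0 < lam) (hε : 0 < ε) (hδ : 0 < δ)
    (hδ1 : δ < 1) : 0 < rate C k d lam ε δ := by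
  have hd1 : (1 : ℝ) ≤ d := by exact_mod_cast hd
  have : (0 : ℝ) < k := by exact_mod_cast hk
  have : 0 < Real.log (d / δ) := Real.log_pos (by rw [one_lt_div hδ]; linarith)
  unfold rate
  positivity

theorem rate_le_sampleBound {C : ℝ} (hC : 1 ≤ C) (hd : 1 ≤ d) (hk : 1 ≤ k) (hlam : 0 < lam)
    (hε : 0 < ε) (hδ : 0 < δ) (hδ1 : δ < 1) : rate C k d lam ε δ ≤ sampleBound C k d lam ε δ := by
  have hrate := rate_pos (C := C) hd hk hlam hε hδ hδ1
  have hlog : 1 ≤ Real.log (3 + rate C k d lam ε δ) := by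
    rw [Real.le_log_iff_exp_le (by linarith)]
    linarith [Real.exp_one_lt_d9]
  rw [sampleBound, mul_right_comm]
  exact le_mul_of_one_le_left hrate.le
    (one_le_mul_of_one_le_of_one_le hC (Real.one_le_rpow hlog (by linarith)))

variable (hd : 3 ≤ d) (hk : 1 ≤ k) (hlam₀ : 0 < lam₀) (hlam : lam₀ ≤ lam) (hε : 0 < ε)
  (hδ : 0 < δ) (hδ1 : δ < 1) (hT : sampleBound (mainConst lam₀) k d lam ε δ ≤ T)

include hd hk hlam₀ hlam hε hδ hδ1 hT

theorem rate_le_natCast : rate (mainConst lam₀) k d lam ε δ ≤ T :=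
  (rate_le_sampleBound (by linarith [ten_le_mainConst hlam₀]) (by omega) hk
    (hlam₀.trans_le hlam) hε hδ hδ1).trans hT

theorem natCast_pos_of_sampleBound_le : 0 < T := by
  have hrate := rate_pos (C := mainConst lam₀) (by omega) hk (hlam₀.trans_le hlam) hε hδ hδ1
    (d := d)
  exact_mod_cast hrate.trans_le (rate_le_natCast hd hk hlam₀ hlam hε hδ hδ1 hT)

theorem four_mul_exp_neg_le :
    4 * (((d : ℝ) + 1) ^ k) ^ 2 * Real.exp (-(T * deviationTolerance d k lam ε ^ 2 / 16)) ≤ δ := by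
  set η := deviationTolerance d k lam ε
  have hη : 0 < η := deviationTolerance_pos (by omega) (hlam₀.trans_le hlam) hε
  have hlog0 : 0 ≤ Real.log (d / δ) := Real.log_nonneg (by
    have : (3 : ℝ) ≤ d := by exact_mod_cast hd
    rw [one_le_div hδ]
    linarith)
  have hlog : Real.log (4 * (((d : ℝ) + 1) ^ k) ^ 2 / δ) ≤ T * η ^ 2 / 16 := calc
    _ ≤ 6 * k * Real.log (d / δ) := log_four_mul_div_le hd hk hδ hδ1
    _ = 96 * η⁻¹ ^ 2 * (k * Real.log (d / δ)) * η ^ 2 / 16 := by field_simp; ring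
    _ ≤ rate (mainConst lam₀) k d lam ε δ * η ^ 2 / 16 := by
      have hprod := mul_le_mul_of_nonneg_right
        (inv_sq_deviationTolerance_le (ε := ε) hd hk hlam₀ hlam hε)
        (by positivity : 0 ≤ k * Real.log (d / δ))
      rw [rate]
      gcongr
      exact hprod.trans_eq (by ring)
    _ ≤ T * η ^ 2 / 16 := by
      gcongr
      exact rate_le_natCast hd hk hlam₀ hlam hε hδ hδ1 hT
  rw [Real.log_le_iff_le_exp (by positivity), div_le_iff₀ hδ] at hlog
  rw [Real.exp_neg, ← div_eq_mul_inv, div_le_iff₀ (Real.exp_pos _)]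
  linarith

end Rates

/-- On the samples `Z` for the node `i`, small excess loss certifies accuracy: every feasible
polynomial whose empirical loss exceeds that of `∂_i ψ` by at most `slack` has all its coefficients
within `ε` of those of `∂_i ψ`. -/
def LossIdentifies (ψ : MPoly n) (k : ℕ) (lam ε slack : ℝ) (i : Fin n) {T : ℕ}
    (Z : Fin T → Config n) : Prop :=
  ∀ p ∈ feasible (neighbors ψ i) k lam, empLoss i Z p ≤ empLoss i Z (ψ.pderiv i) + slack →
    (p - ψ.pderiv i).supNorm ≤ ε

section Identification

variable {d k T : ℕ} {lam₀ lam ε δ slack : ℝ} {ψ : MPoly n} {i : Fin n}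

theorem LossIdentifies.supNorm_sub_le_of_isLogReg {Z : Fin T → Config n}
    (h : LossIdentifies ψ k lam ε slack i Z) (hM : IsMRF k d lam ψ) (hslack : 0 ≤ slack)
    {p : MPoly n} (hp : IsLogReg i (neighbors ψ i) k lam Z p) : (p - ψ.pderiv i).supNorm ≤ ε :=
  h p hp.1 ((hp.2 _ (hM.pderiv_mem_feasible i)).trans (le_add_of_nonneg_right hslack))

theorem Typical.lossIdentifies (hM : IsMRF k d lam ψ) (hd : 3 ≤ d) (hlam : 0 < lam) (hε : 0 < ε)
    (hT : 0 < T) {y : ℕ → Config n}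
    (h : Typical (sampleKernel ψ i (freeSteps d n)) i (monos (neighbors ψ i) k) (ψ.pderiv i) T
      (deviationTolerance d k lam ε) y) :
    LossIdentifies ψ k lam ε (tolerance d k lam ε) i fun m : Fin T => y (m + 1) := by
  intro p hp hloss
  set η := deviationTolerance d k lam ε
  have hη : 0 < η := deviationTolerance_pos (by omega) hlam hε
  have hs : 0 < spread d k lam := spread_pos (by omega)
  have hdev : (4 * lam + 2 * lam ^ 2) * η = tolerance d k lam ε :=
    mul_div_cancel₀ _ (by positivity)
  have hexp : 2 * Real.exp (-(2 * lam)) * lam ^ 2 * η ≤ 2 * 1 * lam ^ 2 * η := by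
    gcongr
    exact Real.exp_le_one_iff.2 (by linarith)
  have hsq : Real.exp (-(2 * lam)) / 2 * spread d k lam * (p - ψ.pderiv i).supNorm ^ 2
      ≤ Real.exp (-(2 * lam)) / 2 * spread d k lam * ε ^ 2 := calc
    _ ≤ tolerance d k lam ε + 4 * lam * η + 2 * Real.exp (-(2 * lam)) * lam ^ 2 * η :=
      h.supNorm_sq_le hM hd hlam.le hT hη.le hp hloss
    _ ≤ 2 * tolerance d k lam ε := by linarith
    _ = _ := by rw [tolerance]; ring
  exact (sq_le_sq₀ (MPoly.supNorm_nonneg _) hε.le).1 (le_of_mul_le_mul_left hsq (by positivity))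

theorem IsGlauber.measure_not_lossIdentifies_le {Ω : Type*} [MeasurableSpace Ω] {P : Measure Ω}
    [IsProbabilityMeasure P] {X : ℕ → Ω → Config n} {U : ℕ → Ω → Fin n} (hG : IsGlauber ψ P X U)
    (hM : IsMRF k d lam ψ) (hd : 3 ≤ d) (hk : 1 ≤ k) (hlam₀ : 0 < lam₀) (hlam : lam₀ ≤ lam)
    (hε : 0 < ε) (hδ : 0 < δ) (hδ1 : δ < 1)
    (hT : sampleBound (mainConst lam₀) k d lam ε δ ≤ T) (i : Fin n) :
    P {ω | ¬ LossIdentifies ψ k lam ε (tolerance d k lam ε) i (samples d X U i T ω)}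
      ≤ ENNReal.ofReal δ := by
  have hl : 0 < lam := hlam₀.trans_le hlam
  have hη : 0 ≤ deviationTolerance d k lam ε := (deviationTolerance_pos (by omega) hl hε).le
  have hT0 : 0 < T := natCast_pos_of_sampleBound_le hd hk hlam₀ hlam hε hδ hδ1 hT
  refine (measure_mono ?_).trans ((hG.measure_not_typical_le hM hd i T hη).trans
    (ENNReal.ofReal_le_ofReal (four_mul_exp_neg_le hd hk hlam₀ hlam hε hδ hδ1 hT)))
  intro ω hω htyp
  exact hω (htyp.lossIdentifies hM hd hl hε hT0)

end Identification

theorem supNorm_assemble_sub_le {p : Fin n → MPoly n} {ψ : MPoly n} {ε : ℝ} (hε : 0 ≤ ε)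
    (h : ∀ i, (p i - ψ.pderiv i).supNorm ≤ ε) : (assemble p - ψ.dropConst).supNorm ≤ ε := by
  refine MPoly.supNorm_le_iff.2 fun S => ?_
  rcases S.eq_empty_or_nonempty with rfl | hS
  · simpa [assemble, MPoly.dropConst] using hε
  · have hcoeff := MPoly.supNorm_le_iff.1 (h (S.min' hS)) (S.erase (S.min' hS))
    rw [Pi.sub_apply, MPoly.pderiv, if_neg (notMem_erase _ _),
      insert_erase (min'_mem S hS)] at hcoeff
    rwa [Pi.sub_apply, assemble, dif_pos hS, MPoly.dropConst, Function.update_of_ne hS.ne_empty]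

theorem one_sub_le_measureReal {Ω : Type*} [MeasurableSpace Ω] {P : Measure Ω}
    [IsProbabilityMeasure P] {δ : ℝ} (hδ : 0 ≤ δ) {p : Ω → Prop}
    (h : P {ω | ¬ p ω} ≤ ENNReal.ofReal δ) : 1 - δ ≤ P.real {ω | p ω} := by
  have hbad : P.real {ω | ¬ p ω} ≤ δ := ENNReal.toReal_le_of_le_ofReal hδ h
  have hunion := measureReal_union_le (μ := P) {ω | p ω} {ω | ¬ p ω}
  have huniv : {ω | p ω} ∪ {ω | ¬ p ω} = Set.univ := Set.union_compl_self _
  rw [huniv, probReal_univ] at hunion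
  linarith

theorem measure_not_forall_le {Ω ι : Type*} [Fintype ι] [Nonempty ι] [MeasurableSpace Ω]
    {P : Measure Ω} {δ : ℝ} {p : ι → Ω → Prop}
    (h : ∀ i, P {ω | ¬ p i ω} ≤ ENNReal.ofReal (δ / Fintype.card ι)) :
    P {ω | ¬ ∀ i, p i ω} ≤ ENNReal.ofReal δ := calc
  P {ω | ¬ ∀ i, p i ω} = P (⋃ i, {ω | ¬ p i ω}) := by
    congr 1
    ext ω
    simp
  _ ≤ ∑ i, P {ω | ¬ p i ω} := measure_iUnion_fintype_le P _
  _ ≤ ∑ _i : ι, ENNReal.ofReal (δ / Fintype.card ι) := sum_le_sum fun i _ => h i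
  _ = ENNReal.ofReal δ := by
    rw [sum_const, card_univ, ← ENNReal.ofReal_nsmul, nsmul_eq_mul,
      mul_div_cancel₀ _ (Nat.cast_ne_zero.2 Fintype.card_ne_zero)]

section AllNodes

variable {d k T : ℕ} {lam₀ lam ε δ : ℝ} {ψ : MPoly n} {Ω : Type*} [MeasurableSpace Ω]
  {P : Measure Ω} [IsProbabilityMeasure P] {X : ℕ → Ω → Config n} {U : ℕ → Ω → Fin n}

theorem IsGlauber.one_sub_le_measureReal_isLogReg (hG : IsGlauber ψ P X U)
    (hM : IsMRF k d lam ψ) (hd : 3 ≤ d) (hk : 1 ≤ k) (hlam₀ : 0 < lam₀) (hlam : lam₀ ≤ lam)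
    (hε : 0 < ε) (hδ : 0 < δ) (hδ1 : δ < 1)
    (hT : sampleBound (mainConst lam₀) k d lam ε δ ≤ T) (i : Fin n) :
    1 - δ ≤ P.real {ω | (∃ p, IsLogReg i (neighbors ψ i) k lam (samples d X U i T ω) p) ∧
      ∀ p, IsLogReg i (neighbors ψ i) k lam (samples d X U i T ω) p →
        (p - ψ.pderiv i).supNorm ≤ ε} := by
  have hslack := tolerance_pos (k := k) (lam := lam) (by omega : 1 ≤ d) hε
  refine (one_sub_le_measureReal hδ.le
    (hG.measure_not_lossIdentifies_le hM hd hk hlam₀ hlam hε hδ hδ1 hT i)).trans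
    (measureReal_mono fun ω hω => ?_)
  exact ⟨exists_isLogReg i _ k (hlam₀.trans_le hlam).le _,
    fun p hp => hω.supNorm_sub_le_of_isLogReg hM hslack.le hp⟩

theorem IsGlauber.one_sub_le_measureReal_forall_lossIdentifies (hG : IsGlauber ψ P X U)
    (hM : IsMRF k d lam ψ) (hn : 1 ≤ n) (hd : 3 ≤ d) (hk : 1 ≤ k) (hlam₀ : 0 < lam₀)
    (hlam : lam₀ ≤ lam) (hε : 0 < ε) (hδ : 0 < δ) (hδ1 : δ < 1)
    (hT : sampleBound (mainConst lam₀) k d lam ε (δ / n) ≤ T) :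
    1 - δ ≤ P.real {ω | ∀ i,
      LossIdentifies ψ k lam ε (tolerance d k lam ε) i (samples d X U i T ω)} := by
  have hn1 : (1 : ℝ) ≤ n := by exact_mod_cast hn
  have : Nonempty (Fin n) := ⟨⟨0, hn⟩⟩
  have hδn : δ / n < 1 := (div_le_self hδ.le hn1).trans_lt hδ1
  refine one_sub_le_measureReal hδ.le (measure_not_forall_le fun i => ?_)
  rw [Fintype.card_fin]
  exact hG.measure_not_lossIdentifies_le hM hd hk hlam₀ hlam hε (by positivity) hδn hT i

theorem IsGlauber.one_sub_le_measureReal_forall_isLogReg (hG : IsGlauber ψ P X U)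
    (hM : IsMRF k d lam ψ) (hn : 1 ≤ n) (hd : 3 ≤ d) (hk : 1 ≤ k) (hlam₀ : 0 < lam₀)
    (hlam : lam₀ ≤ lam) (hε : 0 < ε) (hδ : 0 < δ) (hδ1 : δ < 1)
    (hT : sampleBound (mainConst lam₀) k d lam ε (δ / n) ≤ T) :
    1 - δ ≤ P.real {ω | (∃ p : Fin n → MPoly n,
        ∀ i, IsLogReg i (neighbors ψ i) k lam (samples d X U i T ω) (p i)) ∧
      ∀ p : Fin n → MPoly n,
        (∀ i, IsLogReg i (neighbors ψ i) k lam (samples d X U i T ω) (p i)) →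
        (assemble p - ψ.dropConst).supNorm ≤ ε} := by
  have hslack := tolerance_pos (k := k) (lam := lam) (by omega : 1 ≤ d) hε
  refine (hG.one_sub_le_measureReal_forall_lossIdentifies hM hn hd hk hlam₀ hlam hε hδ hδ1
    hT).trans (measureReal_mono fun ω hω => ?_)
  exact ⟨Classical.skolem.1 fun i => exists_isLogReg i _ k (hlam₀.trans_le hlam).le _,
    fun p hp => supNorm_assemble_sub_le hε.le fun i =>
      (hω i).supNorm_sub_le_of_isLogReg hM hslack.le (hp i)⟩

end AllNodes

/-! ### Accuracy and cost of exponentiated gradient descent -/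

/-- The excess loss at which exponentiated gradient descent is stopped. -/
def descentTarget (d k : ℕ) (lam ε : ℝ) : ℝ := min ε (tolerance d k lam ε)

/-- The step size of exponentiated gradient descent. -/
def descentStep (d k : ℕ) (lam ε : ℝ) : ℝ := descentTarget d k lam ε / (16 * lam)

/-- The number of rounds of exponentiated gradient descent. -/
def descentRounds (d k : ℕ) (lam ε : ℝ) : ℕ :=
  ⌈64 * lam ^ 2 * ((d : ℝ) + 1) ^ k / descentTarget d k lam ε ^ 2⌉₊

/-- The efficiently computable substitute for logistic regression for node `i` with neighborhood
`N`: exponentiated gradient descent on the empirical loss, run to accuracy `descentTarget`. -/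
def descent (d k : ℕ) (lam ε : ℝ) (i : Fin n) (N : Finset (Fin n)) {T : ℕ}
    (Z : Fin T → Config n) : MPoly n :=
  hedgeAvg i (monos N k) lam (descentStep d k lam ε) (descentRounds d k lam ε) Z

section Descent

variable {d k T : ℕ} {lam₀ lam ε δ : ℝ}

theorem descentTarget_pos (hd : 1 ≤ d) (hε : 0 < ε) : 0 < descentTarget d k lam ε :=
  lt_min hε (tolerance_pos hd hε)

theorem descentRounds_pos (hd : 1 ≤ d) (hlam : 0 < lam) (hε : 0 < ε) :
    0 < descentRounds d k lam ε := by
  have := descentTarget_pos (k := k) (lam := lam) hd hε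
  exact Nat.ceil_pos.2 (by positivity)

theorem empLoss_descent_le (hd : 1 ≤ d) (hlam : 0 < lam) (hε : 0 < ε) (i : Fin n)
    {N : Finset (Fin n)} (hN : #N ≤ d) (Z : Fin T → Config n) {q : MPoly n}
    (hq : q ∈ feasible N k lam) :
    empLoss i Z (descent d k lam ε i N Z) ≤ empLoss i Z q + descentTarget d k lam ε := by
  set s := descentTarget d k lam ε
  set R := descentRounds d k lam ε
  have hs : 0 < s := descentTarget_pos hd hε
  have hR : 0 < R := descentRounds_pos hd hlam hε
  have hstep : 0 < descentStep d k lam ε := div_pos hs (by positivity)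
  have hRounds : 64 * lam ^ 2 * ((d : ℝ) + 1) ^ k ≤ s ^ 2 * R := by
    rw [← div_le_iff₀' (by positivity)]
    exact Nat.le_ceil _
  have hlog : Real.log (2 * #(monos N k)) ≤ 2 * ((d : ℝ) + 1) ^ k :=
    (Real.log_le_self (by positivity)).trans (by
      have : (#(monos N k) : ℝ) ≤ ((d : ℝ) + 1) ^ k := by exact_mod_cast card_monos_le hN k
      gcongr)
  have hregret : Real.log (2 * #(monos N k)) / (s / (16 * lam) * R) ≤ s / (2 * lam) := by
    rw [div_le_div_iff₀ (by positivity) (by positivity)]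
    have : s * (s / (16 * lam) * R) = s ^ 2 * R / (16 * lam) := by ring
    rw [this, le_div_iff₀ (by positivity)]
    nlinarith [mul_le_mul_of_nonneg_right hlog (sq_nonneg lam)]
  calc empLoss i Z (descent d k lam ε i N Z)
      ≤ empLoss i Z q + lam * (Real.log (2 * #(monos N k)) / (s / (16 * lam) * R)
          + 8 * (s / (16 * lam))) :=
        empLoss_hedgeAvg_le ⟨∅, mem_monos.2 (by simp)⟩ hlam hstep hq.2.2
          (fun S hS => mem_monos.2 ⟨hq.1 S hS, hq.2.1 S hS⟩) i hR.ne' Z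
    _ ≤ empLoss i Z q + lam * (s / (2 * lam) + 8 * (s / (16 * lam))) := by gcongr
    _ = empLoss i Z q + s := by field_simp; ring

theorem inv_descentTarget_le (hd : 3 ≤ d) (hk : 1 ≤ k) (hlam : 0 ≤ lam) (hε : 0 < ε) :
    (descentTarget d k lam ε)⁻¹ ≤
      (d : ℝ) ^ ((13 + 4 * lam) * (k : ℝ) ^ 2) * (1 + 1 / ε) ^ 2 := by
  have hd1 : (1 : ℝ) ≤ d := by exact_mod_cast (by omega : 1 ≤ d)
  have hinv : 0 < 1 / ε := by positivity
  rcases min_choice ε (tolerance d k lam ε) with h | h <;> rw [descentTarget, h]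
  · calc ε⁻¹ ≤ (1 + 1 / ε) ^ 2 := by rw [← one_div]; nlinarith
      _ ≤ _ := le_mul_of_one_le_left (by positivity) (Real.one_le_rpow hd1 (by positivity))
  · calc (tolerance d k lam ε)⁻¹ ≤ (d : ℝ) ^ ((13 + 4 * lam) * (k : ℝ) ^ 2) / ε ^ 2 :=
        inv_tolerance_le hd hk hlam
      _ = (d : ℝ) ^ ((13 + 4 * lam) * (k : ℝ) ^ 2) * (1 / ε) ^ 2 := by ring
      _ ≤ _ := by gcongr; linarith

theorem descentRounds_le (hd : 3 ≤ d) (hk : 1 ≤ k) (hlam : 0 ≤ lam) (hε : 0 < ε) :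
    (descentRounds d k lam ε : ℝ) ≤ 64 * (d : ℝ) ^ (2 * k) * (d : ℝ) ^ (2 * lam)
      * ((d : ℝ) ^ ((13 + 4 * lam) * (k : ℝ) ^ 2) * (1 + 1 / ε) ^ 2) ^ 2 := by
  have hd3 : (3 : ℝ) ≤ d := by exact_mod_cast hd
  set v := (d : ℝ) ^ ((13 + 4 * lam) * (k : ℝ) ^ 2) * (1 + 1 / ε) ^ 2
  have hs : 0 < descentTarget d k lam ε := descentTarget_pos (by omega) hε
  have hv : 1 ≤ v := one_le_mul_of_one_le_of_one_le (Real.one_le_rpow (by linarith) (by positivity))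
    (one_le_pow₀ (le_add_of_nonneg_right (by positivity)))
  have hB : 1 ≤ (d : ℝ) ^ (2 * k) := one_le_pow₀ (by linarith)
  calc (descentRounds d k lam ε : ℝ)
      ≤ 64 * lam ^ 2 * ((d : ℝ) + 1) ^ k / descentTarget d k lam ε ^ 2 + 1 :=
        (Nat.ceil_lt_add_one (by positivity)).le
    _ = 64 * lam ^ 2 * ((d : ℝ) + 1) ^ k * ((descentTarget d k lam ε)⁻¹) ^ 2 + 1 := by ring
    _ ≤ 64 * lam ^ 2 * (d : ℝ) ^ (2 * k) * v ^ 2 + (d : ℝ) ^ (2 * k) * v ^ 2 := by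
        gcongr
        · exact add_one_pow_le_pow_two_mul hd3 k
        · exact inv_descentTarget_le hd hk hlam hε
        · exact one_le_mul_of_one_le_of_one_le hB (one_le_pow₀ hv)
    _ = (64 * lam ^ 2 + 1) * ((d : ℝ) ^ (2 * k) * v ^ 2) := by ring
    _ ≤ 64 * (1 + lam) ^ 2 * ((d : ℝ) ^ (2 * k) * v ^ 2) := by gcongr; nlinarith
    _ ≤ 64 * (d : ℝ) ^ (2 * lam) * ((d : ℝ) ^ (2 * k) * v ^ 2) := by
        gcongr
        exact one_add_sq_le_rpow (exp_one_le_natCast hd) hlam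
    _ = _ := by ring

theorem instruction_count_le (hd : 3 ≤ d) (hk : 1 ≤ k) (hlam₀ : 0 < lam₀) (hlam : lam₀ ≤ lam)
    (hε : 0 < ε) (hT : 0 < T) :
    ((88 * ((d + 1) ^ k * T) ^ 4 * descentRounds d k lam ε : ℕ) : ℝ) ≤
      mainConst lam₀ * (d : ℝ) ^ (mainConst lam₀ * lam * (k : ℝ) ^ 2) *
        ((T : ℝ) * (1 + 1 / ε)) ^ mainConst lam₀ := by
  have hl : 0 < lam := hlam₀.trans_le hlam
  have hC := ten_le_mainConst hlam₀
  have hd3 : (3 : ℝ) ≤ d := by exact_mod_cast hd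
  have hd0 : (0 : ℝ) < d := by linarith
  have hk1 : (1 : ℝ) ≤ k := by exact_mod_cast hk
  have hk2 : 1 ≤ (k : ℝ) ^ 2 := one_le_pow₀ hk1
  have hTw : 1 ≤ T * (1 + 1 / ε) := one_le_mul_of_one_le_of_one_le (by exact_mod_cast hT)
    (le_add_of_nonneg_right (by positivity))
  push_cast
  calc 88 * (((d : ℝ) + 1) ^ k * T) ^ 4 * descentRounds d k lam ε
      ≤ 88 * ((d : ℝ) ^ (2 * k) * T) ^ 4 * (64 * (d : ℝ) ^ (2 * k) * (d : ℝ) ^ (2 * lam)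
          * ((d : ℝ) ^ ((13 + 4 * lam) * (k : ℝ) ^ 2) * (1 + 1 / ε) ^ 2) ^ 2) := by
        gcongr
        · exact add_one_pow_le_pow_two_mul hd3 k
        · exact descentRounds_le hd hk hl.le hε
    _ = 5632 * (((d : ℝ) ^ (2 * k)) ^ 5 * (d : ℝ) ^ (2 * lam)
          * ((d : ℝ) ^ ((13 + 4 * lam) * (k : ℝ) ^ 2)) ^ 2) * (T * (1 + 1 / ε)) ^ 4 := by ring
    _ ≤ (d : ℝ) ^ 8 * (((d : ℝ) ^ (2 * k)) ^ 5 * (d : ℝ) ^ (2 * lam)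
          * ((d : ℝ) ^ ((13 + 4 * lam) * (k : ℝ) ^ 2)) ^ 2) * (T * (1 + 1 / ε)) ^ 4 := by
        gcongr
        exact (by norm_num : (5632 : ℝ) ≤ 3 ^ 8).trans (by gcongr)
    _ = (d : ℝ) ^ (8 + 10 * k + 2 * lam + (13 + 4 * lam) * (k : ℝ) ^ 2 * 2)
          * (T * (1 + 1 / ε)) ^ (4 : ℝ) := by
        simp only [← Real.rpow_natCast, ← Real.rpow_mul hd0.le, ← Real.rpow_add hd0]
        push_cast
        simp only [Real.rpow_two]
        ring_nf
    _ ≤ (d : ℝ) ^ (mainConst lam₀ * lam * (k : ℝ) ^ 2)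
          * (T * (1 + 1 / ε)) ^ mainConst lam₀ := by
        gcongr ?_ * ?_
        · exact rpow_le_rpow_mainConst hd hlam₀ hlam
            (by nlinarith [mul_le_mul_of_nonneg_left hk2 hl.le])
        · exact Real.rpow_le_rpow_of_exponent_le hTw (by linarith)
    _ ≤ _ := by
        rw [mul_assoc (mainConst lam₀) (_ ^ _)]
        exact le_mul_of_one_le_left (by positivity) (by linarith : 1 ≤ mainConst lam₀)

theorem exists_computes_assemble_descent {N : Fin n → Finset (Fin n)} (hN : ∀ i, #(N i) ≤ d)
    (hn : 1 ≤ n) (hd : 3 ≤ d) (hk : 1 ≤ k) (hlam₀ : 0 < lam₀) (hlam : lam₀ ≤ lam) (hε : 0 < ε)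
    (hT : 0 < T) :
    ∃ (m : ℕ) (R : Set ((Fin n → Fin T → Config n) → ℝ)), Computes (dataInputs T N) m R ∧
      (∀ S, (fun z => assemble (fun i => descent d k lam ε i (N i) (z i)) S) ∈ R) ∧
      (m : ℝ) ≤ n * (mainConst lam₀ * (d : ℝ) ^ (mainConst lam₀ * lam * (k : ℝ) ^ 2) *
        ((T : ℝ) * (1 + 1 / ε)) ^ mainConst lam₀) := by
  have hpow : 0 < (d + 1) ^ k := by positivity
  have hle : (d + 1) ^ k ≤ (d + 1) ^ k * T := Nat.le_mul_of_pos_right _ hT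
  obtain ⟨R, hR, hmem⟩ := exists_computes_assemble_hedgeAvg hn (Nat.mul_pos hpow hT)
    ((Nat.lt_pow_self (by omega)).le.trans hle) (fun i => (card_monos_le (hN i) k).trans hle)
    (Nat.le_mul_of_pos_left T hpow) lam (descentStep d k lam ε)
    (descentRounds_pos (d := d) (k := k) (by omega) (hlam₀.trans_le hlam) hε)
  refine ⟨_, R, hR, hmem, ?_⟩
  rw [Nat.cast_mul]
  gcongr
  exact instruction_count_le hd hk hlam₀ hlam hε hT

theorem IsGlauber.one_sub_le_measureReal_assemble_descent {ψ : MPoly n} {Ω : Type*}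
    [MeasurableSpace Ω] {P : Measure Ω} [IsProbabilityMeasure P] {X : ℕ → Ω → Config n}
    {U : ℕ → Ω → Fin n} (hG : IsGlauber ψ P X U) (hM : IsMRF k d lam ψ) (hn : 1 ≤ n) (hd : 3 ≤ d)
    (hk : 1 ≤ k) (hlam₀ : 0 < lam₀) (hlam : lam₀ ≤ lam) (hε : 0 < ε) (hδ : 0 < δ) (hδ1 : δ < 1)
    (hT : sampleBound (mainConst lam₀) k d lam ε (δ / n) ≤ T) :
    1 - δ ≤ P.real {ω | (assemble (fun i =>
      descent d k lam ε i (neighbors ψ i) (samples d X U i T ω)) - ψ.dropConst).supNorm ≤ ε} := by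
  have hl : 0 < lam := hlam₀.trans_le hlam
  refine (hG.one_sub_le_measureReal_forall_lossIdentifies hM hn hd hk hlam₀ hlam hε hδ hδ1
    hT).trans (measureReal_mono fun ω hω => ?_)
  refine supNorm_assemble_sub_le hε.le fun i => hω i _ (hedgeAvg_mem_feasible i _ k hl.le _ _ _) ?_
  exact (empLoss_descent_le (by omega) hl hε i (hM.card_neighbors i) _
    (hM.pderiv_mem_feasible i)).trans (by gcongr; exact min_le_right _ _)

end Descent

end

end GlauberMRF

theorem mainTheorem2 (lam₀ : ℝ) (hlam₀ : 0 < lam₀) :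
    ∃ C : ℝ, 0 < C ∧
    -- a single node
    (∀ (n d k T : ℕ) (lam ε δ : ℝ), 3 ≤ d → 1 ≤ k → lam₀ ≤ lam → 0 < ε → 0 < δ → δ < 1 →
      sampleBound C k d lam ε δ ≤ T →
      ∀ (ψ : MPoly n), IsMRF k d lam ψ →
      ∀ (Ω : Type*) [MeasurableSpace Ω] (P : MeasureTheory.Measure Ω)
        [MeasureTheory.IsProbabilityMeasure P] (X : ℕ → Ω → Config n) (U : ℕ → Ω → Fin n),
        IsGlauber ψ P X U → ∀ i : Fin n,
        1 - δ ≤ P.real {ω |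
          (∃ p, IsLogReg i (neighbors ψ i) k lam (samples d X U i T ω) p) ∧
          ∀ p, IsLogReg i (neighbors ψ i) k lam (samples d X U i T ω) p →
            (p - ψ.pderiv i).supNorm ≤ ε}) ∧
    -- all nodes
    (∀ (n d k T : ℕ) (lam ε δ : ℝ), 1 ≤ n → 3 ≤ d → 1 ≤ k → lam₀ ≤ lam → 0 < ε → 0 < δ → δ < 1 →
      sampleBound C k d lam ε (δ / n) ≤ T →
      ∀ (ψ : MPoly n), IsMRF k d lam ψ →
      ∀ (Ω : Type*) [MeasurableSpace Ω] (P : MeasureTheory.Measure Ω)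
        [MeasureTheory.IsProbabilityMeasure P] (X : ℕ → Ω → Config n) (U : ℕ → Ω → Fin n),
        IsGlauber ψ P X U →
        1 - δ ≤ P.real {ω |
          (∃ p : Fin n → MPoly n,
            ∀ i, IsLogReg i (neighbors ψ i) k lam (samples d X U i T ω) (p i)) ∧
          ∀ p : Fin n → MPoly n,
            (∀ i, IsLogReg i (neighbors ψ i) k lam (samples d X U i T ω) (p i)) →
            (assemble p - ψ.dropConst).supNorm ≤ ε}) ∧
    -- efficient construction, the neighborhoods `N` being known
    (∀ (n d k T : ℕ) (lam ε δ : ℝ), 1 ≤ n → 3 ≤ d → 1 ≤ k → lam₀ ≤ lam → 0 < ε → 0 < δ → δ < 1 →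
      sampleBound C k d lam ε (δ / n) ≤ T →
      ∀ N : Fin n → Finset (Fin n), (∀ i, (N i).card ≤ d) →
      ∃ (q : Fin n → (Fin T → Config n) → MPoly n) (m : ℕ)
        (R : Set ((Fin n → Fin T → Config n) → ℝ)),
        (∀ i Z, q i Z ∈ feasible (N i) k lam ∧
          ∀ p ∈ feasible (N i) k lam, empLoss i Z (q i Z) ≤ empLoss i Z p + ε) ∧
        Computes (dataInputs T N) m R ∧
        (∀ S, (fun z => assemble (fun i => q i (z i)) S) ∈ R) ∧
        (m : ℝ) ≤ n * (C * (d : ℝ) ^ (C * lam * (k : ℝ) ^ 2) * ((T : ℝ) * (1 + 1 / ε)) ^ C) ∧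
        ∀ (ψ : MPoly n), IsMRF k d lam ψ → (∀ i, neighbors ψ i = N i) →
        ∀ (Ω : Type*) [MeasurableSpace Ω] (P : MeasureTheory.Measure Ω)
          [MeasureTheory.IsProbabilityMeasure P] (X : ℕ → Ω → Config n) (U : ℕ → Ω → Fin n),
          IsGlauber ψ P X U →
          1 - δ ≤ P.real {ω |
            (assemble (fun i => q i (samples d X U i T ω)) - ψ.dropConst).supNorm ≤ ε}) := by
  refine ⟨mainConst lam₀, by linarith [ten_le_mainConst hlam₀], ?_, ?_, ?_⟩
  · intro n d k T lam ε δ hd hk hlam hε hδ hδ1 hT ψ hM Ω _ P _ X U hG i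
    exact hG.one_sub_le_measureReal_isLogReg hM hd hk hlam₀ hlam hε hδ hδ1 hT i
  · intro n d k T lam ε δ hn hd hk hlam hε hδ hδ1 hT ψ hM Ω _ P _ X U hG
    exact hG.one_sub_le_measureReal_forall_isLogReg hM hn hd hk hlam₀ hlam hε hδ hδ1 hT
  · intro n d k T lam ε δ hn hd hk hlam hε hδ hδ1 hT N hN
    have hl : 0 < lam := hlam₀.trans_le hlam
    have hn1 : (1 : ℝ) ≤ n := by exact_mod_cast hn
    have hT0 : 0 < T := natCast_pos_of_sampleBound_le hd hk hlam₀ hlam hε (by positivity)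
      ((div_le_self hδ.le hn1).trans_lt hδ1) hT
    obtain ⟨m, R, hR, hmem, hm⟩ :=
      exists_computes_assemble_descent hN hn hd hk hlam₀ hlam hε hT0
    refine ⟨fun i => descent d k lam ε i (N i), m, R, fun i Z =>
      ⟨hedgeAvg_mem_feasible i _ k hl.le _ _ Z, fun p hp => ?_⟩, hR, hmem, hm, ?_⟩
    · exact (empLoss_descent_le (by omega) hl hε i (hN i) Z hp).trans
        (by gcongr; exact min_le_left _ _)
    · intro ψ hM hψ Ω _ P _ X U hG
      obtain rfl : neighbors ψ = N := funext hψ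
      exact hG.one_sub_le_measureReal_assemble_descent hM hn hd hk hlam₀ hlam hε hδ hδ1 hT
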